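/- Let $\mathcal R=\mathbb Q(\mathrm{Re})\{p,u,v,w\}$ be the differential polynomial ring with commuting derivations $\partial_t,\partial_1,\partial_2,\partial_3$, put $(u_1,u_2,u_3)=(u,v,w)$, $\nabla^2=\sum_j\partial_j^2$, and let $$F_0=\sum_j\partial_j u_j,\qquad F_i=\partial_t u_i+\sum_j\partial_j(u_iu_j)+\partial_i p-\tfrac1{\mathrm{Re}}\nabla^2u_i\quad(i=1,2,3),$$ $$F_4=\sum_i\partial_iF_i+\tfrac1{\mathrm{Re}}\nabla^2F_0-\partial_tF_0 .$$ Let $\tilde{\mathcal R}$ be the ring of difference polynomials over $\mathbb Q(\mathrm{Re},\tau,h_1,h_2,h_3)$, i.e. of polynomials in the shifts $\sigma_t^{k_0}\sigma_1^{k_1}\sigma_2^{k_2}\sigma_3^{k_3}\tilde y$ with $k\in\mathbb Z^4$ and $\tilde y\in\{\tilde p,\tilde u,\tilde v,\tilde w\}$. With $$D_t=\frac{\sigma_t-1}{\tau},\qquad D_i=\frac{\sigma_i-\sigma_i^{-1}}{2h_i},\qquad \tilde\Delta=\sum_{j=1}^3\frac{\sigma_j-2+\sigma_j^{-1}}{h_j^2}$$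 let $$\tilde F_0=\sum_jD_j\tilde u_j,\qquad \tilde F_i=D_t\tilde u_i+\sum_jD_j(\tilde u_i\tilde u_j)+D_i\tilde p-\tfrac1{\mathrm{Re}}\tilde\Delta\tilde u_i\quad(i=1,2,3),$$ $$\tilde F_4=\sum_iD_iD_i\tilde p+\sum_iD_iD_i(\tilde u_i^2)+2\sum_{i<j}D_iD_j(\tilde u_i\tilde u_j)-\tfrac1{\mathrm{Re}}\sum_iD_i\tilde\Delta\tilde u_i .$$ For a difference polynomial $\tilde f$ and a set $R$ of differential polynomials write $\tilde f\rhd R$ if there is a non-zero polynomial $q$ in the grid spacings $(\tau,h_1,h_2,h_3)$, over $\mathbb Q(\mathrm{Re})$, such that $q\tilde f$ has coefficients polynomial in the grid spacings and its formal Taylor expansion about a grid point is $\sum_{k=1}^K m_kr_k$ plus terms of total degree $>d$ in the grid spacings, with $K\ge1$, $d>0$, distinct monomials $m_k$ of degree $d$ in the grid spacings, and non-zero $r_k\in\mathcal R$, $R=\{r_1,\dots,r_K\}$. Let $[\![F]\!]$ be the radical differential ideal generated by $F=\{F_0,\dots,F_4\}$. Let $[\![\tilde F]\!]$ be the perfect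 closure of $\tilde F=\{\tilde F_0,\dots,\tilde F_4\}$: the smallest ideal of $\tilde{\mathcal R}$ that contains $\tilde F$, is closed under $\sigma_t,\sigma_1,\sigma_2,\sigma_3$, and contains $\tilde f$ whenever it contains a product $(\theta_1\tilde f)^{k_1}\cdots(\theta_r\tilde f)^{k_r}$ with $k_j\ge0$ and $\theta_j$ power products of the $\sigma$'s with non-negative exponents. Let $[\tilde F]$ be the smallest ideal of $\tilde{\mathcal R}$ that contains $\tilde F$ and is closed under all $\sigma_t^{\pm1},\sigma_1^{\pm1},\sigma_2^{\pm1},\sigma_3^{\pm1}$. Then: 1. $\tilde F$ is a finite difference approximation: $\tilde F_j\rhd\{F_j\}$ for $j=0,1,2,3$, and $\tilde F_4\rhd\{F_4-\frac1{\mathrm{Re}}\nabla^2F_0\}$. 2. $\tilde F$ is s-consistent with $F$: for every non-zero $\tilde f\in[\![\tilde F]\!]$ there is a set $R\subseteq[\![F]\!]$ with $\tilde f\rhd R$. 3. Rank the variables with non-negative shifts by comparing first the shifts lexicographically with $\sigma_t\succ\sigma_1\succ\sigma_2\succ\sigma_3$ and then $\tilde p\succ\tilde u\succ\tilde v\succ\tilde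 w$. The pure lexicographic monomial ordering of this ranking is an admissible difference monomial ordering. With negative shifts removed by right shifts, the polynomials $$\sigma_1^2\sigma_2^2\sigma_3^2\tilde F_0,\quad \sigma_1\sigma_2\sigma_3\tilde F_1,\quad \sigma_1\sigma_2\sigma_3\tilde F_2,\quad \sigma_1\sigma_2\sigma_3\tilde F_3,\quad \sigma_1^2\sigma_2^2\sigma_3^2\tilde F_4$$ form, for this ordering, a head-reduced difference Gröbner basis of the difference ideal that they generate in the ring of difference polynomials with non-negative shifts (ideals closed under $\sigma_t,\sigma_1,\sigma_2,\sigma_3$): the leading monomial of each non-zero element of that ideal is of the form $t\cdot\theta\operatorname{lm}(g)$ with $g$ one of the five polynomials, $t$ a difference monomial and $\theta$ a power product of the $\sigma$'s with non-negative exponents, and no leading monomial of one of the five has this form with respect to another one. An element $\tilde f\in\tilde{\mathcal R}$ lies in $[\tilde F]$ if and only if $\theta\tilde f$ lies in that difference ideal for some such $\theta$. 4. $[\tilde F]=[\![\tilde F]\!]$. -/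

import Mathlib

open MvPolynomial

noncomputable section

namespace NavierStokes

/-! ### Indices

Independent variables (directions) are indexed by `Fin 4`: `0` is time `t`, and `1, 2, 3` are the
space coordinates.  Dependent variables are indexed by `Fin 4` too: `0` is the pressure `p`, and
`1, 2, 3` are the velocity components `u, v, w`.  So for `i : Fin 3` the index `i.succ` is the
`i`-th velocity component, respectively the `i`-th space direction. -/

/-! ### The differential side -/

/-- The coefficient field `ℚ(Re)`. -/
abbrev CoeffField : Type := RatFunc ℚ

/-- The Reynolds number, a parameter. -/
def reynolds : CoeffField := RatFunc.X

/-- The differential polynomial ring `ℚ(Re){p, u, v, w}` with four commuting derivations.  The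
variable `X (α, k)` is the derivative `∂ᵏ` of the dependent variable `α`. -/
abbrev DiffPoly : Type := MvPolynomial (Fin 4 × (Fin 4 → ℕ)) CoeffField

/-- The derivation `∂ᵢ`. -/
def deriv (i : Fin 4) : Derivation CoeffField DiffPoly DiffPoly :=
  mkDerivation CoeffField fun x => X (x.1, x.2 + Pi.single i 1)

/-- The dependent variables as differential polynomials. -/
def dvar (α : Fin 4) : DiffPoly := X (α, 0)

/-- The velocity components `u, v, w`. -/
def vel (i : Fin 3) : DiffPoly := dvar i.succ

/-- The pressure `p`. -/
def pres : DiffPoly := dvar 0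

/-- The operator `∇² = ∂₁² + ∂₂² + ∂₃²`. -/
def laplace (f : DiffPoly) : DiffPoly := ∑ j : Fin 3, deriv j.succ (deriv j.succ f)

/-- The continuity equation `F₀ = ∂₁ u + ∂₂ v + ∂₃ w`. -/
def continuityEq : DiffPoly := ∑ j : Fin 3, deriv j.succ (vel j)

/-- The momentum equations `F₁, F₂, F₃` in divergence form. -/
def momentumEq (i : Fin 3) : DiffPoly :=
  deriv 0 (vel i) + ∑ j : Fin 3, deriv j.succ (vel i * vel j) + deriv i.succ pres
    - reynolds⁻¹ • laplace (vel i)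

/-- The pressure Poisson equation
`F₄ = ∂₁ F₁ + ∂₂ F₂ + ∂₃ F₃ + (1 / Re) ∇² F₀ - ∂ₜ F₀`. -/
def poissonEq : DiffPoly :=
  ∑ i : Fin 3, deriv i.succ (momentumEq i) + reynolds⁻¹ • laplace continuityEq
    - deriv 0 continuityEq

/-- The system `F₀, …, F₄`. -/
def pdeSystem : Fin 5 → DiffPoly :=
  ![continuityEq, momentumEq 0, momentumEq 1, momentumEq 2, poissonEq]

/-- The radical differential ideal generated by a set of differential polynomials. -/
def radicalDifferentialIdeal (F : Set DiffPoly) : Ideal DiffPoly :=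
  sInf {I | F ⊆ I ∧ I.IsRadical ∧ ∀ i : Fin 4, ∀ f ∈ I, deriv i f ∈ I}

/-! ### The difference side -/

/-- Polynomials `ℚ(Re)[τ, h₁, h₂, h₃]` in the grid spacings; `X 0` is the time step `τ`, and
`X 1, X 2, X 3` are the mesh sizes `h₁, h₂, h₃`. -/
abbrev StepPoly : Type := MvPolynomial (Fin 4) CoeffField

/-- The field `ℚ(Re, τ, h₁, h₂, h₃)`. -/
abbrev StepField : Type := FractionRing StepPoly

/-- Difference polynomials over `ℚ(Re, τ, h₁, h₂, h₃)` in the dependent variables `p, u, v, w`,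
with shift exponents in `S`.  The variable `X (α, k)` is the shift `σᵏ` of the variable `α`. -/
abbrev ShiftPoly (S : Type) : Type := MvPolynomial (Fin 4 × (Fin 4 → S)) StepField

/-- The action of the shift `σˢ = σ₀^{s₀} ⋯ σ₃^{s₃}` on difference polynomials. -/
def shift {S : Type} [Add S] (s : Fin 4 → S) : ShiftPoly S →ₐ[StepField] ShiftPoly S :=
  rename fun x => (x.1, x.2 + s)

/-- The inclusion of the difference polynomials with non-negative shifts into the ring of
difference polynomials with arbitrary integer shifts. -/
def natInclusion : ShiftPoly ℕ →ₐ[StepField] ShiftPoly ℤ :=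
  rename fun x => (x.1, fun i => (x.2 i : ℤ))

/-- The grid spacing in direction `i` (`τ` for `i = 0`), as an element of the coefficient field. -/
def step (i : Fin 4) : StepField := algebraMap StepPoly StepField (X i)

/-- `1 / Re` as an element of the coefficient field of the difference polynomials. -/
def invRe : StepField := algebraMap StepPoly StepField (C reynolds⁻¹)

/-- The forward difference `D_t = (σ_t - 1) / τ`. -/
def Dt (f : ShiftPoly ℤ) : ShiftPoly ℤ := (step 0)⁻¹ • (shift (Pi.single 0 1) f - f)

/-- The central differences `D_i = (σ_i - σ_i⁻¹) / (2 h_i)`. -/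
def Dx (i : Fin 3) (f : ShiftPoly ℤ) : ShiftPoly ℤ :=
  (2 * step i.succ)⁻¹ • (shift (Pi.single i.succ 1) f - shift (Pi.single i.succ (-1)) f)

/-- The discrete Laplacian `∑ⱼ (σⱼ - 2 + σⱼ⁻¹) / hⱼ²`. -/
def discreteLaplace (f : ShiftPoly ℤ) : ShiftPoly ℤ :=
  ∑ j : Fin 3, (step j.succ ^ 2)⁻¹ •
    (shift (Pi.single j.succ 1) f - 2 * f + shift (Pi.single j.succ (-1)) f)

/-- The grid functions for the velocity components. -/
def gridVel (i : Fin 3) : ShiftPoly ℤ := X (i.succ, 0)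

/-- The grid function for the pressure. -/
def gridPres : ShiftPoly ℤ := X (0, 0)

/-- The discrete continuity equation `F̃₀`. -/
def discreteContinuity : ShiftPoly ℤ := ∑ j : Fin 3, Dx j (gridVel j)

/-- The discrete momentum equations `F̃₁, F̃₂, F̃₃`. -/
def discreteMomentum (i : Fin 3) : ShiftPoly ℤ :=
  Dt (gridVel i) + ∑ j : Fin 3, Dx j (gridVel i * gridVel j) + Dx i gridPres
    - invRe • discreteLaplace (gridVel i)

/-- The discrete pressure Poisson equation `F̃₄`. -/
def discretePoisson : ShiftPoly ℤ :=
  ∑ i : Fin 3, Dx i (Dx i gridPres) + ∑ i : Fin 3, Dx i (Dx i (gridVel i ^ 2))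
    + 2 * (Dx 0 (Dx 1 (gridVel 0 * gridVel 1)) + Dx 0 (Dx 2 (gridVel 0 * gridVel 2))
      + Dx 1 (Dx 2 (gridVel 1 * gridVel 2)))
    - invRe • ∑ i : Fin 3, Dx i (discreteLaplace (gridVel i))

/-- The difference approximation `F̃₀, …, F̃₄`. -/
def discreteSystem : Fin 5 → ShiftPoly ℤ :=
  ![discreteContinuity, discreteMomentum 0, discreteMomentum 1, discreteMomentum 2,
    discretePoisson]

/-- The difference ideal generated by a set of difference polynomials with non-negative shifts. -/
def differenceIdeal (G : Set (ShiftPoly ℕ)) : Ideal (ShiftPoly ℕ) :=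
  sInf {I | G ⊆ I ∧ ∀ i : Fin 4, ∀ f ∈ I, shift (Pi.single i 1) f ∈ I}

/-- The difference ideal generated by a set of difference polynomials with integer shifts, for the
differences `σᵢ` and `σᵢ⁻¹`. -/
def inversiveDifferenceIdeal (G : Set (ShiftPoly ℤ)) : Ideal (ShiftPoly ℤ) :=
  sInf {I | G ⊆ I ∧ ∀ i : Fin 4, ∀ f ∈ I,
    shift (Pi.single i 1) f ∈ I ∧ shift (Pi.single i (-1)) f ∈ I}

/-- The perfect difference ideal (perfect closure) generated by a set: the smallest ideal that
contains the set, is closed under the `σᵢ`, and contains `f` whenever it contains a product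
`(θ₁ f)^{k₁} ⋯ (θᵣ f)^{kᵣ}` with power products `θⱼ` of the `σᵢ`. -/
def perfectDifferenceIdeal (G : Set (ShiftPoly ℤ)) : Ideal (ShiftPoly ℤ) :=
  sInf {I | G ⊆ I ∧ (∀ i : Fin 4, ∀ f ∈ I, shift (Pi.single i 1) f ∈ I) ∧
    ∀ (f : ShiftPoly ℤ) (r : ℕ) (θ : Fin r → Fin 4 → ℕ) (k : Fin r → ℕ),
      ∏ j, shift (fun i => (θ j i : ℤ)) f ^ k j ∈ I → f ∈ I}

/-! ### Taylor expansion and consistency -/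

/-- Taylor expansion of the shifted grid function `σᵃ u^(α)`: the coefficient of the monomial
`τ^{k₀} h₁^{k₁} h₂^{k₂} h₃^{k₃}` is `(∏ᵢ aᵢ^{kᵢ} / kᵢ!) ∂ᵏ u^(α)`. -/
def taylorVar (x : Fin 4 × (Fin 4 → ℤ)) : MvPowerSeries (Fin 4) DiffPoly :=
  fun k => (∏ i, ((x.2 i : CoeffField) ^ k i / ((k i).factorial : CoeffField))) • X (x.1, ⇑k)

/-- Taylor expansion about a grid point of a difference polynomial whose coefficients are
polynomials in the grid spacings, as a formal power series in the grid spacings with differential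
polynomials as coefficients. -/
def taylor : MvPolynomial (Fin 4 × (Fin 4 → ℤ)) StepPoly →+* MvPowerSeries (Fin 4) DiffPoly :=
  eval₂Hom (coeToMvPowerSeries.ringHom.comp (MvPolynomial.map C)) taylorVar

/-- The relation `f ▷ R`: after multiplication of the difference polynomial `f` by a suitable
non-zero `q` that clears denominators, the Taylor expansion is
`∑ₖ mₖ rₖ + (terms of degree > d in the grid spacings)`, where the `mₖ` are distinct monomials of
degree `d > 0` in the grid spacings, and the `rₖ`, which form the set `R`, are non-zero
differential polynomials. -/
def Implies (f : ShiftPoly ℤ) (R : Set DiffPoly) : Prop :=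
  ∃ q : StepPoly, q ≠ 0 ∧
  ∃ P : MvPolynomial (Fin 4 × (Fin 4 → ℤ)) StepPoly,
    MvPolynomial.map (algebraMap StepPoly StepField) P
      = C (algebraMap StepPoly StepField q) * f ∧
  ∃ d : ℕ, 0 < d ∧ ∃ K : ℕ, 0 < K ∧
  ∃ (m : Fin K → Fin 4 →₀ ℕ) (r : Fin K → DiffPoly),
    Function.Injective m ∧ (∀ k, (m k).degree = d) ∧ (∀ k, r k ≠ 0) ∧ R = Set.range r ∧
    ∀ n : Fin 4 →₀ ℕ, n.degree ≤ d →
      MvPowerSeries.coeff n (taylor P) = ∑ k, if m k = n then r k else 0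

/-- s-consistency (strong consistency) of a difference system with a differential system: every
non-zero element of the perfect difference ideal implies a set of elements of the radical
differential ideal. -/
def SConsistent (G : Set (ShiftPoly ℤ)) (F : Set DiffPoly) : Prop :=
  ∀ f ∈ perfectDifferenceIdeal G, f ≠ 0 →
    ∃ R : Set DiffPoly, R ⊆ radicalDifferentialIdeal F ∧ Implies f R

/-! ### Difference Gröbner bases -/

/-- The shifts `σᵏ u^(α)` with non-negative `k`. -/
abbrev Var : Type := Fin 4 × (Fin 4 → ℕ)

/-- Difference monomials, given by their exponents. -/
abbrev Mon : Type := Var →₀ ℕ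

/-- The action of `σˢ` on difference monomials. -/
def monShift (s : Fin 4 → ℕ) (v : Mon) : Mon := v.mapDomain fun x => (x.1, x.2 + s)

/-- `rk x y` (read: `y` ranks higher than `x`) is a ranking. -/
structure IsRanking (rk : Var → Var → Prop) : Prop where
  total : IsStrictTotalOrder Var rk
  shift_gt : ∀ (α : Fin 4) (k : Fin 4 → ℕ), k ≠ 0 → rk (α, 0) (α, k)
  shift_mono : ∀ (α β : Fin 4) (k l s : Fin 4 → ℕ), rk (β, l) (α, k) → rk (β, l + s) (α, k + s)

/-- `lt v w` (read: `w` is greater than `v`) is an admissible difference monomial ordering that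
extends the ranking `rk`. -/
structure IsAdmissibleOrdering (rk : Var → Var → Prop) (lt : Mon → Mon → Prop) : Prop where
  total : IsStrictTotalOrder Mon lt
  ranking : IsRanking rk
  extends_ranking : ∀ x y : Var, rk x y ↔ lt (Finsupp.single x 1) (Finsupp.single y 1)
  one_lt : ∀ t : Mon, t ≠ 0 → lt 0 t
  mul_shift : ∀ (s : Fin 4 → ℕ) (t v w : Mon),
    lt w v ↔ lt (t + monShift s w) (t + monShift s v)

/-- `m` is the leading monomial of `f`. -/
def IsLeadingMon (lt : Mon → Mon → Prop) (f : ShiftPoly ℕ) (m : Mon) : Prop :=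
  m ∈ f.support ∧ ∀ m' ∈ f.support, m' ≠ m → lt m' m

/-- Divisibility `v ∣ w` of difference monomials: `w = t · θ ∘ v`. -/
def MonDvd (v w : Mon) : Prop := ∃ (t : Mon) (s : Fin 4 → ℕ), w = t + monShift s v

/-- `f` is head reducible modulo `g`. -/
def HeadReducible (lt : Mon → Mon → Prop) (f g : ShiftPoly ℕ) : Prop :=
  ∃ mf mg : Mon, IsLeadingMon lt f mf ∧ IsLeadingMon lt g mg ∧ MonDvd mg mf

/-- `G` is a difference Gröbner basis of the difference ideal `I`. -/
def IsGroebnerBasis (lt : Mon → Mon → Prop) (G : Set (ShiftPoly ℕ)) (I : Ideal (ShiftPoly ℕ)) :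
    Prop :=
  differenceIdeal G = I ∧ ∀ f ∈ I, f ≠ 0 → ∃ g ∈ G, HeadReducible lt f g

/-- `G` is head reduced: no element is head reducible modulo another one. -/
def IsHeadReduced (lt : Mon → Mon → Prop) (G : Set (ShiftPoly ℕ)) : Prop :=
  ∀ f ∈ G, ∀ g ∈ G \ {f}, ¬ HeadReducible lt f g

/-- The ranking that first compares shifts lexicographically with `σ_t ≻ σ₁ ≻ σ₂ ≻ σ₃`, and then
dependent variables with `p ≻ u ≻ v ≻ w`; `rankLT x y` means that `y` ranks higher. -/
def rankLT (x y : Var) : Prop :=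
  toLex x.2 < toLex y.2 ∨ x.2 = y.2 ∧ y.1 < x.1

/-- The pure lexicographic monomial ordering of the above ranking: the exponents of the highest
ranked variable that occurs with different exponents are compared. -/
def lexLT (v w : Mon) : Prop :=
  ∃ x : Var, v x < w x ∧ ∀ y : Var, rankLT x y → v y = w y

/-- The power products of right shifts by which the negative shifts are removed from
`F̃₀, …, F̃₄`: `σ₁² σ₂² σ₃²` for `F̃₀` and `F̃₄`, and `σ₁ σ₂ σ₃` for `F̃₁, F̃₂, F̃₃`. -/
def clearing : Fin 5 → Fin 4 → ℤ :=
  ![![0, 2, 2, 2], ![0, 1, 1, 1], ![0, 1, 1, 1], ![0, 1, 1, 1], ![0, 2, 2, 2]]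

end NavierStokes

end

/-! Both systems are linear in well-chosen leading variables, and one integrability condition makes
the resulting rewriting rules complete. On the difference side the leading variables are shifts of
`u` (continuity), of `u, v, w` one time step later (momentum) and of `p` (Poisson). Rules are needed
only for all shifts of the last four equations and for the shifts of continuity that do not involve
time: by `Dt_discreteContinuity`, the forward time difference of the discrete continuity equation is
the discrete divergence of the momentum equations minus the Poisson equation, so its later shifts
follow. The leading variables of these rules are distinct and every tail lies in lower ranked
variables, so recursive substitution defines a ring homomorphism `φ` of the polynomial ring whose
kernel is exactly the difference ideal (`exists_normalForm`).

Two consequences are immediate. A monomial without leading variables is fixed by `φ` and cannot be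
cancelled by images of smaller monomials, so the leading monomial of a kernel element contains a
leading variable: this is the Gröbner property. The kernel of a homomorphism into a domain is prime,
so the inversive ideal is prime; it is therefore perfect, and conversely a perfect ideal is
automatically closed under inverse shifts.

For s-consistency, the generic solution of the differential system is deformed into a formal power
series solution of the discrete one. Taylor expansion turns each discrete equation into a power
series in the grid spacings whose constant term is the corresponding differential equation, once the
Poisson equation is corrected by a multiple of the discrete Laplacian of continuity. These series
and their derivatives are again triangular, so `IsTriangular.exists_isSolution` gives a homomorphism
`E` from differential polynomials to power series that kills them and whose constant part is the
identity modulo the differential ideal. If `f` lies in the difference ideal, some right shift of `f`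
has a Taylor expansion killed by `E`. A right shift does not change the terms of lowest degree, and
on these `E` acts through its constant part, so every lowest coefficient lies in the differential
ideal. Injectivity of Taylor expansion (`taylor_ne_zero`) guarantees that there are lowest terms. -/

noncomputable section

namespace NavierStokes

/-! ### Extension of homomorphisms to formal power series -/

section Extend

variable {σ A B : Type*} [DecidableEq σ] [CommRing A] [CommRing B]

/-- The extension of a map `E : A → B⟦h⟧` to `A⟦h⟧` that fixes the variables `h`. -/
def extendFun (E : A → MvPowerSeries σ B) (f : MvPowerSeries σ A) : MvPowerSeries σ B :=
  fun n => ∑ p ∈ Finset.HasAntidiagonal.antidiagonal n,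
    MvPowerSeries.coeff p.2 (E (MvPowerSeries.coeff p.1 f))

theorem coeff_extendFun (E : A → MvPowerSeries σ B) (f : MvPowerSeries σ A) (n : σ →₀ ℕ) :
    MvPowerSeries.coeff n (extendFun E f) = ∑ p ∈ Finset.HasAntidiagonal.antidiagonal n,
      MvPowerSeries.coeff p.2 (E (MvPowerSeries.coeff p.1 f)) := rfl

/-- The extension of a ring homomorphism `E : A → B⟦h⟧` to `A⟦h⟧` that fixes the variables `h`. -/
def extend (E : A →+* MvPowerSeries σ B) : MvPowerSeries σ A →+* MvPowerSeries σ B where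
  toFun := extendFun E
  map_zero' := by
    ext n
    simp [coeff_extendFun]
  map_one' := by
    ext n
    rw [coeff_extendFun, Finset.sum_eq_single (0, n)]
    · simp
    · rintro ⟨a, b⟩ hab hne
      have ha : a ≠ 0 := by
        rintro rfl
        simp_all
      simp [MvPowerSeries.coeff_one, ha]
    · simp
  map_add' f g := by
    ext n
    simp [coeff_extendFun, Finset.sum_add_distrib]
  map_mul' f g := by
    ext n
    rw [MvPowerSeries.coeff_mul]
    simp only [coeff_extendFun, MvPowerSeries.coeff_mul, map_sum, map_mul,
      Finset.sum_mul_sum, ← Finset.sum_product']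
    simp only [Finset.sum_sigma']
    -- Both sides run over the ways of writing `n` as a sum of four exponents; the bijection
    -- exchanges the two middle ones.
    refine Finset.sum_nbij'
      (fun x => ⟨(x.2.1.1 + x.2.2.1, x.2.1.2 + x.2.2.2), ((x.2.1.1, x.2.2.1), (x.2.1.2, x.2.2.2))⟩)
      (fun x => ⟨(x.2.1.1 + x.2.2.1, x.2.1.2 + x.2.2.2), ⟨(x.2.1.1, x.2.2.1), (x.2.1.2, x.2.2.2)⟩⟩)
      ?_ ?_ ?_ ?_ ?_ <;>
    · rintro ⟨⟨a, b⟩, ⟨c, d⟩, e, f⟩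
      simp only [Finset.mem_sigma, Finset.HasAntidiagonal.mem_antidiagonal, Finset.mem_product]
      rintro ⟨rfl, rfl, rfl⟩
      first
        | rfl
        | simp [add_add_add_comm]

theorem coeff_extend (E : A →+* MvPowerSeries σ B) (f : MvPowerSeries σ A) (n : σ →₀ ℕ) :
    MvPowerSeries.coeff n (extend E f) = ∑ p ∈ Finset.HasAntidiagonal.antidiagonal n,
      MvPowerSeries.coeff p.2 (E (MvPowerSeries.coeff p.1 f)) := rfl

theorem extend_monomial (E : A →+* MvPowerSeries σ B) (m : σ →₀ ℕ) (a : A) :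
    extend E (MvPowerSeries.monomial m a) = MvPowerSeries.monomial m 1 * E a := by
  ext n
  rw [coeff_extend, MvPowerSeries.coeff_monomial_mul]
  split_ifs with h
  · rw [Finset.sum_eq_single (m, n - m)]
    · simp
    · rintro ⟨p, q⟩ hpq hne
      have hp : p ≠ m := by
        rintro rfl
        rw [Finset.HasAntidiagonal.mem_antidiagonal] at hpq
        exact hne (by simp [← hpq])
      simp [MvPowerSeries.coeff_monomial_ne hp]
    · intro h'
      exact absurd (Finset.HasAntidiagonal.mem_antidiagonal.2 (add_tsub_cancel_of_le h)) h'
  · refine Finset.sum_eq_zero ?_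
    rintro ⟨p, q⟩ hpq
    have hp : p ≠ m := by
      rintro rfl
      rw [Finset.HasAntidiagonal.mem_antidiagonal] at hpq
      exact h (by simp [← hpq])
    simp [MvPowerSeries.coeff_monomial_ne hp]

theorem extend_C (E : A →+* MvPowerSeries σ B) (a : A) :
    extend E (MvPowerSeries.C a) = E a := by
  rw [← MvPowerSeries.monomial_zero_eq_C_apply, extend_monomial, MvPowerSeries.monomial_zero_one,
    one_mul]

/-- Terms of lowest degree are mapped by the constant part of `E`. -/
theorem coeff_extend_of_forall_lt (E : A →+* MvPowerSeries σ B) (f : MvPowerSeries σ A)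
    (n : σ →₀ ℕ) (h : ∀ m < n, MvPowerSeries.coeff m f = 0) :
    MvPowerSeries.coeff n (extend E f)
      = MvPowerSeries.constantCoeff (E (MvPowerSeries.coeff n f)) := by
  rw [coeff_extend, Finset.sum_eq_single (n, 0)]
  · rfl
  · rintro ⟨p, q⟩ hpq hne
    rw [Finset.HasAntidiagonal.mem_antidiagonal] at hpq
    have hp : p < n := by
      refine lt_of_le_of_ne (by simp [← hpq]) ?_
      rintro rfl
      exact hne (by simpa using hpq)
    simp [h p hp]
  · simp

theorem constantCoeff_extend (E : A →+* MvPowerSeries σ B) (f : MvPowerSeries σ A) :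
    MvPowerSeries.constantCoeff (extend E f)
      = MvPowerSeries.constantCoeff (E (MvPowerSeries.constantCoeff f)) :=
  coeff_extend_of_forall_lt E f 0 fun m hm => absurd hm (by simp)

end Extend

/-! ### Solving triangular systems over formal power series -/

section Deformation

variable {σ V ι K : Type*} [DecidableEq σ] [Field K]

omit [DecidableEq σ] in
theorem map_mem_of_mem_supported {A : Type*} [CommRing A] {F : MvPolynomial V K →+* A} {s : Set V}
    {T : Subring A} (hC : ∀ a, F (C a) ∈ T) (hX : ∀ x ∈ s, F (X x) ∈ T) {p : MvPolynomial V K}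
    (hp : p ∈ supported K s) : F p ∈ T := by
  induction hp using Algebra.adjoin_induction with
  | mem x hx =>
    obtain ⟨y, hy, rfl⟩ := hx
    exact hX y hy
  | algebraMap a => exact hC a
  | add f g _ _ hf hg => simpa using add_mem hf hg
  | mul f g _ _ hf hg => simpa using mul_mem hf hg

/-- A coefficient of a product involves only coefficients at smaller or equal exponents of its
factors. This causality makes the recursive construction of solutions possible. -/
theorem coeff_aeval_congr {Φ Ψ : V → MvPowerSeries σ (MvPolynomial V K)} {n : σ →₀ ℕ} {s : Set V}
    (h : ∀ y ∈ s, ∀ m ≤ n, MvPowerSeries.coeff m (Φ y) = MvPowerSeries.coeff m (Ψ y))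
    {p : MvPolynomial V K} (hp : p ∈ supported K s) :
    ∀ m ≤ n, MvPowerSeries.coeff m (aeval Φ p) = MvPowerSeries.coeff m (aeval Ψ p) := by
  induction hp using Algebra.adjoin_induction with
  | mem x hx =>
    obtain ⟨y, hy, rfl⟩ := hx
    simpa using h y hy
  | algebraMap a => simp
  | add f g _ _ hf hg =>
    intro m hm
    simp [hf m hm, hg m hm]
  | mul f g _ _ hf hg =>
    intro m hm
    rw [map_mul (aeval Φ), map_mul (aeval Ψ), MvPowerSeries.coeff_mul, MvPowerSeries.coeff_mul]
    refine Finset.sum_congr rfl fun q hq => ?_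
    rw [Finset.HasAntidiagonal.mem_antidiagonal] at hq
    rw [hf q.1 (le_trans (by simp [← hq]) hm), hg q.2 (le_trans (by simp [← hq]) hm)]

/-- A family `G` of equations over `K[V]⟦h⟧` is triangular if the constant terms are of the form
`X x + (polynomial in lower variables)`, with distinct leading variables `x`. -/
structure IsTriangular (r : V → V → Prop) (lead : ι → V)
    (G : ι → MvPowerSeries σ (MvPolynomial V K)) : Prop where
  wf : WellFounded r
  injective : Function.Injective lead
  tail : ∀ i, MvPowerSeries.constantCoeff (G i) - X (lead i) ∈ supported K {y | r y (lead i)}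

/-- A solution of a family of equations over `K[V]⟦h⟧`: a homomorphism `K[V] → K[V]⟦h⟧` whose
extension to `K[V]⟦h⟧` kills the equations, and which fixes the variables that are not leading. -/
structure IsSolution (lead : ι → V) (G : ι → MvPowerSeries σ (MvPolynomial V K))
    (E : MvPolynomial V K →+* MvPowerSeries σ (MvPolynomial V K)) : Prop where
  map_C : ∀ a, E (C a) = MvPowerSeries.C (C a)
  map_X : ∀ x ∉ Set.range lead, E (X x) = MvPowerSeries.C (X x)
  extend_eq_zero : ∀ i, extend E (G i) = 0

open Classical in
/-- The family `Φ` of power series with the coefficients not satisfying `P` replaced by `0`. -/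
def restrictCoeff (P : (σ →₀ ℕ) × V → Prop) (Φ : V → MvPowerSeries σ (MvPolynomial V K)) (y : V) :
    MvPowerSeries σ (MvPolynomial V K) :=
  fun m => if P (m, y) then MvPowerSeries.coeff m (Φ y) else 0

omit [DecidableEq σ] in
theorem coeff_restrictCoeff {P : (σ →₀ ℕ) × V → Prop}
    {Φ : V → MvPowerSeries σ (MvPolynomial V K)} {y : V} {m : σ →₀ ℕ} (h : P (m, y)) :
    MvPowerSeries.coeff m (restrictCoeff P Φ y) = MvPowerSeries.coeff m (Φ y) :=
  if_pos h

variable (lead : ι → V) (G : ι → MvPowerSeries σ (MvPolynomial V K))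

open Classical in
/-- The value that the equations `G` force on the coefficient `p.1` of the image of the variable
`p.2`, in terms of the images `Φ` of the variables. -/
def forcedCoeff (Φ : V → MvPowerSeries σ (MvPolynomial V K)) (p : (σ →₀ ℕ) × V) :
    MvPolynomial V K :=
  if h : ∃ i, lead i = p.2 then
    -MvPowerSeries.coeff p.1
        (aeval Φ (MvPowerSeries.constantCoeff (G h.choose) - X (lead h.choose)))
      - ∑ q ∈ (Finset.HasAntidiagonal.antidiagonal p.1).erase (0, p.1),
          MvPowerSeries.coeff q.2 (aeval Φ (MvPowerSeries.coeff q.1 (G h.choose)))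
  else MvPowerSeries.coeff p.1 (MvPowerSeries.C (X p.2))

variable {lead G}

omit [DecidableEq σ] in
/-- Recursive definition of a family of power series, by recursion on the exponent and the index. -/
theorem exists_forall_coeff_eq_of_wellFounded [Finite σ] {r : V → V → Prop} (hr : WellFounded r)
    (F : (V → MvPowerSeries σ (MvPolynomial V K)) → (σ →₀ ℕ) × V → MvPolynomial V K) :
    ∃ Φ : V → MvPowerSeries σ (MvPolynomial V K), ∀ n x, MvPowerSeries.coeff n (Φ x)
      = F (restrictCoeff (fun q => Prod.Lex (· < ·) r q (n, x)) Φ) (n, x) := by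
  classical
  have wf : WellFounded (Prod.Lex (· < ·) r : (σ →₀ ℕ) × V → (σ →₀ ℕ) × V → Prop) :=
    WellFounded.prod_lex wellFounded_lt hr
  let step (p : (σ →₀ ℕ) × V) (rec : ∀ q, Prod.Lex (· < ·) r q p → MvPolynomial V K) :
      MvPolynomial V K :=
    -- Values not yet constructed are set to `0`, exactly as in `restrictCoeff`, so that `F` can be
    -- applied to a total family.
    F (fun y m => if h : Prod.Lex (· < ·) r (m, y) p then rec (m, y) h else 0) p
  refine ⟨fun y m => wf.fix step (m, y), fun n x => (wf.fix_eq step (n, x)).trans ?_⟩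
  refine congrArg (F · (n, x)) (funext fun y => funext fun m => ?_)
  by_cases h : Prod.Lex (· < ·) r (m, y) (n, x)
  · exact (dif_pos h).trans (if_pos h).symm
  · exact (dif_neg h).trans (if_neg h).symm

/-- The coefficient at `n` of the image of an equation is the coefficient at `n` of the image of its
leading variable, plus a contribution of the tail, which needs only lower variables at exponents up
to `n`, plus contributions of its higher terms, which need only exponents strictly below `n`. Hence
it can be made to vanish by recursion along the lexicographic order on pairs (exponent, variable).
-/
theorem IsTriangular.exists_isSolution [Finite σ] {r : V → V → Prop}
    (h : IsTriangular r lead G) : ∃ E, IsSolution lead G E := by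
  obtain ⟨Φ, key⟩ := exists_forall_coeff_eq_of_wellFounded h.wf (forcedCoeff lead G)
  refine ⟨(aeval Φ).toRingHom, fun a => ?_, fun x hx => ?_, fun i => ?_⟩
  · exact (aeval_C Φ a).trans (MvPowerSeries.algebraMap_apply ..)
  · ext1 n
    have := key n x
    unfold forcedCoeff at this
    rw [dif_neg (by simpa using hx)] at this
    simpa using this
  · ext1 n
    have hk := key n (lead i)
    have hex : ∃ i', lead i' = (n, lead i).2 := ⟨i, rfl⟩
    -- Leading variables are distinct, so the equation chosen in `forcedCoeff` is the intended one.
    have hch : hex.choose = i := h.injective hex.choose_spec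
    unfold forcedCoeff at hk
    rw [dif_pos hex, hch] at hk
    dsimp only at hk
    have h1 : MvPowerSeries.coeff n (aeval (restrictCoeff
          (fun q => Prod.Lex (· < ·) r q (n, lead i)) Φ)
          (MvPowerSeries.constantCoeff (G i) - X (lead i)))
        = MvPowerSeries.coeff n
          (aeval Φ (MvPowerSeries.constantCoeff (G i) - X (lead i))) := by
      refine coeff_aeval_congr (n := n) (fun y hy m hm => ?_) (h.tail i) n le_rfl
      refine coeff_restrictCoeff (P := fun q => Prod.Lex (· < ·) r q (n, lead i)) ?_
      rcases hm.lt_or_eq with h | h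
      · exact Prod.Lex.left _ _ h
      · subst h
        exact Prod.Lex.right _ hy
    have h2 : ∀ q ∈ (Finset.HasAntidiagonal.antidiagonal n).erase (0, n),
        MvPowerSeries.coeff q.2 (aeval (restrictCoeff
          (fun q => Prod.Lex (· < ·) r q (n, lead i)) Φ) (MvPowerSeries.coeff q.1 (G i)))
        = MvPowerSeries.coeff q.2 (aeval Φ (MvPowerSeries.coeff q.1 (G i))) := by
      intro q hq
      obtain ⟨hne, hq⟩ := Finset.mem_erase.1 hq
      rw [Finset.HasAntidiagonal.mem_antidiagonal] at hq
      -- A positive power of the grid spacings has been split off, so the remaining exponent is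
      -- strictly smaller and all variables are available.
      have hlt : q.2 < n := by
        refine lt_of_le_of_ne (by simp [← hq]) fun h => hne ?_
        rw [h] at hq
        exact Prod.ext (by simpa using hq) h
      refine coeff_aeval_congr (n := q.2) (s := Set.univ) (fun y _ m hm => ?_)
        (by simp [supported_univ]) _ le_rfl
      exact coeff_restrictCoeff (P := fun q => Prod.Lex (· < ·) r q (n, lead i))
        (Prod.Lex.left _ _ (hm.trans_lt hlt))
    rw [h1, Finset.sum_congr rfl h2] at hk
    rw [coeff_extend, ← Finset.add_sum_erase _ _
      (show (0, n) ∈ Finset.HasAntidiagonal.antidiagonal n by simp)]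
    simp only [AlgHom.toRingHom_eq_coe, RingHom.coe_coe,
      MvPowerSeries.coeff_zero_eq_constantCoeff_apply]
    have h3 : MvPowerSeries.coeff n (aeval Φ (MvPowerSeries.constantCoeff (G i) - X (lead i)))
        = MvPowerSeries.coeff n (aeval Φ (MvPowerSeries.constantCoeff (G i)))
          - MvPowerSeries.coeff n (Φ (lead i)) := by
      rw [map_sub, map_sub, aeval_X]
    rw [map_zero]
    linear_combination hk - h3

variable {E : MvPolynomial V K →+* MvPowerSeries σ (MvPolynomial V K)}

theorem IsSolution.constantCoeff_constantCoeff (hE : IsSolution lead G E) (i : ι) :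
    MvPowerSeries.constantCoeff (E (MvPowerSeries.constantCoeff (G i))) = 0 := by
  rw [← constantCoeff_extend, hE.extend_eq_zero, map_zero]

theorem IsSolution.constantCoeff_lead (hE : IsSolution lead G E) (i : ι) :
    MvPowerSeries.constantCoeff (E (X (lead i))) = -MvPowerSeries.constantCoeff
      (E (MvPowerSeries.constantCoeff (G i) - X (lead i))) := by
  rw [map_sub, map_sub, hE.constantCoeff_constantCoeff, zero_sub, neg_neg]

/-- Modulo the constant terms of the equations, the constant part of a solution is the
identity. -/
theorem IsSolution.sub_constantCoeff_mem {r : V → V → Prop} (h : IsTriangular r lead G)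
    (hE : IsSolution lead G E) {J : Ideal (MvPolynomial V K)}
    (hJ : ∀ i, MvPowerSeries.constantCoeff (G i) ∈ J) (f : MvPolynomial V K) :
    f - MvPowerSeries.constantCoeff (E f) ∈ J := by
  have step (s : Set V) (hs : ∀ x ∈ s, X x - MvPowerSeries.constantCoeff (E (X x)) ∈ J)
      (f : MvPolynomial V K) (hf : f ∈ supported K s) :
      f - MvPowerSeries.constantCoeff (E f) ∈ J := by
    induction hf using Algebra.adjoin_induction with
    | mem x hx =>
      obtain ⟨y, hy, rfl⟩ := hx
      exact hs y hy
    | algebraMap a => simp [algebraMap_eq, hE.map_C]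
    | add f g _ _ hf hg =>
      rw [map_add, map_add, add_sub_add_comm]
      exact J.add_mem hf hg
    | mul f g _ _ hf hg =>
      have : f * g - MvPowerSeries.constantCoeff (E (f * g))
          = f * (g - MvPowerSeries.constantCoeff (E g))
            + MvPowerSeries.constantCoeff (E g) * (f - MvPowerSeries.constantCoeff (E f)) := by
        rw [map_mul, map_mul]
        ring
      rw [this]
      exact J.add_mem (J.mul_mem_left _ hg) (J.mul_mem_left _ hf)
  refine step Set.univ (fun x _ => ?_) f (by simp [supported_univ])
  induction x using h.wf.induction with
  | _ x ih =>
    by_cases hx : x ∈ Set.range lead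
    · obtain ⟨i, rfl⟩ := hx
      -- Modulo `J` the leading variable equals minus its tail, and its image is minus the image of
      -- the tail; the two agree by induction on the rank.
      have h1 := step _ (fun y hy => ih y hy trivial) _ (h.tail i)
      rw [hE.constantCoeff_lead i]
      convert J.sub_mem (hJ i) h1 using 1
      ring
    · simp [hE.map_X x hx]

/-- The constant part of a solution maps leading variables to polynomials in lower variables. -/
theorem IsSolution.constantCoeff_lead_mem_supported {r : V → V → Prop} [IsTrans V r]
    (h : IsTriangular r lead G) (hE : IsSolution lead G E) (i : ι) :
    MvPowerSeries.constantCoeff (E (X (lead i))) ∈ supported K {y | r y (lead i)} := by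
  have key (x : V) : x ∈ Set.range lead →
      MvPowerSeries.constantCoeff (E (X x)) ∈ supported K {y | r y x} := by
    induction x using h.wf.induction with
    | _ x ih =>
      rintro ⟨i, rfl⟩
      rw [hE.constantCoeff_lead]
      refine neg_mem (map_mem_of_mem_supported (F := MvPowerSeries.constantCoeff.comp E)
        (T := (supported K {y | r y (lead i)}).toSubring) (fun a => ?_) (fun y hy => ?_)
        (h.tail i))
      · rw [RingHom.comp_apply, hE.map_C, MvPowerSeries.constantCoeff_C]
        exact Subalgebra.algebraMap_mem _ a
      · by_cases hy' : y ∈ Set.range lead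
        · exact supported_mono
            (fun z (hz : r z y) => (IsTrans.trans z y _ hz hy : r z (lead i))) (ih y hy hy')
        · rw [RingHom.comp_apply, hE.map_X y hy', MvPowerSeries.constantCoeff_C]
          exact X_mem_supported.2 hy
  exact key _ ⟨i, rfl⟩

end Deformation

/-! ### The ranking of the variables -/

section Ranking

/-- The ranking as a lexicographic product. -/
def rankKey (x : Var) : Lex (Lex (Fin 4 → ℕ) × (Fin 4)ᵒᵈ) := toLex (toLex x.2, OrderDual.toDual x.1)

theorem rankKey_injective : Function.Injective rankKey := fun x y h => by
  have h' := Prod.ext_iff.1 (toLex.injective h)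
  exact Prod.ext (OrderDual.toDual.injective h'.2) (toLex.injective h'.1)

theorem rankLT_iff {x y : Var} : rankLT x y ↔ rankKey x < rankKey y := by
  rw [rankLT, rankKey, rankKey, Prod.Lex.toLex_lt_toLex]
  simp

/-- The ranking is the pullback of a lexicographic product of well-founded orders with finitely many
factors. -/
theorem wellFounded_rankLT : WellFounded rankLT := by
  have : rankLT = InvImage (· < ·) rankKey := by
    ext x y
    exact rankLT_iff
  rw [this]
  exact InvImage.wf _ wellFounded_lt

instance : IsTrans Var rankLT :=
  ⟨fun _ _ _ hxy hyz => rankLT_iff.2 ((rankLT_iff.1 hxy).trans (rankLT_iff.1 hyz))⟩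

theorem rankLT_irrefl (x : Var) : ¬ rankLT x x := by
  simp [rankLT_iff]

theorem rankLT_trans {x y z : Var} (hxy : rankLT x y) (hyz : rankLT y z) : rankLT x z :=
  _root_.trans hxy hyz

theorem rankLT_trichotomy (x y : Var) : rankLT x y ∨ x = y ∨ rankLT y x := by
  simp only [rankLT_iff, ← rankKey_injective.eq_iff]
  exact lt_trichotomy _ _

theorem rankLT_add {x y : Var} (s : Fin 4 → ℕ) (h : rankLT x y) :
    rankLT (x.1, x.2 + s) (y.1, y.2 + s) := by
  rcases h with h | ⟨h, h'⟩
  · exact Or.inl (by simpa [toLex_add] using h)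
  · exact Or.inr ⟨by simp [h], h'⟩

theorem rankLT_of_lt {α β : Fin 4} {k l : Fin 4 → ℕ} (h : k < l) : rankLT (α, k) (β, l) :=
  Or.inl (Pi.toLex_strictMono h)

theorem isRanking_rankLT : IsRanking rankLT where
  total :=
    { trichotomous := fun x y h h' => by
        rcases rankLT_trichotomy x y with h'' | h'' | h''
        exacts [absurd h'' h, h'', absurd h'' h']
      irrefl := rankLT_irrefl
      trans := fun _ _ _ => rankLT_trans }
  shift_gt α k hk := rankLT_of_lt (pos_iff_ne_zero.2 hk)
  shift_mono α β k l s h := rankLT_add s h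

end Ranking

/-! ### The pure lexicographic monomial ordering -/

section Ordering

theorem lexLT_irrefl (v : Mon) : ¬ lexLT v v := fun ⟨_, h, _⟩ => lt_irrefl _ h

theorem lexLT_trans {u v w : Mon} (huv : lexLT u v) (hvw : lexLT v w) : lexLT u w := by
  obtain ⟨x, hx, hx'⟩ := huv
  obtain ⟨y, hy, hy'⟩ := hvw
  rcases rankLT_trichotomy x y with h | rfl | h
  · exact ⟨y, (hx' y h).trans_lt hy, fun z hz => (hx' z (rankLT_trans h hz)).trans (hy' z hz)⟩
  · exact ⟨x, hx.trans hy, fun z hz => (hx' z hz).trans (hy' z hz)⟩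
  · exact ⟨x, hx.trans_eq (hy' x h), fun z hz => (hx' z hz).trans (hy' z (rankLT_trans h hz))⟩

/-- Two distinct monomials differ at only finitely many variables, and the highest ranked of these
decides. -/
theorem lexLT_trichotomy (v w : Mon) : lexLT v w ∨ v = w ∨ lexLT w v := by
  by_cases hvw : v = w
  · exact Or.inr (Or.inl hvw)
  have hne : (v.neLocus w).Nonempty := Finsupp.nonempty_neLocus_iff.2 hvw
  obtain ⟨x, hx, hmax⟩ := Finset.exists_max_image _ rankKey hne
  have hmax' (y : Var) (h : rankLT x y) : v y = w y := by
    by_contra hy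
    exact absurd (rankLT_iff.1 h) (not_lt.2 (hmax y (Finsupp.mem_neLocus.2 hy)))
  rcases lt_or_gt_of_ne (Finsupp.mem_neLocus.1 hx) with h | h
  · exact Or.inl ⟨x, h, hmax'⟩
  · exact Or.inr (Or.inr ⟨x, h, fun y hy => (hmax' y hy).symm⟩)

theorem lexLT_add_left {v w : Mon} (t : Mon) (h : lexLT v w) : lexLT (t + v) (t + w) := by
  obtain ⟨x, hx, hx'⟩ := h
  exact ⟨x, by simpa using hx, fun y hy => by simpa using hx' y hy⟩

theorem lexLT_zero_of_ne_zero {t : Mon} (ht : t ≠ 0) : lexLT 0 t := by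
  rcases lexLT_trichotomy 0 t with h | h | ⟨x, hx, _⟩
  · exact h
  · exact absurd h.symm ht
  · simp at hx

theorem shiftVar_injective {S : Type*} [AddRightCancelSemigroup S] (s : Fin 4 → S) :
    Function.Injective fun x : Fin 4 × (Fin 4 → S) => (x.1, x.2 + s) := fun x y h => by
  simp only [Prod.mk.injEq, add_left_inj] at h
  exact Prod.ext h.1 h.2

theorem lexLT_monShift {v w : Mon} (s : Fin 4 → ℕ) (h : lexLT v w) :
    lexLT (monShift s v) (monShift s w) := by
  obtain ⟨x, hx, hx'⟩ := h
  have hinj := shiftVar_injective s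
  refine ⟨(x.1, x.2 + s), ?_, fun y hy => ?_⟩
  · rw [monShift, monShift]
    simpa only [Finsupp.mapDomain_apply hinj v x, Finsupp.mapDomain_apply hinj w x] using hx
  · by_cases hy' : y ∈ Set.range fun x : Var => (x.1, x.2 + s)
    · obtain ⟨z, rfl⟩ := hy'
      have hz : rankLT x z := by
        rcases rankLT_trichotomy x z with h | rfl | h
        · exact h
        · exact absurd hy (rankLT_irrefl _)
        · exact absurd (rankLT_trans hy (rankLT_add s h)) (rankLT_irrefl _)
      rw [monShift, monShift]
      simpa only [Finsupp.mapDomain_apply hinj v z, Finsupp.mapDomain_apply hinj w z] using hx' z hz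
    -- A variable that is not a shift by `s` has exponent `0` in both shifted monomials.
    · rw [monShift, monShift, Finsupp.mapDomain_of_notMem_range _ _ hy',
        Finsupp.mapDomain_of_notMem_range _ _ hy']

/-- In the pure lexicographic ordering degrees are irrelevant: one higher variable beats every
monomial in lower ones. Hence nonlinear tails do not disturb the linear leading terms. -/
theorem lexLT_single_of_forall_rankLT {m : Mon} {x : Var} (h : ∀ y ∈ m.support, rankLT y x) :
    lexLT m (Finsupp.single x 1) := by
  have hzero (y : Var) (hy : y = x ∨ rankLT x y) : m y = 0 := by
    by_contra hne
    have := h y (Finsupp.mem_support_iff.2 hne)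
    rcases hy with rfl | hy
    · exact rankLT_irrefl _ this
    · exact rankLT_irrefl _ (rankLT_trans this hy)
  refine ⟨x, by simp [hzero x (Or.inl rfl)], fun y hy => ?_⟩
  rw [hzero y (Or.inr hy), Finsupp.single_eq_of_ne]
  rintro rfl
  exact rankLT_irrefl _ hy

theorem isAdmissibleOrdering_lexLT : IsAdmissibleOrdering rankLT lexLT where
  total :=
    { trichotomous := fun v w h h' => by
        rcases lexLT_trichotomy v w with h'' | h'' | h''
        exacts [absurd h'' h, h'', absurd h'' h']
      irrefl := lexLT_irrefl
      trans := fun _ _ _ => lexLT_trans }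
  ranking := isRanking_rankLT
  extends_ranking x y := by
    have key {x y : Var} (h : rankLT x y) : lexLT (Finsupp.single x 1) (Finsupp.single y 1) := by
      refine lexLT_single_of_forall_rankLT fun z hz => ?_
      rwa [Finset.mem_singleton.1 (Finsupp.support_single_subset hz)]
    refine ⟨key, fun h => ?_⟩
    rcases rankLT_trichotomy x y with h' | rfl | h'
    · exact h'
    · exact absurd h (lexLT_irrefl _)
    · exact absurd (lexLT_trans h (key h')) (lexLT_irrefl _)
  one_lt t := lexLT_zero_of_ne_zero
  mul_shift s t v w := by
    have key {v w : Mon} (h : lexLT w v) : lexLT (t + monShift s w) (t + monShift s v) :=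
      lexLT_add_left t (lexLT_monShift s h)
    -- The converse follows from monotonicity, since the order is total.
    refine ⟨key, fun h => ?_⟩
    rcases lexLT_trichotomy w v with h' | rfl | h'
    · exact h'
    · exact absurd h (lexLT_irrefl _)
    · exact absurd (lexLT_trans h (key h')) (lexLT_irrefl _)

end Ordering

/-! ### Shifts of difference polynomials -/

section Shift

variable {S : Type}

theorem shift_X [Add S] (s : Fin 4 → S) (x : Fin 4 × (Fin 4 → S)) :
    shift s (X x) = X (x.1, x.2 + s) := rename_X ..

theorem shift_shift [AddSemigroup S] (s t : Fin 4 → S) (f : ShiftPoly S) :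
    shift s (shift t f) = shift (t + s) f := by
  simp [shift, rename_rename, Function.comp_def, add_assoc]

theorem shift_comm [AddCommSemigroup S] (s t : Fin 4 → S) (f : ShiftPoly S) :
    shift s (shift t f) = shift t (shift s f) := by
  rw [shift_shift, shift_shift, add_comm]

theorem shift_zero [AddMonoid S] (f : ShiftPoly S) : shift 0 f = f := by
  simp only [shift, add_zero]
  exact rename_id_apply f

/-- Nonnegative shift exponents as integer ones. -/
def castShift (s : Fin 4 → ℕ) : Fin 4 → ℤ := fun i => s i

theorem castShift_add (s t : Fin 4 → ℕ) : castShift (s + t) = castShift s + castShift t := by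
  ext i
  simp [castShift]

theorem castShift_zero : castShift 0 = 0 := by
  ext i
  simp [castShift]

theorem castShift_single (i : Fin 4) : castShift (Pi.single i 1) = Pi.single i 1 := by
  ext j
  by_cases h : j = i
  · subst h
    simp [castShift]
  · simp [castShift, h]

theorem natInclusion_X (x : Fin 4 × (Fin 4 → ℕ)) :
    natInclusion (X x) = X (x.1, castShift x.2) := rename_X ..

theorem natInclusion_injective : Function.Injective natInclusion :=
  rename_injective _ fun x y h => by
    simp only [Prod.mk.injEq, funext_iff, Nat.cast_inj] at h
    exact Prod.ext h.1 (funext h.2)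

theorem natInclusion_shift (s : Fin 4 → ℕ) (f : ShiftPoly ℕ) :
    natInclusion (shift s f) = shift (castShift s) (natInclusion f) := by
  simp only [natInclusion, shift, rename_rename]
  congr 2

end Shift

/-! ### Difference operators and the discrete integrability condition -/

section Operators

theorem Dx_add (i : Fin 3) (f g : ShiftPoly ℤ) : Dx i (f + g) = Dx i f + Dx i g := by
  simp only [Dx, map_add, smul_sub, smul_add]
  abel

theorem Dx_sub (i : Fin 3) (f g : ShiftPoly ℤ) : Dx i (f - g) = Dx i f - Dx i g := by
  simp only [Dx, map_sub, smul_sub]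
  abel

theorem Dx_smul (i : Fin 3) (a : StepField) (f : ShiftPoly ℤ) : Dx i (a • f) = a • Dx i f := by
  simp only [Dx, map_smul, ← smul_sub, smul_comm a]

theorem Dx_shift (i : Fin 3) (s : Fin 4 → ℤ) (f : ShiftPoly ℤ) :
    Dx i (shift s f) = shift s (Dx i f) := by
  simp only [Dx, map_smul, map_sub, shift_comm s]

theorem discreteLaplace_shift (s : Fin 4 → ℤ) (f : ShiftPoly ℤ) :
    discreteLaplace (shift s f) = shift s (discreteLaplace f) := by
  simp only [discreteLaplace, map_smul, map_sub, map_sum, map_add, map_mul, map_ofNat,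
    shift_comm s]

theorem Dx_comm (i j : Fin 3) (f : ShiftPoly ℤ) : Dx i (Dx j f) = Dx j (Dx i f) := by
  conv_lhs => rw [Dx, ← Dx_shift, ← Dx_shift, ← Dx_sub, ← Dx_smul]
  rfl

theorem Dt_Dx (i : Fin 3) (f : ShiftPoly ℤ) : Dt (Dx i f) = Dx i (Dt f) := by
  rw [Dt, ← Dx_shift, ← Dx_sub, ← Dx_smul]
  rfl

theorem Dt_add (f g : ShiftPoly ℤ) : Dt (f + g) = Dt f + Dt g := by
  simp only [Dt, map_add, smul_sub, smul_add]
  abel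

/-- The discrete pressure Poisson equation is the integrability condition of the discrete
continuity equation and the discrete momentum equations. -/
theorem Dt_discreteContinuity :
    Dt discreteContinuity = ∑ i : Fin 3, Dx i (discreteMomentum i) - discretePoisson := by
  -- The divergence form makes this purely linear: only commutation of the difference operators is
  -- used, and no discrete product rule. Mixed differences and products are put in a fixed order so
  -- that equal terms match.
  simp only [discreteContinuity, discreteMomentum, discretePoisson, Fin.sum_univ_three, Dx_add,
    Dx_sub, Dx_smul, Dt_add, Dt_Dx, Dx_comm 1 0, Dx_comm 2 0, Dx_comm 2 1, pow_two,
    mul_comm (gridVel 1) (gridVel 0), mul_comm (gridVel 2) (gridVel 0),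
    mul_comm (gridVel 2) (gridVel 1), smul_add]
  ring

end Operators

/-! ### The system with negative shifts removed -/

section Cleared

/-- The shift that clears one application of the spatial difference operators. -/
def center : Fin 4 → ℕ := ![0, 1, 1, 1]

/-- `σ₁ σ₂ σ₃ Dₜ` on difference polynomials with nonnegative shifts. -/
def clearedDt (f : ShiftPoly ℕ) : ShiftPoly ℕ :=
  (step 0)⁻¹ • (shift (center + Pi.single 0 1) f - shift center f)

/-- `σ₁ σ₂ σ₃ Dᵢ` on difference polynomials with nonnegative shifts. -/
def clearedDx (i : Fin 3) (f : ShiftPoly ℕ) : ShiftPoly ℕ :=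
  (2 * step i.succ)⁻¹ •
    (shift (center + Pi.single i.succ 1) f - shift (center - Pi.single i.succ 1) f)

/-- `σ₁ σ₂ σ₃ Δ` on difference polynomials with nonnegative shifts. -/
def clearedLaplace (f : ShiftPoly ℕ) : ShiftPoly ℕ :=
  ∑ j : Fin 3, (step j.succ ^ 2)⁻¹ •
    (shift (center + Pi.single j.succ 1) f - 2 * shift center f
      + shift (center - Pi.single j.succ 1) f)

/-- The cleared velocity components. -/
def natVel (i : Fin 3) : ShiftPoly ℕ := X (i.succ, 0)

/-- The cleared pressure. -/
def natPres : ShiftPoly ℕ := X (0, 0)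

/-- The discrete continuity equation with negative shifts removed. -/
def clearedContinuity : ShiftPoly ℕ := shift center (∑ j : Fin 3, clearedDx j (natVel j))

/-- The discrete momentum equations with negative shifts removed. -/
def clearedMomentum (i : Fin 3) : ShiftPoly ℕ :=
  clearedDt (natVel i) + ∑ j : Fin 3, clearedDx j (natVel i * natVel j) + clearedDx i natPres
    - invRe • clearedLaplace (natVel i)

/-- The discrete pressure Poisson equation with negative shifts removed. -/
def clearedPoisson : ShiftPoly ℕ :=
  ∑ i : Fin 3, clearedDx i (clearedDx i natPres)
    + ∑ i : Fin 3, clearedDx i (clearedDx i (natVel i ^ 2))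
    + 2 * (clearedDx 0 (clearedDx 1 (natVel 0 * natVel 1))
      + clearedDx 0 (clearedDx 2 (natVel 0 * natVel 2))
      + clearedDx 1 (clearedDx 2 (natVel 1 * natVel 2)))
    - invRe • ∑ i : Fin 3, clearedDx i (clearedLaplace (natVel i))

/-- The discrete system with negative shifts removed. -/
def clearedSystem : Fin 5 → ShiftPoly ℕ :=
  ![clearedContinuity, clearedMomentum 0, clearedMomentum 1, clearedMomentum 2, clearedPoisson]

theorem castShift_center_add (i : Fin 3) :
    castShift (center + Pi.single i.succ 1) = Pi.single i.succ 1 + castShift center := by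
  ext j
  fin_cases i <;> fin_cases j <;> rfl

/-- The truncated subtraction is exact because `center` equals `1` in every space direction. -/
theorem castShift_center_sub (i : Fin 3) :
    castShift (center - Pi.single i.succ 1) = Pi.single i.succ (-1) + castShift center := by
  ext j
  fin_cases i <;> fin_cases j <;> rfl

theorem natInclusion_clearedDt (f : ShiftPoly ℕ) :
    natInclusion (clearedDt f) = shift (castShift center) (Dt (natInclusion f)) := by
  simp only [clearedDt, Dt, map_smul, map_sub, natInclusion_shift, shift_shift, castShift_add,
    castShift_single, add_comm (castShift center)]

theorem natInclusion_clearedDx (i : Fin 3) (f : ShiftPoly ℕ) :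
    natInclusion (clearedDx i f) = shift (castShift center) (Dx i (natInclusion f)) := by
  simp only [clearedDx, Dx, map_smul, map_sub, natInclusion_shift, shift_shift,
    castShift_center_add,
    castShift_center_sub]

theorem natInclusion_clearedLaplace (f : ShiftPoly ℕ) :
    natInclusion (clearedLaplace f)
      = shift (castShift center) (discreteLaplace (natInclusion f)) := by
  simp only [clearedLaplace, discreteLaplace, map_smul, map_sub, map_sum, map_add, map_mul,
    map_ofNat, natInclusion_shift, shift_shift,
    castShift_center_add,
    castShift_center_sub]

theorem natInclusion_natVel (i : Fin 3) : natInclusion (natVel i) = gridVel i := by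
  rw [natVel, natInclusion_X, castShift_zero]
  rfl

theorem natInclusion_natPres : natInclusion natPres = gridPres := by
  rw [natPres, natInclusion_X, castShift_zero]
  rfl

theorem clearing_center : clearing = ![castShift (center + center), castShift center,
    castShift center, castShift center, castShift (center + center)] := by
  ext i j
  fin_cases i <;> fin_cases j <;> rfl

theorem natInclusion_clearedContinuity :
    natInclusion clearedContinuity = shift (castShift (center + center)) discreteContinuity := by
  simp only [clearedContinuity, discreteContinuity, natInclusion_shift, map_sum,
    natInclusion_clearedDx, natInclusion_natVel, shift_shift, castShift_add]

theorem natInclusion_clearedMomentum (i : Fin 3) :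
    natInclusion (clearedMomentum i) = shift (castShift center) (discreteMomentum i) := by
  simp only [clearedMomentum, discreteMomentum, map_sum, map_add, map_sub, map_smul, map_mul,
    natInclusion_clearedDx, natInclusion_clearedDt, natInclusion_clearedLaplace,
    natInclusion_natVel, natInclusion_natPres]

theorem natInclusion_clearedPoisson :
    natInclusion clearedPoisson = shift (castShift (center + center)) discretePoisson := by
  simp only [clearedPoisson, discretePoisson, map_sum, map_add, map_sub, map_smul, map_mul,
    map_pow, map_ofNat, natInclusion_clearedDx, natInclusion_clearedLaplace,
    natInclusion_natVel, natInclusion_natPres, Dx_shift, shift_shift, castShift_add]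

theorem natInclusion_clearedSystem (j : Fin 5) :
    natInclusion (clearedSystem j) = shift (clearing j) (discreteSystem j) := by
  rw [clearing_center]
  fin_cases j
  · exact natInclusion_clearedContinuity
  · exact natInclusion_clearedMomentum 0
  · exact natInclusion_clearedMomentum 1
  · exact natInclusion_clearedMomentum 2
  · exact natInclusion_clearedPoisson

theorem step_ne_zero (i : Fin 4) : step i ≠ 0 := by
  rw [step, Ne, FaithfulSMul.algebraMap_eq_zero_iff]
  exact X_ne_zero i

theorem shift_time_discreteContinuity :
    shift (Pi.single 0 1) discreteContinuity = discreteContinuity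
      + step 0 • (∑ i : Fin 3, Dx i (discreteMomentum i) - discretePoisson) := by
  rw [← Dt_discreteContinuity, Dt, smul_smul, mul_inv_cancel₀ (step_ne_zero 0), one_smul,
    add_sub_cancel]

/-- The additional factor `σ₁ σ₂ σ₃` on the continuity equation is what aligns it with differences
of the cleared momentum equations and with the cleared Poisson equation, so that the integrability
condition needs no negative shifts. -/
theorem shift_time_clearedContinuity :
    shift (Pi.single 0 1) clearedContinuity = clearedContinuity
      + step 0 • (∑ i : Fin 3, clearedDx i (clearedMomentum i) - clearedPoisson) := by
  apply natInclusion_injective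
  simp only [map_add, map_smul, map_sub, map_sum, natInclusion_shift,
    natInclusion_clearedContinuity, natInclusion_clearedDx, natInclusion_clearedMomentum,
    natInclusion_clearedPoisson, Dx_shift]
  rw [shift_comm, castShift_single, shift_time_discreteContinuity]
  simp only [map_add, map_smul, map_sub, map_sum, shift_shift, castShift_add]

end Cleared

/-! ### Rewriting rules and their leading variables -/

section Rules

/-- The rules that are used to solve for leading variables: all derivatives, respectively shifts,
of the equations `1, …, 4`, and those of equation `0` that do not involve time. -/
abbrev RuleIndex : Type := {p : Fin 5 × (Fin 4 → ℕ) // p.1 = 0 → p.2 0 = 0}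

/-- The leading variable of a rule, given the leading variables `l` of the five equations. -/
def ruleLead (l : Fin 5 → Var) (p : RuleIndex) : Var := ((l p.1.1).1, (l p.1.1).2 + p.1.2)

/-- Only the continuity equation and the first momentum equation lead with the same dependent
variable `u`. Their rules are told apart by time: the former have time exponent zero, the latter a
positive one. -/
theorem ruleLead_injective {l : Fin 5 → Var} (hl : (fun j => (l j).1) = ![1, 1, 2, 3, 0])
    (h0 : (l 0).2 0 = 0) (h1 : (l 1).2 0 ≠ 0) : Function.Injective (ruleLead l) := by
  have hl' (j : Fin 5) : (l j).1 = ![1, 1, 2, 3, 0] j := congrFun hl j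
  have hne (s t : Fin 4 → ℕ) (hs : s 0 = 0) (h : (l 0).2 + s = (l 1).2 + t) : False := by
    have := congrFun h 0
    simp only [Pi.add_apply] at this
    omega
  rintro ⟨⟨i, s⟩, hs⟩ ⟨⟨j, t⟩, ht⟩ h
  simp only [ruleLead, Prod.mk.injEq, hl'] at h
  obtain ⟨h, h'⟩ := h
  have hij : i = j := by
    by_contra hij
    have : i = 0 ∧ j = 1 ∨ i = 1 ∧ j = 0 := by
      clear hs ht h'
      revert i j
      decide
    rcases this with ⟨rfl, rfl⟩ | ⟨rfl, rfl⟩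
    · exact hne s t (hs rfl) h'
    · exact hne t s (ht rfl) h'.symm
  subst hij
  simp only [add_right_inj] at h'
  simp [h']

end Rules

/-! ### Leading terms of the cleared discrete system -/

section Leading

theorem toLex_lt_of {a b : Fin 4 → ℕ} (i : Fin 4) (h : ∀ j < i, a j = b j) (h' : a i < b i) :
    toLex a < toLex b := ⟨i, h, h'⟩

/-- Polynomials in the variables that rank lower than `x`. -/
def lower (K : Type*) [Field K] (x : Var) : Subalgebra K (MvPolynomial Var K) :=
  supported K {y | rankLT y x}

/-- Polynomials in the shifts, respectively derivatives, of the variables in `A` with exponents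
at most `k`. -/
def within (K : Type*) [Field K] (A : Set (Fin 4)) (k : Fin 4 → ℕ) :
    Subalgebra K (MvPolynomial Var K) :=
  supported K {y | y.1 ∈ A ∧ toLex y.2 ≤ toLex k}

variable {K : Type*} [Field K]

/-- There are two ways to rank below `x`: a smaller shift, whatever the dependent variable, or the
same shift and a lower dependent variable. -/
theorem within_le_lower {A : Set (Fin 4)} {k : Fin 4 → ℕ} {x : Var}
    (h : toLex k < toLex x.2 ∨ k = x.2 ∧ ∀ α ∈ A, x.1 < α) : within K A k ≤ lower K x := by
  refine supported_mono fun y hy => ?_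
  rcases h with h | ⟨rfl, h⟩
  · exact Or.inl (hy.2.trans_lt h)
  · rcases hy.2.lt_or_eq with h' | h'
    · exact Or.inl h'
    · exact Or.inr ⟨toLex.injective h', h _ hy.1⟩

theorem X_mem_within {A : Set (Fin 4)} {k l : Fin 4 → ℕ} {α : Fin 4} (hα : α ∈ A)
    (h : toLex l ≤ toLex k) : (X (α, l) : MvPolynomial Var K) ∈ within K A k :=
  X_mem_supported.2 ⟨hα, h⟩

theorem shift_mem_within {A : Set (Fin 4)} {k l s : Fin 4 → ℕ} {f : ShiftPoly ℕ}
    (hf : f ∈ within StepField A k) (h : toLex (k + s) ≤ toLex l) :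
    shift s f ∈ within StepField A l := by
  refine map_mem_of_mem_supported (F := (shift s).toRingHom) (T := (within StepField A l).toSubring)
    (fun a => ?_) (fun y hy => ?_) hf
  · exact (congrArg (· ∈ within StepField A l) ((shift s).commutes a)).mpr
      (Subalgebra.algebraMap_mem _ a)
  · refine (congrArg (· ∈ within StepField A l) (shift_X s y)).mpr
      (X_mem_within hy.1 (le_trans ?_ h))
    simpa only [toLex_add] using add_le_add_left hy.2 (toLex s)

theorem shift_mem_lower {x : Var} {s : Fin 4 → ℕ} {f : ShiftPoly ℕ}
    (hf : f ∈ lower StepField x) : shift s f ∈ lower StepField (x.1, x.2 + s) := by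
  refine map_mem_of_mem_supported (F := (shift s).toRingHom)
    (T := (lower StepField (x.1, x.2 + s)).toSubring) (fun a => ?_) (fun y hy => ?_) hf
  · exact (congrArg (· ∈ lower StepField (x.1, x.2 + s)) ((shift s).commutes a)).mpr
      (Subalgebra.algebraMap_mem _ a)
  · exact (congrArg (· ∈ lower StepField (x.1, x.2 + s)) (shift_X s y)).mpr
      (X_mem_supported.2 (rankLT_add s hy))

theorem toLex_center_sub_le (i : Fin 3) (k : Fin 4 → ℕ) :
    toLex (k + (center - Pi.single i.succ 1)) ≤ toLex (k + (center + Pi.single i.succ 1)) :=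
  Pi.toLex_monotone (add_le_add_right (tsub_le_self.trans le_self_add) k)

theorem toLex_center_le (i : Fin 3) (k : Fin 4 → ℕ) :
    toLex (k + center) ≤ toLex (k + (center + Pi.single i.succ 1)) :=
  Pi.toLex_monotone (add_le_add_right le_self_add k)

theorem toLex_center_add_le (i : Fin 3) (k : Fin 4 → ℕ) :
    toLex (k + (center + Pi.single i.succ 1)) ≤ toLex (k + (center + Pi.single 1 1)) := by
  have : toLex (center + Pi.single i.succ 1) ≤ toLex (center + Pi.single 1 1) := by
    fin_cases i
    · exact le_rfl
    · exact (toLex_lt_of 1 (by decide) (by decide)).le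
    · exact (toLex_lt_of 1 (by decide) (by decide)).le
  simpa only [toLex_add] using add_le_add_right this (toLex k)

theorem clearedDx_mem_within {A : Set (Fin 4)} {k l : Fin 4 → ℕ} {f : ShiftPoly ℕ} (i : Fin 3)
    (hf : f ∈ within StepField A k) (h : toLex (k + (center + Pi.single i.succ 1)) ≤ toLex l) :
    clearedDx i f ∈ within StepField A l :=
  Subalgebra.smul_mem _ (sub_mem (shift_mem_within hf h)
    (shift_mem_within hf ((toLex_center_sub_le i k).trans h))) _

theorem clearedLaplace_mem_within {A : Set (Fin 4)} {k l : Fin 4 → ℕ} {f : ShiftPoly ℕ}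
    (hf : f ∈ within StepField A k) (h : toLex (k + (center + Pi.single 1 1)) ≤ toLex l) :
    clearedLaplace f ∈ within StepField A l := by
  refine sum_mem fun i _ => Subalgebra.smul_mem _ (add_mem (sub_mem ?_ ?_) ?_) _
  · exact shift_mem_within hf ((toLex_center_add_le i k).trans h)
  · rw [two_mul]
    have := shift_mem_within hf
      (((toLex_center_le i k).trans (toLex_center_add_le i k)).trans h)
    exact add_mem this this
  · exact shift_mem_within hf
      (((toLex_center_sub_le i k).trans (toLex_center_add_le i k)).trans h)

theorem natVel_mem_within (i : Fin 3) : natVel i ∈ within StepField {α | 0 < α} 0 :=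
  X_mem_within (Fin.succ_pos i) le_rfl

theorem natVel_mem_within_univ (i : Fin 3) : natVel i ∈ within StepField Set.univ 0 :=
  X_mem_within (Set.mem_univ _) le_rfl

theorem natPres_mem_within_univ : natPres ∈ within StepField Set.univ 0 :=
  X_mem_within (Set.mem_univ _) le_rfl

/-- The leading variables of the cleared discrete system. -/
def discreteLead : Fin 5 → Var :=
  ![(1, ![0, 3, 2, 2]), (1, ![1, 1, 1, 1]), (2, ![1, 1, 1, 1]), (3, ![1, 1, 1, 1]),
    (0, ![0, 4, 2, 2])]

/-- The leading coefficients of the cleared discrete system. -/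
def discreteLeadCoeff : Fin 5 → StepField :=
  ![(2 * step 1)⁻¹, (step 0)⁻¹, (step 0)⁻¹, (step 0)⁻¹, (2 * step 1)⁻¹ * (2 * step 1)⁻¹]

theorem clearedContinuity_tail :
    clearedContinuity - (2 * step 1)⁻¹ • X (1, ![0, 3, 2, 2])
      ∈ lower StepField (1, ![0, 3, 2, 2]) := by
  have h0 : shift center (clearedDx 0 (natVel 0)) - (2 * step 1)⁻¹ • X (1, ![0, 3, 2, 2])
      = -((2 * step 1)⁻¹ • X (1, ![0, 1, 2, 2])) := by
    have h1 : 0 + (center + Pi.single 1 1) + center = ![0, 3, 2, 2] := by decide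
    have h2 : 0 + (center - Pi.single 1 1) + center = ![0, 1, 2, 2] := by decide
    simp only [clearedDx, natVel, map_smul, map_sub, shift_X, Fin.succ_zero_eq_one, h1, h2,
      smul_sub]
    abel
  rw [clearedContinuity, Fin.sum_univ_three, map_add, map_add, add_assoc, add_sub_right_comm, h0]
  have hle : within StepField Set.univ ![0, 2, 3, 2] ≤ lower StepField (1, ![0, 3, 2, 2]) :=
    within_le_lower (Or.inl (toLex_lt_of 1 (by decide) (by decide)))
  refine hle (add_mem (neg_mem (Subalgebra.smul_mem _ (X_mem_within (Set.mem_univ _) ?_) _))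
    (add_mem ?_ ?_))
  · exact (toLex_lt_of 1 (by decide) (by decide)).le
  · refine shift_mem_within (clearedDx_mem_within 1 (natVel_mem_within_univ 1) le_rfl) (le_of_eq ?_)
    exact congrArg toLex (by decide)
  · refine shift_mem_within (clearedDx_mem_within 2 (natVel_mem_within_univ 2) le_rfl) ?_
    exact (toLex_lt_of 2 (by decide) (by decide)).le

theorem clearedMomentum_tail (i : Fin 3) :
    clearedMomentum i - (step 0)⁻¹ • X (i.succ, ![1, 1, 1, 1])
      ∈ lower StepField (i.succ, ![1, 1, 1, 1]) := by
  have h0 : clearedDt (natVel i) - (step 0)⁻¹ • X (i.succ, ![1, 1, 1, 1])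
      = -((step 0)⁻¹ • X (i.succ, ![0, 1, 1, 1])) := by
    have h1 : 0 + (center + Pi.single 0 1) = ![1, 1, 1, 1] := by decide
    have h2 : 0 + center = ![0, 1, 1, 1] := by decide
    simp only [clearedDt, natVel, shift_X, h1, h2, smul_sub]
    abel
  have h1 : clearedMomentum i - (step 0)⁻¹ • X (i.succ, ![1, 1, 1, 1])
      = -((step 0)⁻¹ • X (i.succ, ![0, 1, 1, 1]))
        + ∑ j : Fin 3, clearedDx j (natVel i * natVel j) + clearedDx i natPres
        - invRe • clearedLaplace (natVel i) := by
    rw [← h0, clearedMomentum]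
    abel
  -- Everything except the leading term lives at the old time level, and time is compared first, so
  -- the large spatial shifts are harmless.
  have hle : within StepField Set.univ ![0, 2, 1, 1] ≤ lower StepField (i.succ, ![1, 1, 1, 1]) :=
    within_le_lower (Or.inl (toLex_lt_of (b := ![1, 1, 1, 1]) 0 (by decide) (by decide)))
  have hc : toLex (0 + (center + Pi.single 1 1)) = toLex ![0, 2, 1, 1] :=
    congrArg toLex (by decide)
  rw [h1]
  refine hle (sub_mem (add_mem (add_mem (neg_mem (Subalgebra.smul_mem _
    (X_mem_within (Set.mem_univ _) ?_) _)) (sum_mem fun j _ => ?_)) ?_)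
    (Subalgebra.smul_mem _ ?_ _))
  · exact (toLex_lt_of 1 (by decide) (by decide)).le
  · exact clearedDx_mem_within j
      (mul_mem (natVel_mem_within_univ i) (natVel_mem_within_univ j))
      ((toLex_center_add_le j 0).trans hc.le)
  · exact clearedDx_mem_within i natPres_mem_within_univ
      ((toLex_center_add_le i 0).trans hc.le)
  · exact clearedLaplace_mem_within (natVel_mem_within_univ i) hc.le

theorem clearedPoisson_tail :
    clearedPoisson - ((2 * step 1)⁻¹ * (2 * step 1)⁻¹) • X (0, ![0, 4, 2, 2])
      ∈ lower StepField (0, ![0, 4, 2, 2]) := by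
  have h0 : clearedDx 0 (clearedDx 0 natPres)
        - ((2 * step 1)⁻¹ * (2 * step 1)⁻¹) • X (0, ![0, 4, 2, 2])
      = ((2 * step 1)⁻¹ * (2 * step 1)⁻¹) •
        (X (0, ![0, 0, 2, 2]) - X (0, ![0, 2, 2, 2]) - X (0, ![0, 2, 2, 2])) := by
    have h1 : 0 + (center + Pi.single 1 1) + (center + Pi.single 1 1) = ![0, 4, 2, 2] := by decide
    have h2 : 0 + (center - Pi.single 1 1) + (center + Pi.single 1 1) = ![0, 2, 2, 2] := by decide
    have h3 : 0 + (center + Pi.single 1 1) + (center - Pi.single 1 1) = ![0, 2, 2, 2] := by decide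
    have h4 : 0 + (center - Pi.single 1 1) + (center - Pi.single 1 1) = ![0, 0, 2, 2] := by decide
    simp only [clearedDx, natPres, map_smul, map_sub, shift_X, Fin.succ_zero_eq_one, h1, h2,
      h3, h4, smul_sub, smul_smul]
    abel
  have h1 : clearedPoisson - ((2 * step 1)⁻¹ * (2 * step 1)⁻¹) • X (0, ![0, 4, 2, 2])
      = ((2 * step 1)⁻¹ * (2 * step 1)⁻¹) •
          (X (0, ![0, 0, 2, 2]) - X (0, ![0, 2, 2, 2]) - X (0, ![0, 2, 2, 2]))
        + (clearedDx 1 (clearedDx 1 natPres) + clearedDx 2 (clearedDx 2 natPres))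
        + (∑ i : Fin 3, clearedDx i (clearedDx i (natVel i ^ 2))
          + 2 * (clearedDx 0 (clearedDx 1 (natVel 0 * natVel 1))
            + clearedDx 0 (clearedDx 2 (natVel 0 * natVel 2))
            + clearedDx 1 (clearedDx 2 (natVel 1 * natVel 2)))
          - invRe • ∑ i : Fin 3, clearedDx i (clearedLaplace (natVel i))) := by
    rw [← h0, clearedPoisson, Fin.sum_univ_three]
    abel
  -- The other pressure terms have smaller shifts. The differences in the second and third
  -- directions shift by only `2` in the first direction.
  have hle : within StepField Set.univ ![0, 3, 2, 2] ≤ lower StepField (0, ![0, 4, 2, 2]) :=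
    within_le_lower (Or.inl (toLex_lt_of 1 (by decide) (by decide)))
  -- The velocity terms do reach the shift of the leading term, through `D₁D₁(u²)` and `D₁Δu`; they
  -- are lower only because `p` ranks above the velocities.
  have hle' : within StepField {α | 0 < α} ![0, 4, 2, 2] ≤ lower StepField (0, ![0, 4, 2, 2]) :=
    within_le_lower (Or.inr ⟨rfl, fun _ h => h⟩)
  have hc : toLex (0 + (center + Pi.single 1 1) + (center + Pi.single 1 1))
      = toLex ![0, 4, 2, 2] := congrArg toLex (by decide)
  have hDD (i j : Fin 3) {f : ShiftPoly ℕ} (hf : f ∈ within StepField {α | 0 < α} 0) :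
      clearedDx i (clearedDx j f) ∈ within StepField {α | 0 < α} ![0, 4, 2, 2] :=
    clearedDx_mem_within i (clearedDx_mem_within j hf (toLex_center_add_le j 0))
      ((toLex_center_add_le i _).trans hc.le)
  have hv := natVel_mem_within
  rw [h1]
  refine add_mem (hle (add_mem (Subalgebra.smul_mem _ (sub_mem (sub_mem ?_ ?_) ?_) _)
    (add_mem ?_ ?_))) (hle' (sub_mem (add_mem ?_ ?_) (Subalgebra.smul_mem _ ?_ _)))
  · exact X_mem_within (Set.mem_univ _) (toLex_lt_of 1 (by decide) (by decide)).le
  · exact X_mem_within (Set.mem_univ _) (toLex_lt_of 1 (by decide) (by decide)).le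
  · exact X_mem_within (Set.mem_univ _) (toLex_lt_of 1 (by decide) (by decide)).le
  · exact clearedDx_mem_within 1 (clearedDx_mem_within 1 natPres_mem_within_univ le_rfl)
      (toLex_lt_of 1 (by decide) (by decide)).le
  · exact clearedDx_mem_within 2 (clearedDx_mem_within 2 natPres_mem_within_univ le_rfl)
      (toLex_lt_of 1 (by decide) (by decide)).le
  · exact sum_mem fun i _ => hDD i i (pow_mem (hv i) 2)
  · rw [two_mul]
    have := add_mem (add_mem (hDD 0 1 (mul_mem (hv 0) (hv 1))) (hDD 0 2 (mul_mem (hv 0) (hv 2))))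
      (hDD 1 2 (mul_mem (hv 1) (hv 2)))
    exact add_mem this this
  · exact sum_mem fun i _ => clearedDx_mem_within i (clearedLaplace_mem_within (hv i) le_rfl)
      ((toLex_center_add_le i _).trans hc.le)

theorem clearedSystem_tail (j : Fin 5) :
    clearedSystem j - discreteLeadCoeff j • X (discreteLead j)
      ∈ lower StepField (discreteLead j) := by
  fin_cases j
  · exact clearedContinuity_tail
  · exact clearedMomentum_tail 0
  · exact clearedMomentum_tail 1
  · exact clearedMomentum_tail 2
  · exact clearedPoisson_tail

theorem discreteLeadCoeff_ne_zero (j : Fin 5) : discreteLeadCoeff j ≠ 0 := by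
  have h (i : Fin 4) : (step i)⁻¹ ≠ 0 := inv_ne_zero (step_ne_zero i)
  have h' : (2 * step 1)⁻¹ ≠ 0 := inv_ne_zero (mul_ne_zero two_ne_zero (step_ne_zero 1))
  fin_cases j
  exacts [h', h 0, h 0, h 0, mul_ne_zero h' h']

end Leading

/-! ### Difference ideals and shift-closed kernels -/

section Closure

theorem nat_shift_induction {p : (Fin 4 → ℕ) → Prop} (h0 : p 0)
    (h : ∀ s i, p s → p (s + Pi.single i 1)) (s : Fin 4 → ℕ) : p s := by
  have key (i : Fin 4) (n : ℕ) (s : Fin 4 → ℕ) (hs : p s) : p (s + Pi.single i n) := by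
    induction n with
    | zero => simpa using hs
    | succ n ih => simpa [Pi.single_add, add_assoc] using h _ i ih
  have := key 3 (s 3) _ (key 2 (s 2) _ (key 1 (s 1) _ (key 0 (s 0) _ h0)))
  rwa [zero_add, ← Fin.sum_univ_four fun i => Pi.single i (s i), Finset.univ_sum_single] at this

theorem int_shift_induction {p : (Fin 4 → ℤ) → Prop} (h0 : p 0)
    (h : ∀ s i, p s → p (s + Pi.single i 1)) (h' : ∀ s i, p s → p (s + Pi.single i (-1)))
    (s : Fin 4 → ℤ) : p s := by
  have key (i : Fin 4) (n : ℤ) (s : Fin 4 → ℤ) (hs : p s) : p (s + Pi.single i n) := by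
    induction n with
    | zero => simpa using hs
    | succ n ih => simpa [Pi.single_add, add_assoc] using h _ i ih
    | pred n ih => simpa [Pi.single_add, sub_eq_add_neg, add_assoc] using h' _ i ih
  have := key 3 (s 3) _ (key 2 (s 2) _ (key 1 (s 1) _ (key 0 (s 0) _ h0)))
  rwa [zero_add, ← Fin.sum_univ_four fun i => Pi.single i (s i), Finset.univ_sum_single] at this

theorem subset_differenceIdeal (G : Set (ShiftPoly ℕ)) : G ⊆ differenceIdeal G := fun _ hf =>
  Ideal.mem_sInf.2 fun {_} hI => hI.1 hf

theorem shift_mem_differenceIdeal {G : Set (ShiftPoly ℕ)} {f : ShiftPoly ℕ}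
    (hf : f ∈ differenceIdeal G) (s : Fin 4 → ℕ) : shift s f ∈ differenceIdeal G := by
  induction s using nat_shift_induction with
  | h0 => rwa [shift_zero]
  | h s i ih =>
    rw [← shift_shift]
    exact Ideal.mem_sInf.2 fun {I} hI => hI.2 i _ (Ideal.mem_sInf.1 ih hI)

theorem differenceIdeal_le {G : Set (ShiftPoly ℕ)} {I : Ideal (ShiftPoly ℕ)} (hG : G ⊆ I)
    (hI : ∀ s, ∀ f ∈ I, shift s f ∈ I) : differenceIdeal G ≤ I :=
  sInf_le ⟨hG, fun _ => hI _⟩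

theorem subset_inversiveDifferenceIdeal (G : Set (ShiftPoly ℤ)) :
    G ⊆ inversiveDifferenceIdeal G := fun _ hf => Ideal.mem_sInf.2 fun {_} hI => hI.1 hf

theorem shift_mem_inversiveDifferenceIdeal {G : Set (ShiftPoly ℤ)} {f : ShiftPoly ℤ}
    (hf : f ∈ inversiveDifferenceIdeal G) (s : Fin 4 → ℤ) :
    shift s f ∈ inversiveDifferenceIdeal G := by
  induction s using int_shift_induction with
  | h0 => rwa [shift_zero]
  | h s i ih =>
    rw [← shift_shift]
    exact Ideal.mem_sInf.2 fun {I} hI => (hI.2 i _ (Ideal.mem_sInf.1 ih hI)).1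
  | h' s i ih =>
    rw [← shift_shift]
    exact Ideal.mem_sInf.2 fun {I} hI => (hI.2 i _ (Ideal.mem_sInf.1 ih hI)).2

theorem inversiveDifferenceIdeal_le {G : Set (ShiftPoly ℤ)} {I : Ideal (ShiftPoly ℤ)}
    (hG : G ⊆ I) (hI : ∀ s, ∀ f ∈ I, shift s f ∈ I) : inversiveDifferenceIdeal G ≤ I :=
  sInf_le ⟨hG, fun _ _ hf => ⟨hI _ _ hf, hI _ _ hf⟩⟩

/-- The largest ideal that is closed under the shifts in the submonoid `M` and on which the
homomorphism `φ` vanishes. -/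
def shiftKernel {S : Type} [AddCommMonoid S] {A : Type*} [CommRing A] (φ : ShiftPoly S →+* A)
    (M : AddSubmonoid (Fin 4 → S)) : Ideal (ShiftPoly S) :=
  ⨅ s : M, RingHom.ker (φ.comp (shift (s : Fin 4 → S)).toRingHom)

theorem mem_shiftKernel {S : Type} [AddCommMonoid S] {A : Type*} [CommRing A]
    {φ : ShiftPoly S →+* A} {M : AddSubmonoid (Fin 4 → S)} {f : ShiftPoly S} :
    f ∈ shiftKernel φ M ↔ ∀ s ∈ M, φ (shift s f) = 0 := by
  simp [shiftKernel, RingHom.mem_ker]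

theorem shift_mem_shiftKernel {S : Type} [AddCommMonoid S] {A : Type*} [CommRing A]
    {φ : ShiftPoly S →+* A} {M : AddSubmonoid (Fin 4 → S)} {f : ShiftPoly S}
    (hf : f ∈ shiftKernel φ M) {s : Fin 4 → S} (hs : s ∈ M) : shift s f ∈ shiftKernel φ M := by
  rw [mem_shiftKernel] at hf ⊢
  intro t ht
  rw [shift_shift]
  exact hf _ (M.add_mem hs ht)

theorem smul_mem_ideal {R A : Type*} [CommSemiring R] [CommRing A] [Algebra R A] {I : Ideal A}
    (a : R) {f : A} (hf : f ∈ I) : a • f ∈ I := by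
  rw [Algebra.smul_def]
  exact I.mul_mem_left _ hf

end Closure

/-! ### Normal forms modulo the difference ideal -/

section NormalForm

/-- The rewriting rules of the cleared discrete system, with leading coefficient `1`. -/
def discreteRule (p : RuleIndex) : MvPowerSeries Empty (ShiftPoly ℕ) :=
  MvPowerSeries.C (shift p.1.2 ((discreteLeadCoeff p.1.1)⁻¹ • clearedSystem p.1.1))

theorem ruleLead_discreteLead_injective : Function.Injective (ruleLead discreteLead) :=
  ruleLead_injective (by ext j; fin_cases j <;> rfl) rfl (by decide)

/-- Power series in no variables are just polynomials, so the deformation theorem, applied with an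
empty set of parameters, performs ordinary elimination of the leading variables. -/
theorem isTriangular_discreteRule : IsTriangular rankLT (ruleLead discreteLead) discreteRule where
  wf := wellFounded_rankLT
  injective := ruleLead_discreteLead_injective
  tail p := by
    have h : MvPowerSeries.constantCoeff (discreteRule p) - X (ruleLead discreteLead p)
        = shift p.1.2 ((discreteLeadCoeff p.1.1)⁻¹ • (clearedSystem p.1.1
          - discreteLeadCoeff p.1.1 • X (discreteLead p.1.1))) := by
      rw [discreteRule, MvPowerSeries.constantCoeff_C, smul_sub, smul_smul,
        inv_mul_cancel₀ (discreteLeadCoeff_ne_zero _), one_smul, map_sub, shift_X]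
      rfl
    rw [h]
    exact shift_mem_lower (Subalgebra.smul_mem _ (clearedSystem_tail p.1.1) _)

/-- Completeness of the rules: the time shifts of continuity, which are not rules, are recovered one
step at a time from the integrability condition. -/
theorem clearedSystem_mem_shiftKernel {φ : ShiftPoly ℕ →+* ShiftPoly ℕ}
    (hφ : ∀ p : RuleIndex, φ (shift p.1.2 (clearedSystem p.1.1)) = 0) (j : Fin 5) :
    clearedSystem j ∈ shiftKernel φ ⊤ := by
  have hne (j : Fin 5) (hj : j ≠ 0) : clearedSystem j ∈ shiftKernel φ ⊤ :=
    mem_shiftKernel.2 fun s _ => hφ ⟨(j, s), fun h => absurd h hj⟩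
  rcases eq_or_ne j 0 with rfl | hj
  swap
  · exact hne j hj
  have hM (i : Fin 3) : clearedMomentum i ∈ shiftKernel φ ⊤ := by
    fin_cases i
    exacts [hne 1 (by decide), hne 2 (by decide), hne 3 (by decide)]
  have hP : clearedPoisson ∈ shiftKernel φ ⊤ := hne 4 (by decide)
  have hstep : step 0 • (∑ i : Fin 3, clearedDx i (clearedMomentum i) - clearedPoisson)
      ∈ shiftKernel φ ⊤ := by
    refine smul_mem_ideal _ (sub_mem (sum_mem fun i _ => smul_mem_ideal _ (sub_mem ?_ ?_)) hP)
    · exact shift_mem_shiftKernel (hM i) trivial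
    · exact shift_mem_shiftKernel (hM i) trivial
  refine mem_shiftKernel.2 fun s _ => ?_
  induction hn : s 0 generalizing s with
  | zero => exact hφ ⟨(0, s), fun _ => hn⟩
  | succ n ih =>
    obtain ⟨t, rfl⟩ : ∃ t : Fin 4 → ℕ, s = Pi.single 0 1 + t := by
      refine ⟨s - Pi.single 0 1, (add_tsub_cancel_of_le fun i => ?_).symm⟩
      by_cases hi : i = 0
      · subst hi
        simp [hn]
      · simp [hi]
    have ht : t 0 = n := by
      simp only [Pi.add_apply, Pi.single_eq_same] at hn
      omega
    have hc : shift (Pi.single 0 1) (clearedSystem 0) = clearedSystem 0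
      + step 0 • (∑ i : Fin 3, clearedDx i (clearedMomentum i) - clearedPoisson) :=
      shift_time_clearedContinuity
    rw [← shift_shift, hc, map_add, map_add, ih t trivial ht,
      mem_shiftKernel.1 hstep t trivial, add_zero]

/-- The normal form modulo the cleared discrete system. -/
theorem exists_normalForm : ∃ φ : ShiftPoly ℕ →+* ShiftPoly ℕ, (∀ a, φ (C a) = C a) ∧
    (∀ x ∉ Set.range (ruleLead discreteLead), φ (X x) = X x) ∧
    (∀ x ∈ Set.range (ruleLead discreteLead), φ (X x) ∈ lower StepField x) ∧
    RingHom.ker φ = differenceIdeal (Set.range clearedSystem) := by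
  obtain ⟨E, hE⟩ := isTriangular_discreteRule.exists_isSolution
  refine ⟨MvPowerSeries.constantCoeff.comp E, fun a => ?_, fun x hx => ?_, ?_, ?_⟩
  · rw [RingHom.comp_apply, hE.map_C, MvPowerSeries.constantCoeff_C]
  · rw [RingHom.comp_apply, hE.map_X x hx, MvPowerSeries.constantCoeff_C]
  · rintro _ ⟨p, rfl⟩
    exact hE.constantCoeff_lead_mem_supported isTriangular_discreteRule p
  have hc (p : RuleIndex) : MvPowerSeries.constantCoeff (discreteRule p)
      = (discreteLeadCoeff p.1.1)⁻¹ • shift p.1.2 (clearedSystem p.1.1) := by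
    rw [discreteRule, MvPowerSeries.constantCoeff_C, map_smul]
  apply le_antisymm
  -- Every `f` is congruent to its normal form modulo the ideal, so a vanishing normal form means
  -- membership.
  · intro f hf
    have := hE.sub_constantCoeff_mem isTriangular_discreteRule
      (J := differenceIdeal (Set.range clearedSystem)) (fun p => ?_) f
    · rwa [← RingHom.comp_apply, RingHom.mem_ker.1 hf, sub_zero] at this
    · rw [hc]
      exact smul_mem_ideal _ (shift_mem_differenceIdeal
        (subset_differenceIdeal _ (Set.mem_range_self _)) _)
  -- The kernel is not visibly closed under shifts, so the shift-closed ideal inside it is used; it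
  -- contains the five equations.
  · have hle : shiftKernel (MvPowerSeries.constantCoeff.comp E) ⊤
        ≤ RingHom.ker (MvPowerSeries.constantCoeff.comp E) := fun f hf => by
      have := mem_shiftKernel.1 hf 0 trivial
      rwa [shift_zero] at this
    refine le_trans (differenceIdeal_le ?_ fun s f hf =>
      shift_mem_shiftKernel hf (AddSubmonoid.mem_top s)) hle
    rintro _ ⟨j, rfl⟩
    refine clearedSystem_mem_shiftKernel (fun p => ?_) j
    have h := hE.constantCoeff_constantCoeff p
    rw [hc, smul_eq_C_mul, map_mul, map_mul, hE.map_C, MvPowerSeries.constantCoeff_C] at h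
    exact (mul_eq_zero.1 h).resolve_left fun h0 =>
      inv_ne_zero (discreteLeadCoeff_ne_zero p.1.1) (C_eq_zero.1 h0)

end NormalForm

/-! ### The Gröbner basis property -/

section Groebner

theorem lexLT_asymm {v w : Mon} (h : lexLT v w) (h' : lexLT w v) : False :=
  lexLT_irrefl _ (lexLT_trans h h')

theorem IsLeadingMon.unique {f : ShiftPoly ℕ} {m m' : Mon} (h : IsLeadingMon lexLT f m)
    (h' : IsLeadingMon lexLT f m') : m = m' := by
  by_contra hne
  exact lexLT_asymm (h.2 m' h'.1 (Ne.symm hne)) (h'.2 m h.1 hne)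

theorem exists_isLeadingMon {f : ShiftPoly ℕ} (hf : f ≠ 0) : ∃ m, IsLeadingMon lexLT f m := by
  have key (s : Finset Mon) (hs : s.Nonempty) : ∃ m ∈ s, ∀ m' ∈ s, m' ≠ m → lexLT m' m := by
    induction hs using Finset.Nonempty.cons_induction with
    | singleton a => exact ⟨a, by simp⟩
    | cons a s ha hs ih =>
      obtain ⟨m, hm, hmax⟩ := ih
      rcases lexLT_trichotomy a m with h | rfl | h
      · refine ⟨m, Finset.mem_cons_of_mem hm, fun m' hm' hne => ?_⟩
        rcases Finset.mem_cons.1 hm' with rfl | hm'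
        exacts [h, hmax m' hm' hne]
      · exact absurd hm ha
      · refine ⟨a, Finset.mem_cons_self a s, fun m' hm' hne => ?_⟩
        have hm' := (Finset.mem_cons.1 hm').resolve_left hne
        by_cases hm'm : m' = m
        · rwa [hm'm]
        · exact lexLT_trans (hmax m' hm' hm'm) h
  exact key f.support (support_nonempty.2 hf)

/-- All monomials of `f` are at most `m`. -/
def MonBounded (m : Mon) (f : ShiftPoly ℕ) : Prop := ∀ t ∈ f.support, t = m ∨ lexLT t m

theorem MonBounded.mul {m n : Mon} {f g : ShiftPoly ℕ} (hf : MonBounded m f)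
    (hg : MonBounded n g) : MonBounded (m + n) (f * g) := by
  classical
  intro t ht
  obtain ⟨a, ha, b, hb, rfl⟩ := Finset.mem_add.1 (support_mul f g ht)
  have hn (b : Mon) (h : lexLT b n) : lexLT (m + b) (m + n) := lexLT_add_left m h
  have hm (b : Mon) (h : lexLT a m) : lexLT (a + b) (m + b) := by
    simpa only [add_comm _ b] using lexLT_add_left b h
  rcases hf a ha with rfl | ha <;> rcases hg b hb with rfl | hb
  · exact Or.inl rfl
  · exact Or.inr (hn b hb)
  · exact Or.inr (hm _ ha)
  · exact Or.inr (lexLT_trans (hm b ha) (hn b hb))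

theorem monBounded_one : MonBounded 0 1 := fun t ht => by
  classical
  rw [mem_support_iff, coeff_one] at ht
  left
  by_contra h
  exact ht (if_neg (Ne.symm h))

theorem monBounded_of_mem_lower {x : Var} {f : ShiftPoly ℕ} (hf : f ∈ lower StepField x) :
    ∀ t ∈ f.support, lexLT t (Finsupp.single x 1) := fun t ht =>
  lexLT_single_of_forall_rankLT fun y hy =>
    mem_supported.1 hf ((mem_vars_iff_mem_support y).2 ⟨t, ht, hy⟩)

variable {φ : ShiftPoly ℕ →+* ShiftPoly ℕ} {N : Set Var}

/-- Reduction replaces a variable by a polynomial in lower variables, so it never raises a monomial;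
the bound is multiplicative. -/
theorem monBounded_map_monomial (hirr : ∀ x ∉ N, φ (X x) = X x)
    (hred : ∀ x ∈ N, φ (X x) ∈ lower StepField x) (m : Mon) : MonBounded m (φ (monomial m 1)) := by
  have hX (x : Var) : MonBounded (Finsupp.single x 1) (φ (X x)) := by
    by_cases hx : x ∈ N
    · exact fun t ht => Or.inr (monBounded_of_mem_lower (hred x hx) t ht)
    · rw [hirr x hx]
      intro t ht
      rw [support_X, Finset.mem_singleton] at ht
      exact Or.inl ht
  induction m using Finsupp.induction_linear with
  | zero => simpa using monBounded_one
  | add m n hm hn =>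
    rw [show monomial (m + n) (1 : StepField) = monomial m 1 * monomial n 1 by
      rw [monomial_mul, one_mul], map_mul]
    exact hm.mul hn
  | single x n =>
    induction n with
    | zero => simpa using monBounded_one
    | succ n ih =>
      rw [Finsupp.single_add, show monomial (Finsupp.single x n + Finsupp.single x 1)
        (1 : StepField) = monomial (Finsupp.single x n) 1 * X x by
          rw [X, monomial_mul, one_mul], map_mul]
      exact ih.mul (hX x)

theorem map_monomial_of_forall_notMem (hirr : ∀ x ∉ N, φ (X x) = X x) {m : Mon}
    (hm : ∀ x ∈ m.support, x ∉ N) : φ (monomial m 1) = monomial m 1 := by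
  rw [monomial_eq, map_mul, map_one, map_one, one_mul, one_mul, Finsupp.prod, map_prod]
  exact Finset.prod_congr rfl fun x hx => by rw [map_pow, hirr x (hm x hx)]

/-- The leading monomial of an element of the kernel of a normal form contains a reducible
variable. -/
theorem exists_mem_support_of_isLeadingMon (hC : ∀ a, φ (C a) = C a)
    (hirr : ∀ x ∉ N, φ (X x) = X x) (hred : ∀ x ∈ N, φ (X x) ∈ lower StepField x) {f : ShiftPoly ℕ}
    (hf : φ f = 0) {m : Mon} (hm : IsLeadingMon lexLT f m) : ∃ x ∈ m.support, x ∈ N := by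
  by_contra! hN
  have h : φ f = ∑ t ∈ f.support, C (f.coeff t) * φ (monomial t 1) := by
    conv_lhs => rw [f.as_sum, map_sum]
    refine Finset.sum_congr rfl fun t _ => ?_
    rw [← hC, ← map_mul, C_mul_monomial, mul_one]
  -- An irreducible leading monomial is fixed by `φ`, while the other monomials of `f` have images
  -- strictly below it. Its coefficient would survive in `φ f`.
  have h' : coeff m (φ f) = coeff m f := by
    rw [h, coeff_sum, Finset.sum_eq_single m]
    · rw [coeff_C_mul, map_monomial_of_forall_notMem hirr hN, coeff_monomial, if_pos rfl, mul_one]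
    · intro t ht hne
      rw [coeff_C_mul]
      refine mul_eq_zero_of_right _ (notMem_support_iff.1 fun hmt => ?_)
      rcases monBounded_map_monomial hirr hred t m hmt with rfl | hlt
      · exact hne rfl
      · exact lexLT_asymm hlt (hm.2 t ht hne)
    · intro hmf
      exact absurd hm.1 hmf
  rw [hf, coeff_zero] at h'
  exact mem_support_iff.1 hm.1 h'.symm

theorem isLeadingMon_clearedSystem (j : Fin 5) :
    IsLeadingMon lexLT (clearedSystem j) (Finsupp.single (discreteLead j) 1) := by
  classical
  set x := discreteLead j
  have ht := monBounded_of_mem_lower (clearedSystem_tail j)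
  have h (m : Mon) : coeff m (clearedSystem j) = discreteLeadCoeff j
      * (if Finsupp.single x 1 = m then 1 else 0)
      + coeff m (clearedSystem j - discreteLeadCoeff j • X x) := by
    rw [coeff_sub, coeff_smul, coeff_X, smul_eq_mul]
    ring
  have hx : coeff (Finsupp.single x 1) (clearedSystem j - discreteLeadCoeff j • X x) = 0 :=
    notMem_support_iff.1 fun hmem => lexLT_irrefl _ (ht _ hmem)
  refine ⟨mem_support_iff.2 ?_, fun m hm hne => ht m (mem_support_iff.2 fun h0 => ?_)⟩
  · rw [h, hx, if_pos rfl, mul_one, add_zero]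
    exact discreteLeadCoeff_ne_zero j
  · refine mem_support_iff.1 hm ?_
    rw [h, h0, if_neg (Ne.symm hne), mul_zero, add_zero]

theorem monShift_single (s : Fin 4 → ℕ) (x : Var) :
    monShift s (Finsupp.single x 1) = Finsupp.single (x.1, x.2 + s) 1 :=
  Finsupp.mapDomain_single

/-- A reducible variable in the leading monomial is a shift of the leading variable of one of the
equations. That equation leads with this single variable to the first power, so divisibility is
immediate. -/
theorem isGroebnerBasis_clearedSystem :
    IsGroebnerBasis lexLT (Set.range clearedSystem)
      (differenceIdeal (Set.range clearedSystem)) := by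
  refine ⟨rfl, fun f hf hf0 => ?_⟩
  obtain ⟨φ, hC, hirr, hred, hker⟩ := exists_normalForm
  obtain ⟨m, hm⟩ := exists_isLeadingMon hf0
  rw [← hker] at hf
  obtain ⟨_, hx, p, rfl⟩ := exists_mem_support_of_isLeadingMon hC hirr hred hf hm
  refine ⟨_, Set.mem_range_self p.1.1, m, _, hm, isLeadingMon_clearedSystem p.1.1,
    m - Finsupp.single (ruleLead discreteLead p) 1, p.1.2, ?_⟩
  rw [monShift_single]
  refine (tsub_add_cancel_of_le ?_).symm
  rw [Finsupp.single_le_iff]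
  exact Nat.one_le_iff_ne_zero.2 (Finsupp.mem_support_iff.1 hx)

/-- Only the two equations leading in `u` could interfere. One leading shift has the larger time
exponent and the other has the larger `σ₁` exponent, so neither is a right shift of the other. -/
theorem isHeadReduced_clearedSystem : IsHeadReduced lexLT (Set.range clearedSystem) := by
  rintro _ ⟨i, rfl⟩ _ ⟨⟨j, rfl⟩, hne⟩ ⟨mf, mg, hf, hg, t, s, h⟩
  have hij : i ≠ j := by
    rintro rfl
    exact hne rfl
  rw [hf.unique (isLeadingMon_clearedSystem i), hg.unique (isLeadingMon_clearedSystem j),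
    monShift_single] at h
  have hx : discreteLead i = ((discreteLead j).1, (discreteLead j).2 + s) := by
    by_contra hx
    have := DFunLike.congr_fun h ((discreteLead j).1, (discreteLead j).2 + s)
    rw [Finsupp.single_eq_of_ne (Ne.symm hx), Finsupp.add_apply, Finsupp.single_eq_same] at this
    omega
  have hvar : (discreteLead i).1 = (discreteLead j).1 := (Prod.ext_iff.1 hx).1
  have h0 : (discreteLead i).2 0 = (discreteLead j).2 0 + s 0 :=
    congrFun (Prod.ext_iff.1 hx).2 0
  have h1 : (discreteLead i).2 1 = (discreteLead j).2 1 + s 1 :=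
    congrFun (Prod.ext_iff.1 hx).2 1
  have hcases : i = 0 ∧ j = 1 ∨ i = 1 ∧ j = 0 := by
    clear h hf hg hne hx h0 h1
    revert i j
    decide
  rcases hcases with ⟨rfl, rfl⟩ | ⟨rfl, rfl⟩
  · change 0 = 1 + s 0 at h0
    omega
  · change 1 = 3 + s 1 at h1
    omega

end Groebner

/-! ### Inversive ideals, primality and perfect closure -/

section Inversive

/-- A polynomial involves finitely many variables, so a large enough right shift removes all
negative exponents. -/
theorem exists_natInclusion_eq_shift (f : ShiftPoly ℤ) :
    ∃ s : Fin 4 → ℕ, ∃ g, natInclusion g = shift (castShift s) f := by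
  induction f using MvPolynomial.induction_on with
  | C a => exact ⟨0, C a, ((natInclusion.commutes a).trans ((shift _).commutes a).symm)⟩
  | add f g hf hg =>
    obtain ⟨s, f', hf⟩ := hf
    obtain ⟨t, g', hg⟩ := hg
    refine ⟨s + t, shift t f' + shift s g', ?_⟩
    rw [map_add, map_add, natInclusion_shift, natInclusion_shift, hf, hg, shift_shift,
      shift_shift, castShift_add, add_comm (castShift t)]
  | mul_X f x hf =>
    obtain ⟨s, f', hf⟩ := hf
    -- Shifting by the absolute value of an exponent makes it non-negative.
    let t : Fin 4 → ℕ := fun i => (x.2 i).natAbs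
    let u : Fin 4 → ℕ := fun i => (x.2 i + (x.2 i).natAbs).toNat
    refine ⟨s + t, shift t f' * shift s (X (x.1, u)), ?_⟩
    have hu : castShift u = x.2 + castShift t := by
      ext i
      simp only [castShift, u, t, Pi.add_apply]
      omega
    rw [map_mul, map_mul, natInclusion_shift, natInclusion_shift, hf, natInclusion_X, hu,
      shift_shift, shift_X, shift_X, castShift_add, add_comm (castShift s), add_assoc]

/-- The reduction of membership in the inversive difference ideal to nonnegative shifts. -/
theorem mem_inversiveDifferenceIdeal_iff (f : ShiftPoly ℤ) :
    f ∈ inversiveDifferenceIdeal (Set.range discreteSystem) ↔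
      ∃ s : Fin 4 → ℕ, ∃ g ∈ differenceIdeal (Set.range clearedSystem),
        natInclusion g = shift (castShift s) f := by
  constructor
  -- The polynomials having a right shift in the difference ideal form an ideal; common right shifts
  -- provide common denominators. It contains the system and is closed under all integer shifts.
  · let I : Ideal (ShiftPoly ℤ) :=
      { carrier := {f | ∃ s : Fin 4 → ℕ, ∃ g ∈ differenceIdeal (Set.range clearedSystem),
          natInclusion g = shift (castShift s) f}
        zero_mem' := ⟨0, 0, zero_mem _, by simp⟩
        add_mem' := by
          rintro f f' ⟨s, g, hg, h⟩ ⟨s', g', hg', h'⟩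
          refine ⟨s + s', shift s' g + shift s g',
            add_mem (shift_mem_differenceIdeal hg s') (shift_mem_differenceIdeal hg' s), ?_⟩
          rw [map_add, map_add, natInclusion_shift, natInclusion_shift, h, h', shift_shift,
            shift_shift, castShift_add, add_comm (castShift s')]
        smul_mem' := by
          rintro c f ⟨s, g, hg, h⟩
          obtain ⟨t, c', hc⟩ := exists_natInclusion_eq_shift c
          refine ⟨s + t, shift s c' * shift t g,
            Ideal.mul_mem_left _ _ (shift_mem_differenceIdeal hg t), ?_⟩
          rw [smul_eq_mul, map_mul, map_mul, natInclusion_shift, natInclusion_shift, hc, h,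
            shift_shift, shift_shift, castShift_add, add_comm (castShift t)] }
    have hle : inversiveDifferenceIdeal (Set.range discreteSystem) ≤ I := by
      refine inversiveDifferenceIdeal_le ?_ ?_
      · rintro _ ⟨j, rfl⟩
        refine ⟨![center + center, center, center, center, center + center] j, clearedSystem j,
          subset_differenceIdeal _ (Set.mem_range_self j), ?_⟩
        rw [natInclusion_clearedSystem, clearing_center]
        fin_cases j <;> rfl
      · rintro s f ⟨t, g, hg, h⟩
        let u : Fin 4 → ℕ := fun i => (s i).natAbs
        let v : Fin 4 → ℕ := fun i => (s i + (s i).natAbs).toNat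
        have hv : castShift v = s + castShift u := by
          ext i
          simp only [castShift, u, v, Pi.add_apply]
          omega
        refine ⟨t + u, shift v g, shift_mem_differenceIdeal hg v, ?_⟩
        rw [natInclusion_shift, h, hv, shift_shift, shift_shift, castShift_add]
        congr 2
        abel
    exact fun hf => hle hf
  · rintro ⟨s, g, hg, h⟩
    have hle : differenceIdeal (Set.range clearedSystem)
        ≤ (inversiveDifferenceIdeal (Set.range discreteSystem)).comap natInclusion := by
      refine differenceIdeal_le ?_ fun t f hf => ?_
      · rintro _ ⟨j, rfl⟩
        have := shift_mem_inversiveDifferenceIdeal (subset_inversiveDifferenceIdeal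
          (Set.range discreteSystem) (Set.mem_range_self j)) (clearing j)
        rwa [← natInclusion_clearedSystem] at this
      · rw [Ideal.mem_comap] at hf ⊢
        rw [natInclusion_shift]
        exact shift_mem_inversiveDifferenceIdeal hf _
    have hmem : natInclusion g ∈ inversiveDifferenceIdeal (Set.range discreteSystem) := hle hg
    rw [h] at hmem
    have := shift_mem_inversiveDifferenceIdeal hmem (-castShift s)
    rwa [shift_shift, add_neg_cancel, shift_zero] at this

/-- The ideal is the kernel of a ring homomorphism into a domain. -/
theorem isPrime_differenceIdeal_clearedSystem :
    (differenceIdeal (Set.range clearedSystem)).IsPrime := by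
  obtain ⟨φ, -, -, -, hker⟩ := exists_normalForm
  rw [← hker]
  exact RingHom.ker_isPrime φ

/-- Primality passes from the difference ideal with non-negative shifts by moving both factors and
their product to a common right shift. -/
theorem isPrime_inversiveDifferenceIdeal :
    (inversiveDifferenceIdeal (Set.range discreteSystem)).IsPrime := by
  have hprime := isPrime_differenceIdeal_clearedSystem
  refine Ideal.isPrime_iff.2 ⟨fun h => ?_, fun {a b} hab => ?_⟩
  · obtain ⟨s, g, hg, h⟩ := (mem_inversiveDifferenceIdeal_iff 1).1 (h ▸ trivial)
    rw [map_one, ← map_one natInclusion] at h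
    rw [natInclusion_injective h] at hg
    exact hprime.ne_top ((Ideal.eq_top_iff_one _).2 hg)
  · obtain ⟨s, g, hg, h⟩ := (mem_inversiveDifferenceIdeal_iff _).1 hab
    obtain ⟨t, a', ha⟩ := exists_natInclusion_eq_shift a
    obtain ⟨u, b', hb⟩ := exists_natInclusion_eq_shift b
    have key : shift (s + u) a' * shift (s + t) b' = shift (t + u) g := by
      apply natInclusion_injective
      rw [map_mul, natInclusion_shift, natInclusion_shift, natInclusion_shift, ha, hb, h,
        map_mul, map_mul]
      simp only [shift_shift, castShift_add]
      congr 3 <;> abel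
    have hmem : shift (s + u) a' * shift (s + t) b'
        ∈ differenceIdeal (Set.range clearedSystem) := key ▸ shift_mem_differenceIdeal hg _
    rcases hprime.mem_or_mem hmem with h' | h'
    · refine Or.inl ((mem_inversiveDifferenceIdeal_iff a).2 ⟨t + (s + u), _, h', ?_⟩)
      rw [natInclusion_shift, ha, shift_shift, castShift_add t]
    · refine Or.inr ((mem_inversiveDifferenceIdeal_iff b).2 ⟨u + (s + t), _, h', ?_⟩)
      rw [natInclusion_shift, hb, shift_shift, castShift_add u]

/-- A prime ideal closed under all inverse shifts is perfect: some factor of the product lies in it,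
hence its base, which can be shifted back. Conversely, a perfect ideal is closed under inverse
shifts. -/
theorem inversiveDifferenceIdeal_eq_perfectDifferenceIdeal :
    inversiveDifferenceIdeal (Set.range discreteSystem)
      = perfectDifferenceIdeal (Set.range discreteSystem) := by
  have hprime := isPrime_inversiveDifferenceIdeal
  apply le_antisymm
  · refine le_sInf fun I hI => sInf_le ⟨hI.1, fun i f hf => ⟨hI.2.1 i f hf, ?_⟩⟩
    -- The one-factor product `σᵢ(σᵢ⁻¹ f) = f` lies in the perfect ideal, hence so does `σᵢ⁻¹ f`.
    refine hI.2.2 _ 1 (fun _ => Pi.single i 1) (fun _ => 1) ?_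
    have hs : shift (fun j => ((Pi.single i 1 : Fin 4 → ℕ) j : ℤ))
        (shift (Pi.single i (-1)) f) = f := by
      change shift (castShift (Pi.single i 1)) _ = f
      rw [castShift_single, shift_shift, ← Pi.single_add, neg_add_cancel, Pi.single_zero,
        shift_zero]
    simpa only [Fin.prod_univ_one, pow_one, hs] using hf
  · refine sInf_le ⟨subset_inversiveDifferenceIdeal _,
      fun i f hf => shift_mem_inversiveDifferenceIdeal hf _, fun f r θ k h => ?_⟩
    obtain ⟨j, -, hj⟩ := hprime.prod_mem_iff.1 h
    have := shift_mem_inversiveDifferenceIdeal (hprime.mem_of_pow_mem _ hj)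
      (-fun i => (θ j i : ℤ))
    rwa [shift_shift, add_neg_cancel, shift_zero] at this

end Inversive

/-! ### Powers of the derivations -/

section Derivatives

theorem deriv_X (i : Fin 4) (x : Var) : deriv i (X x) = X (x.1, x.2 + Pi.single i 1) :=
  mkDerivation_X ..

theorem deriv_C (i : Fin 4) (a : CoeffField) : deriv i (C a) = 0 := (deriv i).map_algebraMap a

theorem deriv_comm (i j : Fin 4) (f : DiffPoly) : deriv i (deriv j f) = deriv j (deriv i f) := by
  have : ⁅deriv i, deriv j⁆ = 0 := by
    refine MvPolynomial.derivation_ext fun x => ?_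
    rw [Derivation.commutator_apply, deriv_X, deriv_X, deriv_X, deriv_X, add_right_comm, sub_self]
    rfl
  have h := DFunLike.congr_fun this f
  rw [Derivation.commutator_apply] at h
  exact sub_eq_zero.1 h

/-- The iterated derivative `∂ᵢⁿ` as a linear map. -/
def derivPow (i : Fin 4) (n : ℕ) : DiffPoly →ₗ[CoeffField] DiffPoly :=
  (deriv i : DiffPoly →ₗ[CoeffField] DiffPoly) ^ n

theorem derivPow_zero (i : Fin 4) (f : DiffPoly) : derivPow i 0 f = f := by
  simp [derivPow]

theorem derivPow_succ (i : Fin 4) (n : ℕ) (f : DiffPoly) :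
    derivPow i (n + 1) f = deriv i (derivPow i n f) := by
  rw [derivPow, pow_succ', Module.End.mul_apply]
  rfl

theorem derivPow_one (i : Fin 4) (f : DiffPoly) : derivPow i 1 f = deriv i f := by
  simp [derivPow]

theorem derivPow_two (i : Fin 4) (f : DiffPoly) : derivPow i 2 f = deriv i (deriv i f) := by
  rw [derivPow_succ, derivPow_one]

theorem derivPow_C (i : Fin 4) {n : ℕ} (hn : n ≠ 0) (a : CoeffField) : derivPow i n (C a) = 0 := by
  obtain ⟨n, rfl⟩ := Nat.exists_eq_succ_of_ne_zero hn
  induction n with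
  | zero => rw [Nat.succ_eq_add_one, zero_add, derivPow_one, deriv_C]
  | succ n ih => rw [Nat.succ_eq_add_one, derivPow_succ, ih (Nat.succ_ne_zero n), map_zero]

theorem derivPow_X (i : Fin 4) (n : ℕ) (x : Var) :
    derivPow i n (X x) = X (x.1, x.2 + Pi.single i n) := by
  induction n with
  | zero => simp [derivPow_zero]
  | succ n ih => rw [derivPow_succ, ih, deriv_X, add_assoc, ← Pi.single_add]

theorem derivPow_mul (i : Fin 4) (n : ℕ) (f g : DiffPoly) :
    derivPow i n (f * g) = ∑ q ∈ Finset.HasAntidiagonal.antidiagonal n,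
      n.choose q.1 • (derivPow i q.1 f * derivPow i q.2 g) := by
  induction n with
  | zero => simp [derivPow_zero]
  | succ n ih =>
    rw [derivPow_succ, ih, Finset.sum_antidiagonal_choose_succ_nsmul
      (fun a b => derivPow i a f * derivPow i b g), map_sum, ← Finset.sum_add_distrib]
    refine Finset.sum_congr rfl fun q hq => ?_
    have : n.choose q.2 = n.choose q.1 :=
      (Nat.choose_symm_of_eq_add (Finset.HasAntidiagonal.mem_antidiagonal.1 hq).symm).symm
    rw [map_nsmul, (deriv i).leibniz, derivPow_succ, derivPow_succ, this, smul_eq_mul,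
      smul_eq_mul, smul_add, mul_comm (derivPow i q.2 g)]

theorem derivPow_deriv (i j : Fin 4) (n : ℕ) (f : DiffPoly) :
    derivPow i n (deriv j f) = deriv j (derivPow i n f) := by
  induction n with
  | zero => simp [derivPow_zero]
  | succ n ih => rw [derivPow_succ, ih, deriv_comm, ← derivPow_succ]

end Derivatives

/-! ### Formal Taylor shifts in the grid spacings -/

section Jets

open MvPowerSeries (coeff constantCoeff)

/-- The coefficient `εⁿ / n!` of the Taylor expansion. -/
def taylorCoeff (ε : ℤ) (n : ℕ) : CoeffField := (ε : CoeffField) ^ n / (n.factorial : CoeffField)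

theorem taylorCoeff_zero (ε : ℤ) : taylorCoeff ε 0 = 1 := by simp [taylorCoeff]

/-- This is the binomial theorem divided by `n!`, the addition law of the exponential series. -/
theorem taylorCoeff_add (a b : ℤ) (n : ℕ) : taylorCoeff (a + b) n
    = ∑ m ∈ Finset.range (n + 1), taylorCoeff a m * taylorCoeff b (n - m) := by
  rw [taylorCoeff, Int.cast_add, add_pow, Finset.sum_div]
  refine Finset.sum_congr rfl fun m hm => ?_
  have hm' : m ≤ n := Nat.lt_succ_iff.1 (Finset.mem_range.1 hm)
  have h := Nat.choose_mul_factorial_mul_factorial hm'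
  have h1 : (m.factorial : CoeffField) ≠ 0 := Nat.cast_ne_zero.2 m.factorial_ne_zero
  have h2 : ((n - m).factorial : CoeffField) ≠ 0 := Nat.cast_ne_zero.2 (n - m).factorial_ne_zero
  have h3 : (n.factorial : CoeffField) ≠ 0 := Nat.cast_ne_zero.2 n.factorial_ne_zero
  rw [taylorCoeff, taylorCoeff, div_mul_div_comm, div_eq_div_iff h3 (mul_ne_zero h1 h2), ← h]
  push_cast
  ring

/-- The formal Taylor expansion of the shift by `ε hᵢ` in direction `i`, on functions. -/
def jetFun (i : Fin 4) (ε : ℤ) (f : DiffPoly) : MvPowerSeries (Fin 4) DiffPoly :=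
  fun n => if n = Finsupp.single i (n i) then taylorCoeff ε (n i) • derivPow i (n i) f else 0

theorem coeff_jetFun_single (i : Fin 4) (ε : ℤ) (f : DiffPoly) (m : ℕ) :
    coeff (Finsupp.single i m) (jetFun i ε f) = taylorCoeff ε m • derivPow i m f := by
  rw [MvPowerSeries.coeff_apply, jetFun, Finsupp.single_eq_same, if_pos rfl]

theorem coeff_jetFun_of_ne {i : Fin 4} {n : Fin 4 →₀ ℕ} (hn : ∀ m, n ≠ Finsupp.single i m)
    (ε : ℤ) (f : DiffPoly) : coeff n (jetFun i ε f) = 0 := by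
  rw [MvPowerSeries.coeff_apply, jetFun, if_neg (hn _)]

theorem jetFun_C (i : Fin 4) (ε : ℤ) (a : CoeffField) :
    jetFun i ε (C a) = MvPowerSeries.C (C a) := by
  ext1 n
  rw [MvPowerSeries.coeff_C]
  by_cases hn : ∃ m, n = Finsupp.single i m
  · obtain ⟨m, rfl⟩ := hn
    rw [coeff_jetFun_single]
    rcases eq_or_ne m 0 with rfl | hm
    · simp [taylorCoeff_zero, derivPow_zero]
    · rw [derivPow_C i hm, smul_zero, if_neg]
      simpa using hm
  · push Not at hn
    rw [coeff_jetFun_of_ne hn, if_neg]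
    rintro rfl
    exact hn 0 (by simp)

/-- The formal shift is the exponential of `ε hᵢ ∂ᵢ`, and the exponential of a derivation is
multiplicative: coefficientwise this is the general Leibniz rule divided by factorials. -/
theorem jetFun_mul (i : Fin 4) (ε : ℤ) (f g : DiffPoly) :
    jetFun i ε (f * g) = jetFun i ε f * jetFun i ε g := by
  ext1 n
  rw [MvPowerSeries.coeff_mul]
  by_cases hn : ∃ m, n = Finsupp.single i m
  · obtain ⟨m, rfl⟩ := hn
    rw [coeff_jetFun_single, Finsupp.antidiagonal_single, Finset.sum_map, derivPow_mul,
      Finset.smul_sum]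
    refine Finset.sum_congr rfl fun q hq => ?_
    rw [Finset.HasAntidiagonal.mem_antidiagonal] at hq
    change _ = coeff (Finsupp.single i q.1) (jetFun i ε f)
      * coeff (Finsupp.single i q.2) (jetFun i ε g)
    rw [coeff_jetFun_single, coeff_jetFun_single, smul_mul_smul_comm,
      ← Nat.cast_smul_eq_nsmul CoeffField, smul_smul]
    congr 1
    have h1 : (q.1.factorial : CoeffField) ≠ 0 := Nat.cast_ne_zero.2 q.1.factorial_ne_zero
    have h2 : (q.2.factorial : CoeffField) ≠ 0 := Nat.cast_ne_zero.2 q.2.factorial_ne_zero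
    have h3 : (m.factorial : CoeffField) ≠ 0 := Nat.cast_ne_zero.2 m.factorial_ne_zero
    have h : (m.choose q.1 * q.1.factorial * q.2.factorial : CoeffField) = m.factorial := by
      have := Nat.choose_mul_factorial_mul_factorial (show q.1 ≤ m by omega)
      rw [show m - q.1 = q.2 by omega] at this
      exact_mod_cast this
    rw [taylorCoeff, taylorCoeff, taylorCoeff, div_mul_div_comm, ← pow_add, hq, div_mul_eq_mul_div,
      div_eq_div_iff h3 (mul_ne_zero h1 h2), ← h]
    ring
  · push Not at hn
    rw [coeff_jetFun_of_ne hn]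
    -- If the total exponent involves other directions than `i`, then so does one of its two
    -- summands.
    refine (Finset.sum_eq_zero fun q hq => ?_).symm
    rw [Finset.HasAntidiagonal.mem_antidiagonal] at hq
    by_cases h1 : ∃ a, q.1 = Finsupp.single i a
    · obtain ⟨a, ha⟩ := h1
      rw [coeff_jetFun_of_ne (n := q.2), mul_zero]
      intro b hb
      exact hn (a + b) (by rw [← hq, ha, hb, Finsupp.single_add])
    · push Not at h1
      rw [coeff_jetFun_of_ne h1, zero_mul]

/-- The formal Taylor expansion of the shift by `ε hᵢ` in direction `i`, as a homomorphism. -/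
def jet (i : Fin 4) (ε : ℤ) : DiffPoly →+* MvPowerSeries (Fin 4) DiffPoly where
  toFun := jetFun i ε
  map_zero' := by simpa using jetFun_C i ε 0
  map_one' := by simpa using jetFun_C i ε 1
  map_mul' := jetFun_mul i ε
  map_add' f g := by
    ext1 n
    rw [map_add]
    by_cases hn : ∃ m, n = Finsupp.single i m
    · obtain ⟨m, rfl⟩ := hn
      simp only [coeff_jetFun_single, map_add, smul_add]
    · push Not at hn
      simp only [coeff_jetFun_of_ne hn, add_zero]

/-- The shift by `ε hᵢ` in direction `i`, on formal power series in the grid spacings. -/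
def formalShift (i : Fin 4) (ε : ℤ) :
    MvPowerSeries (Fin 4) DiffPoly →+* MvPowerSeries (Fin 4) DiffPoly := extend (jet i ε)

/-- Only pure powers of `hᵢ` occur in `jet`, so the sum over all splittings of `n` collapses to one
direction. -/
theorem coeff_formalShift (i : Fin 4) (ε : ℤ) (g : MvPowerSeries (Fin 4) DiffPoly)
    (n : Fin 4 →₀ ℕ) : coeff n (formalShift i ε g) = ∑ m ∈ Finset.range (n i + 1),
      taylorCoeff ε m • derivPow i m (coeff (n - Finsupp.single i m) g) := by
  rw [formalShift, coeff_extend]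
  symm
  refine Finset.sum_of_injOn (fun m => (n - Finsupp.single i m, Finsupp.single i m)) ?_ ?_ ?_ ?_
  · intro a _ b _ h
    exact Finsupp.single_injective i (Prod.ext_iff.1 h).2
  · intro m hm
    have : Finsupp.single i m ≤ n := by
      rw [Finsupp.single_le_iff]
      exact Nat.lt_succ_iff.1 (Finset.mem_range.1 hm)
    simpa using tsub_add_cancel_of_le this
  · rintro ⟨p, q⟩ hpq hnot
    refine coeff_jetFun_of_ne (fun m hm => hnot ⟨m, ?_⟩) ε _
    rw [Finset.HasAntidiagonal.mem_antidiagonal] at hpq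
    dsimp only at hpq hm
    subst hm
    refine ⟨?_, Prod.ext ?_ rfl⟩
    · rw [← hpq]
      simp
    · simp [← hpq]
  · intro m _
    exact (coeff_jetFun_single i ε _ m).symm

theorem coeff_formalShift_zero {i : Fin 4} {n : Fin 4 →₀ ℕ} (hn : n i = 0) (ε : ℤ)
    (g : MvPowerSeries (Fin 4) DiffPoly) : coeff n (formalShift i ε g) = coeff n g := by
  simp [coeff_formalShift, hn, taylorCoeff_zero, derivPow_zero]

theorem formalShift_of_forall_mem_range_C {g : MvPowerSeries (Fin 4) DiffPoly}
    (hg : ∀ n, ∃ a, coeff n g = C a) (i : Fin 4) (ε : ℤ) : formalShift i ε g = g := by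
  ext1 n
  rw [coeff_formalShift, Finset.sum_eq_single 0]
  · simp [taylorCoeff_zero, derivPow_zero]
  · intro m _ hm
    obtain ⟨a, ha⟩ := hg (n - Finsupp.single i m)
    rw [ha, derivPow_C i hm, smul_zero]
  · simp

end Jets

/-! ### Taylor expansion of difference polynomials -/

section Taylor

/-- Shift by `s` of difference polynomials with polynomial coefficients. -/
def polyShift (s : Fin 4 → ℤ) : MvPolynomial (Fin 4 × (Fin 4 → ℤ)) StepPoly →ₐ[StepPoly]
    MvPolynomial (Fin 4 × (Fin 4 → ℤ)) StepPoly :=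
  rename fun x => (x.1, x.2 + s)

theorem map_polyShift (s : Fin 4 → ℤ) (P : MvPolynomial (Fin 4 × (Fin 4 → ℤ)) StepPoly) :
    MvPolynomial.map (algebraMap StepPoly StepField) (polyShift s P)
      = shift s (MvPolynomial.map (algebraMap StepPoly StepField) P) :=
  map_rename ..

theorem taylor_C (a : StepPoly) :
    taylor (C a) = (MvPolynomial.map C a : MvPolynomial (Fin 4) DiffPoly) := by
  simp [taylor]

theorem taylor_X (x : Fin 4 × (Fin 4 → ℤ)) : taylor (X x) = taylorVar x := by
  simp [taylor]

theorem taylor_C_monomial (m : Fin 4 →₀ ℕ) (a : CoeffField) :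
    taylor (C (monomial m a)) = MvPowerSeries.monomial m (C a) := by
  rw [taylor_C, map_monomial, coe_monomial]

theorem coeff_taylorVar (x : Fin 4 × (Fin 4 → ℤ)) (n : Fin 4 →₀ ℕ) :
    MvPowerSeries.coeff n (taylorVar x) = (∏ i, taylorCoeff (x.2 i) (n i)) • X (x.1, ⇑n) := rfl

/-- Successive formal shifts in one direction add their displacements, by the addition law
`taylorCoeff_add`; the other directions are unaffected. -/
theorem formalShift_taylorVar (i : Fin 4) (ε : ℤ) (x : Fin 4 × (Fin 4 → ℤ)) :
    formalShift i ε (taylorVar x) = taylorVar (x.1, x.2 + Pi.single i ε) := by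
  ext1 n
  rw [coeff_formalShift, coeff_taylorVar, ← Finset.mul_prod_erase _ _ (Finset.mem_univ i)]
  dsimp only
  rw [Pi.add_apply, Pi.single_eq_same, add_comm (x.2 i), taylorCoeff_add, Finset.sum_mul,
    Finset.sum_smul]
  refine Finset.sum_congr rfl fun m hm => ?_
  have hle : Finsupp.single i m ≤ n := by
    rw [Finsupp.single_le_iff]
    exact Nat.lt_succ_iff.1 (Finset.mem_range.1 hm)
  rw [coeff_taylorVar, map_smul, derivPow_X, smul_smul,
    ← Finset.mul_prod_erase _ _ (Finset.mem_univ i), mul_assoc]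
  have h1 : ⇑(n - Finsupp.single i m) + Pi.single i m = ⇑n := by
    rw [← Finsupp.single_eq_pi_single, ← Finsupp.coe_add, tsub_add_cancel_of_le hle]
  have h2 : ∏ j ∈ Finset.univ.erase i, taylorCoeff (x.2 j) ((n - Finsupp.single i m) j)
      = ∏ j ∈ Finset.univ.erase i,
        taylorCoeff ((x.2 + Pi.single i ε : Fin 4 → ℤ) j) (n j) := by
    refine Finset.prod_congr rfl fun j hj => ?_
    have hj' : j ≠ i := Finset.ne_of_mem_erase hj
    simp [hj']
  rw [h1, h2, Finsupp.tsub_apply, Finsupp.single_eq_same]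

theorem taylor_polyShift (i : Fin 4) (ε : ℤ) (P : MvPolynomial (Fin 4 × (Fin 4 → ℤ)) StepPoly) :
    taylor (polyShift (Pi.single i ε) P) = formalShift i ε (taylor P) := by
  have : taylor.comp (polyShift (Pi.single i ε)).toRingHom = (formalShift i ε).comp taylor := by
    refine MvPolynomial.ringHom_ext (fun a => ?_) fun x => ?_
    · have h : polyShift (Pi.single i ε) (C a) = C a := (polyShift _).commutes a
      change taylor (polyShift (Pi.single i ε) (C a)) = formalShift i ε (taylor (C a))
      rw [h, formalShift_of_forall_mem_range_C]
      intro n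
      exact ⟨a.coeff n, by rw [taylor_C, coeff_coe, coeff_map]⟩
    · change taylor (polyShift (Pi.single i ε) (X x)) = formalShift i ε (taylor (X x))
      rw [polyShift, rename_X, taylor_X, taylor_X, formalShift_taylorVar]
  exact RingHom.congr_fun this P

end Taylor

/-! ### Expansions with denominators and approximation of differential polynomials -/

section Representation

open MvPowerSeries (coeff constantCoeff)

/-- The monomial `hᵐ` clears the denominators of `f`, and the Taylor expansion of `f` is `g`. -/
def HasExpansion (m : Fin 4 →₀ ℕ) (f : ShiftPoly ℤ) (g : MvPowerSeries (Fin 4) DiffPoly) : Prop :=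
  ∃ P : MvPolynomial (Fin 4 × (Fin 4 → ℤ)) StepPoly,
    MvPolynomial.map (algebraMap StepPoly StepField) P
      = C (algebraMap StepPoly StepField (monomial m 1)) * f ∧
    taylor P = MvPowerSeries.monomial m 1 * g

/-- A constant as an element of the coefficient field of the difference polynomials. -/
def constStep (a : CoeffField) : StepField := algebraMap StepPoly StepField (C a)

variable {m m' : Fin 4 →₀ ℕ} {f f' : ShiftPoly ℤ} {g g' : MvPowerSeries (Fin 4) DiffPoly}

theorem hasExpansion_X (x : Fin 4 × (Fin 4 → ℤ)) : HasExpansion 0 (X x) (taylorVar x) := by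
  refine ⟨X x, ?_, ?_⟩
  · simp
  · rw [taylor_X, MvPowerSeries.monomial_zero_one, one_mul]

theorem HasExpansion.mono (h : HasExpansion m f g) (k : Fin 4 →₀ ℕ) :
    HasExpansion (m + k) f g := by
  obtain ⟨P, hP, ht⟩ := h
  refine ⟨C (monomial k 1) * P, ?_, ?_⟩
  · rw [map_mul, map_C, hP, ← mul_assoc, ← C_mul, ← map_mul, monomial_mul, one_mul, add_comm]
  · rw [map_mul, taylor_C_monomial, ht, ← mul_assoc, C_1, MvPowerSeries.monomial_mul_monomial,
      one_mul, add_comm]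

theorem HasExpansion.add (h : HasExpansion m f g) (h' : HasExpansion m f' g') :
    HasExpansion m (f + f') (g + g') := by
  obtain ⟨P, hP, ht⟩ := h
  obtain ⟨P', hP', ht'⟩ := h'
  exact ⟨P + P', by rw [map_add, hP, hP', mul_add], by rw [map_add, ht, ht', mul_add]⟩

theorem HasExpansion.sub (h : HasExpansion m f g) (h' : HasExpansion m f' g') :
    HasExpansion m (f - f') (g - g') := by
  obtain ⟨P, hP, ht⟩ := h
  obtain ⟨P', hP', ht'⟩ := h'
  exact ⟨P - P', by rw [map_sub, hP, hP', mul_sub], by rw [map_sub, ht, ht', mul_sub]⟩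

theorem HasExpansion.mul (h : HasExpansion m f g) (h' : HasExpansion m' f' g') :
    HasExpansion (m + m') (f * f') (g * g') := by
  obtain ⟨P, hP, ht⟩ := h
  obtain ⟨P', hP', ht'⟩ := h'
  refine ⟨P * P', ?_, ?_⟩
  · rw [map_mul, hP, hP', mul_mul_mul_comm, ← C_mul, ← map_mul, monomial_mul, one_mul]
  · rw [map_mul, ht, ht', mul_mul_mul_comm, MvPowerSeries.monomial_mul_monomial, one_mul]

theorem HasExpansion.smul (h : HasExpansion m f g) (a : CoeffField) :
    HasExpansion m (constStep a • f) (MvPowerSeries.C (C a) * g) := by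
  obtain ⟨P, hP, ht⟩ := h
  refine ⟨C (C a) * P, ?_, ?_⟩
  · rw [map_mul, map_C, hP, smul_eq_C_mul, constStep, mul_left_comm]
  · rw [map_mul, ht, taylor_C, MvPolynomial.map_C, coe_C, mul_left_comm]

theorem HasExpansion.shift (h : HasExpansion m f g) (i : Fin 4) (ε : ℤ) :
    HasExpansion m (shift (Pi.single i ε) f) (formalShift i ε g) := by
  obtain ⟨P, hP, ht⟩ := h
  refine ⟨polyShift (Pi.single i ε) P, ?_, ?_⟩
  · rw [map_polyShift, hP, map_mul]
    congr 1
    exact (NavierStokes.shift _).commutes _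
  · rw [taylor_polyShift, ht, map_mul, formalShift_of_forall_mem_range_C]
    intro n
    rw [MvPowerSeries.coeff_monomial]
    split_ifs
    · exact ⟨1, C_1.symm⟩
    · exact ⟨0, C_0.symm⟩

/-- If the expansion is divisible by `hᵏ`, the same cleared polynomial serves for the quotient, with
`hᵏ` moved into the clearing monomial. -/
theorem HasExpansion.div {k : Fin 4 →₀ ℕ}
    (h : HasExpansion m f (MvPowerSeries.monomial k 1 * g)) :
    HasExpansion (m + k) ((algebraMap StepPoly StepField (monomial k 1))⁻¹ • f) g := by
  obtain ⟨P, hP, ht⟩ := h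
  have hk : algebraMap StepPoly StepField (monomial k 1) ≠ 0 := by
    rw [Ne, FaithfulSMul.algebraMap_eq_zero_iff, monomial_eq_zero]
    exact one_ne_zero
  refine ⟨P, ?_, ?_⟩
  · have hmk : algebraMap StepPoly StepField (monomial m 1)
        = algebraMap StepPoly StepField (monomial (m + k) 1)
          * (algebraMap StepPoly StepField (monomial k 1))⁻¹ := by
      rw [eq_mul_inv_iff_mul_eq₀ hk, ← map_mul, monomial_mul, one_mul]
    rw [hP, ← C_mul', ← mul_assoc, ← C_mul, ← hmk]
  · rw [ht, ← mul_assoc, MvPowerSeries.monomial_mul_monomial, one_mul]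

theorem algebraMap_monomial_single (i : Fin 4) (n : ℕ) :
    algebraMap StepPoly StepField (monomial (Finsupp.single i n) 1) = step i ^ n := by
  rw [step, ← map_pow, X_pow_eq_monomial]

theorem exists_eq_monomial_mul (i : Fin 4) (k : ℕ) (φ : MvPowerSeries (Fin 4) DiffPoly)
    (h : ∀ n : Fin 4 →₀ ℕ, n i < k → coeff n φ = 0) :
    ∃ ψ : MvPowerSeries (Fin 4) DiffPoly, φ = MvPowerSeries.monomial (Finsupp.single i k) 1 * ψ ∧
      constantCoeff ψ = coeff (Finsupp.single i k) φ := by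
  obtain ⟨ψ, rfl⟩ := MvPowerSeries.X_pow_dvd_iff.2 h
  refine ⟨ψ, by rw [MvPowerSeries.X_pow_eq], ?_⟩
  have := MvPowerSeries.coeff_add_monomial_mul (Finsupp.single i k) 0 ψ (1 : DiffPoly)
  rw [add_zero, one_mul] at this
  rw [MvPowerSeries.X_pow_eq, this]
  rfl

/-- The difference polynomial `f` approximates the differential polynomial `r`. -/
def Approximates (f : ShiftPoly ℤ) (r : DiffPoly) : Prop :=
  ∃ m g, HasExpansion m f g ∧ constantCoeff g = r

variable {r r' : DiffPoly}

theorem approximates_X (α : Fin 4) : Approximates (X (α, 0)) (dvar α) := by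
  refine ⟨_, _, hasExpansion_X _, ?_⟩
  have := coeff_taylorVar (α, 0) 0
  simpa [taylorCoeff_zero, dvar] using this

theorem Approximates.add (h : Approximates f r) (h' : Approximates f' r') :
    Approximates (f + f') (r + r') := by
  obtain ⟨m, g, h, rfl⟩ := h
  obtain ⟨m', g', h', rfl⟩ := h'
  have h' := h'.mono m
  rw [add_comm] at h'
  exact ⟨_, _, (h.mono m').add h', map_add _ _ _⟩

theorem Approximates.sub (h : Approximates f r) (h' : Approximates f' r') :
    Approximates (f - f') (r - r') := by
  obtain ⟨m, g, h, rfl⟩ := h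
  obtain ⟨m', g', h', rfl⟩ := h'
  have h' := h'.mono m
  rw [add_comm] at h'
  exact ⟨_, _, (h.mono m').sub h', map_sub _ _ _⟩

theorem Approximates.mul (h : Approximates f r) (h' : Approximates f' r') :
    Approximates (f * f') (r * r') := by
  obtain ⟨m, g, h, rfl⟩ := h
  obtain ⟨m', g', h', rfl⟩ := h'
  exact ⟨_, _, h.mul h', map_mul _ _ _⟩

theorem Approximates.smul (h : Approximates f r) (a : CoeffField) :
    Approximates (constStep a • f) (a • r) := by
  obtain ⟨m, g, h, rfl⟩ := h
  refine ⟨_, _, h.smul a, ?_⟩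
  rw [map_mul, MvPowerSeries.constantCoeff_C, smul_eq_C_mul]

theorem Approximates.sum {f : Fin 3 → ShiftPoly ℤ} {r : Fin 3 → DiffPoly}
    (h : ∀ i, Approximates (f i) (r i)) : Approximates (∑ i, f i) (∑ i, r i) := by
  rw [Fin.sum_univ_three, Fin.sum_univ_three]
  exact ((h 0).add (h 1)).add (h 2)

/-- The terms of the expansion without `τ` are unchanged by the shift, so they cancel and the
difference is divisible by `τ`; the quotient starts with the first Taylor term. -/
theorem Approximates.dt (h : Approximates f r) : Approximates (Dt f) (deriv 0 r) := by
  obtain ⟨m, g, h, rfl⟩ := h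
  obtain ⟨ψ, hψ, hψ0⟩ := exists_eq_monomial_mul 0 1 (formalShift 0 1 g - g) fun n hn => by
    rw [map_sub, coeff_formalShift_zero (Nat.lt_one_iff.1 hn), sub_self]
  have h1 := (h.shift 0 1).sub h
  rw [hψ] at h1
  have h2 := h1.div
  rw [algebraMap_monomial_single, pow_one] at h2
  refine ⟨_, _, h2, ?_⟩
  · rw [hψ0, map_sub, coeff_formalShift, Finsupp.single_eq_same, Finset.sum_range_succ,
      Finset.sum_range_one]
    simp [taylorCoeff, derivPow_zero, derivPow_one]

theorem Approximates.dx (h : Approximates f r) (i : Fin 3) :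
    Approximates (Dx i f) (deriv i.succ r) := by
  obtain ⟨m, g, h, rfl⟩ := h
  obtain ⟨ψ, hψ, hψ0⟩ := exists_eq_monomial_mul i.succ 1
    (formalShift i.succ 1 g - formalShift i.succ (-1) g) fun n hn => by
      rw [map_sub, coeff_formalShift_zero (Nat.lt_one_iff.1 hn),
        coeff_formalShift_zero (Nat.lt_one_iff.1 hn), sub_self]
  have h0 := (h.shift i.succ 1).sub (h.shift i.succ (-1))
  rw [hψ] at h0
  -- The two first-order Taylor terms add up to twice the derivative, which is why the central
  -- difference carries the factor `1/2`.
  have h1 := h0.div.smul 2⁻¹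
  have h2 : constStep 2⁻¹ = 2⁻¹ := by
    have h := map_inv₀ ((algebraMap StepPoly StepField).comp C) (2 : CoeffField)
    rwa [map_ofNat] at h
  rw [algebraMap_monomial_single, pow_one, h2, smul_smul, ← mul_inv] at h1
  refine ⟨_, _, h1, ?_⟩
  rw [map_mul, MvPowerSeries.constantCoeff_C, hψ0, map_sub, coeff_formalShift, coeff_formalShift,
    Finsupp.single_eq_same, Finset.sum_range_succ, Finset.sum_range_one, Finset.sum_range_succ,
    Finset.sum_range_one, ← smul_eq_C_mul]
  simp only [taylorCoeff, derivPow_zero, derivPow_one, tsub_self, tsub_zero, Finsupp.single_zero,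
    MvPowerSeries.coeff_zero_eq_constantCoeff_apply, pow_one, pow_zero,
    Nat.factorial_zero, Nat.factorial_one, Nat.cast_one, Int.cast_one, Int.cast_neg, div_one]
  rw [add_sub_add_left_eq_sub, ← sub_smul, smul_smul]
  norm_num

theorem Approximates.discreteLaplace (h : Approximates f r) :
    Approximates (discreteLaplace f) (laplace r) := by
  refine Approximates.sum fun j => ?_
  obtain ⟨m, g, h, rfl⟩ := h
  obtain ⟨ψ, hψ, hψ0⟩ := exists_eq_monomial_mul j.succ 2
    (formalShift j.succ 1 g - (g + g) + formalShift j.succ (-1) g) fun n hn => by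
      -- Orders `0` and `1` in `hⱼ` cancel in the symmetric second difference, so it is divisible by
      -- `hⱼ²`; the two halves of second order make up the second derivative.
      have hcases : n j.succ = 0 ∨ n j.succ = 1 := by omega
      rw [map_add, map_sub, map_add]
      rcases hcases with hn | hn
      · rw [coeff_formalShift_zero hn, coeff_formalShift_zero hn]
        abel
      · rw [coeff_formalShift, coeff_formalShift, hn, Finset.sum_range_succ,
          Finset.sum_range_one, Finset.sum_range_succ, Finset.sum_range_one]
        simp only [taylorCoeff, derivPow_zero, derivPow_one, tsub_zero, Finsupp.single_zero,
          pow_one, pow_zero, Nat.factorial_zero, Nat.factorial_one, Nat.cast_one, Int.cast_one,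
          Int.cast_neg, div_one, one_smul, neg_smul]
        abel
  have h0 := ((h.shift j.succ 1).sub (h.add h)).add (h.shift j.succ (-1))
  rw [hψ] at h0
  have h1 := h0.div
  rw [algebraMap_monomial_single, ← two_mul] at h1
  refine ⟨_, _, h1, ?_⟩
  rw [hψ0, map_add, map_sub, map_add, coeff_formalShift, coeff_formalShift,
    Finsupp.single_eq_same, Finset.sum_range_succ, Finset.sum_range_succ, Finset.sum_range_one,
    Finset.sum_range_succ, Finset.sum_range_succ, Finset.sum_range_one, ← derivPow_two]
  simp only [taylorCoeff, derivPow_zero, derivPow_one, tsub_self, tsub_zero, Finsupp.single_zero,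
    MvPowerSeries.coeff_zero_eq_constantCoeff_apply, pow_one, pow_zero, one_pow,
    Nat.factorial_zero, Nat.factorial_one, Nat.cast_one, Int.cast_one, Int.cast_neg, div_one,
    one_smul, neg_smul, neg_one_sq, Nat.factorial_two, Nat.cast_ofNat]
  have h2 : ((1 : CoeffField) / 2) • derivPow j.succ 2 (constantCoeff g)
      + ((1 : CoeffField) / 2) • derivPow j.succ 2 (constantCoeff g)
      = derivPow j.succ 2 (constantCoeff g) := by
    rw [← add_smul]
    norm_num
  linear_combination (exp := 1) h2

theorem Approximates.implies (h : Approximates f r) (hr : r ≠ 0) : Implies f {r} := by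
  obtain ⟨m, g, h, rfl⟩ := h
  -- An extra factor `τ` in the multiplier makes the lowest degree positive, as the definition of
  -- `Implies` requires, even when no denominator has to be cleared.
  obtain ⟨P, hP, ht⟩ := h.mono (Finsupp.single 0 1)
  set m' := m + Finsupp.single 0 1
  refine ⟨monomial m' 1, by simp, P, hP, m'.degree, ?_, 1, one_pos, fun _ => m',
    fun _ => constantCoeff g, Function.injective_of_subsingleton _, fun _ => rfl, fun _ => hr,
    by simp, fun n hn => ?_⟩
  · simp [m', map_add]
  · rw [ht, MvPowerSeries.coeff_monomial_mul, Fin.sum_univ_one, one_mul]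
    by_cases hle : m' ≤ n
    · obtain ⟨k, rfl⟩ := exists_add_of_le hle
      have hk : k = 0 := by
        rw [← Finsupp.degree_eq_zero_iff]
        rw [map_add] at hn
        omega
      simp [hk]
    · rw [if_neg hle, if_neg]
      rintro h
      exact hle h.le

end Representation

/-! ### The differential equations approximated by the discrete ones -/

section System

theorem approximates_gridVel (i : Fin 3) : Approximates (gridVel i) (vel i) := approximates_X i.succ

theorem approximates_gridPres : Approximates gridPres pres := approximates_X 0

theorem approximates_discreteContinuity : Approximates discreteContinuity continuityEq :=
  Approximates.sum fun i => (approximates_gridVel i).dx i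

theorem approximates_discreteMomentum (i : Fin 3) :
    Approximates (discreteMomentum i) (momentumEq i) :=
  (((approximates_gridVel i).dt.add (Approximates.sum fun j =>
    ((approximates_gridVel i).mul (approximates_gridVel j)).dx j)).add
    (approximates_gridPres.dx i)).sub ((approximates_gridVel i).discreteLaplace.smul _)

/-- The pressure Poisson equation without its linear velocity terms. -/
theorem poissonEq_eq : poissonEq = ∑ i : Fin 3, deriv i.succ (deriv i.succ pres)
    + ∑ i : Fin 3, ∑ j : Fin 3, deriv i.succ (deriv j.succ (vel i * vel j)) := by
  have h (i j : Fin 3) : deriv i.succ (laplace (vel j)) = laplace (deriv i.succ (vel j)) := by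
    simp only [laplace, map_sum, deriv_comm i.succ]
  have h' : laplace continuityEq = ∑ i : Fin 3, deriv i.succ (laplace (vel i)) := by
    simp only [h]
    simp only [laplace, continuityEq, map_sum]
    exact Finset.sum_comm
  have h'' : deriv 0 continuityEq = ∑ i : Fin 3, deriv i.succ (deriv 0 (vel i)) := by
    simp only [continuityEq, map_sum, deriv_comm 0]
  rw [poissonEq, h', h'']
  simp only [momentumEq, map_add, map_sub, map_sum, Derivation.map_smul, Finset.sum_add_distrib,
    Finset.sum_sub_distrib, ← Finset.smul_sum]
  abel

/-- In the differential Poisson equation the viscous terms cancel against the Laplacian of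
continuity. The discrete one keeps them, and their limit is the Laplacian of continuity divided by
the Reynolds number. -/
theorem approximates_discretePoisson : Approximates discretePoisson
    (poissonEq - reynolds⁻¹ • laplace continuityEq) := by
  have h : poissonEq - reynolds⁻¹ • laplace continuityEq
      = ∑ i : Fin 3, deriv i.succ (deriv i.succ pres)
        + ∑ i : Fin 3, deriv i.succ (deriv i.succ (vel i * vel i))
        + ((deriv 1 (deriv 2 (vel 0 * vel 1)) + deriv 1 (deriv 3 (vel 0 * vel 2))
            + deriv 2 (deriv 3 (vel 1 * vel 2)))
          + (deriv 1 (deriv 2 (vel 0 * vel 1)) + deriv 1 (deriv 3 (vel 0 * vel 2))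
            + deriv 2 (deriv 3 (vel 1 * vel 2))))
        - reynolds⁻¹ • ∑ i : Fin 3, deriv i.succ (laplace (vel i)) := by
    have h (i j : Fin 3) : deriv i.succ (laplace (vel j)) = laplace (deriv i.succ (vel j)) := by
      simp only [laplace, map_sum, deriv_comm i.succ]
    have h' : laplace continuityEq = ∑ i : Fin 3, deriv i.succ (laplace (vel i)) := by
      simp only [h]
      simp only [laplace, continuityEq, map_sum]
      exact Finset.sum_comm
    rw [poissonEq_eq, h']
    simp only [Fin.sum_univ_three, Fin.succ_zero_eq_one, Fin.succ_one_eq_two,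
      show (2 : Fin 3).succ = 3 from rfl, deriv_comm 2 1, deriv_comm 3 1, deriv_comm 3 2,
      mul_comm (vel 1) (vel 0), mul_comm (vel 2) (vel 0), mul_comm (vel 2) (vel 1)]
    abel
  have hv := approximates_gridVel
  have hDD (i j : Fin 3) : Approximates (Dx i (Dx j (gridVel i * gridVel j)))
      (deriv i.succ (deriv j.succ (vel i * vel j))) := (((hv i).mul (hv j)).dx j).dx i
  rw [h, discretePoisson, two_mul]
  simp only [pow_two]
  have h2 := ((hDD 0 1).add (hDD 0 2)).add (hDD 1 2)
  exact (((Approximates.sum fun i => (approximates_gridPres.dx i).dx i).add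
    (Approximates.sum fun i => hDD i i)).add (h2.add h2)).sub
    ((Approximates.sum fun i => (hv i).discreteLaplace.dx i).smul _)

end System

/-! ### Leading terms of the differential system -/

section DifferentialLeading

theorem derivation_mem_supported {s t : Set Var} (hst : s ⊆ t) (i : Fin 4)
    (h : ∀ x ∈ s, (x.1, x.2 + Pi.single i 1) ∈ t) {f : DiffPoly} (hf : f ∈ supported CoeffField s) :
    deriv i f ∈ supported CoeffField t := by
  induction hf using Algebra.adjoin_induction with
  | mem x hx =>
    obtain ⟨y, hy, rfl⟩ := hx
    rw [deriv_X]
    exact X_mem_supported.2 (h y hy)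
  | algebraMap a =>
    rw [algebraMap_eq, deriv_C]
    exact zero_mem _
  | add f g _ _ hf hg =>
    rw [map_add]
    exact add_mem hf hg
  | mul f g hf' hg' hf hg =>
    rw [(deriv i).leibniz, smul_eq_mul, smul_eq_mul]
    exact add_mem (mul_mem (supported_mono hst hf') hg) (mul_mem (supported_mono hst hg') hf)

theorem deriv_mem_within {A : Set (Fin 4)} {k l : Fin 4 → ℕ} {f : DiffPoly} {i : Fin 4}
    (hf : f ∈ within CoeffField A k) (h : toLex (k + Pi.single i 1) ≤ toLex l) :
    deriv i f ∈ within CoeffField A l := by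
  refine derivation_mem_supported (s := {y : Var | y.1 ∈ A ∧ toLex y.2 ≤ toLex k})
    (t := {y : Var | y.1 ∈ A ∧ toLex y.2 ≤ toLex l})
    (fun x hx => ⟨hx.1, hx.2.trans (le_trans ?_ h)⟩) i
    (fun x hx => ⟨hx.1, le_trans ?_ h⟩) hf
  · exact Pi.toLex_monotone le_self_add
  · simpa only [toLex_add] using add_le_add_left hx.2 (toLex (Pi.single i 1))

theorem deriv_mem_lower {x : Var} {f : DiffPoly} (hf : f ∈ lower CoeffField x) (i : Fin 4) :
    deriv i f ∈ lower CoeffField (x.1, x.2 + Pi.single i 1) := by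
  refine derivation_mem_supported (fun y hy => ?_) i (fun y hy => rankLT_add _ hy) hf
  refine rankLT_trans (rankLT_of_lt ?_) (rankLT_add (Pi.single i 1) hy)
  exact lt_add_of_pos_right _ (pos_iff_ne_zero.2 (by simp))

theorem vel_mem_within (i : Fin 3) : vel i ∈ within CoeffField {α | 0 < α} 0 :=
  X_mem_within (Fin.succ_pos i) le_rfl

theorem vel_mem_within_univ (i : Fin 3) : vel i ∈ within CoeffField Set.univ 0 :=
  X_mem_within (Set.mem_univ _) le_rfl

/-- The leading variables of the differential system. -/
def differentialLead : Fin 5 → Var :=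
  ![(1, Pi.single 1 1), (1, Pi.single 0 1), (2, Pi.single 0 1), (3, Pi.single 0 1),
    (0, Pi.single 1 2)]

theorem toLex_single_lt (i : Fin 3) (k : Fin 4 → ℕ) :
    toLex (k + Pi.single i.succ 1) ≤ toLex (k + Pi.single 1 1) := by
  have : toLex (Pi.single i.succ 1 : Fin 4 → ℕ) ≤ toLex (Pi.single 1 1) := by
    fin_cases i
    · exact le_rfl
    · exact (toLex_lt_of 1 (by decide) (by decide)).le
    · exact (toLex_lt_of 1 (by decide) (by decide)).le
  simpa only [toLex_add] using add_le_add_right this (toLex k)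

theorem continuityEq_tail :
    continuityEq - X (1, Pi.single 1 1) ∈ lower CoeffField (1, Pi.single 1 1) := by
  have h : continuityEq - X (1, Pi.single 1 1) = deriv 2 (vel 1) + deriv 3 (vel 2) := by
    have h0 : deriv 1 (vel 0) = X (1, Pi.single 1 1) := by
      rw [vel, dvar, deriv_X, zero_add]
      rfl
    rw [continuityEq, Fin.sum_univ_three, Fin.succ_zero_eq_one, h0, add_assoc, add_sub_cancel_left]
    rfl
  have hle : within CoeffField Set.univ (Pi.single 2 1) ≤ lower CoeffField (1, Pi.single 1 1) :=
    within_le_lower (Or.inl (toLex_lt_of (b := Pi.single 1 1) 1 (by decide) (by decide)))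
  rw [h]
  refine hle (add_mem (deriv_mem_within (vel_mem_within_univ 1) ?_)
    (deriv_mem_within (vel_mem_within_univ 2) ?_))
  · rw [zero_add]
  · exact (toLex_lt_of 2 (by decide) (by decide)).le

theorem momentumEq_tail (i : Fin 3) :
    momentumEq i - X (i.succ, Pi.single 0 1) ∈ lower CoeffField (i.succ, Pi.single 0 1) := by
  have h : momentumEq i - X (i.succ, Pi.single 0 1)
      = ∑ j : Fin 3, deriv j.succ (vel i * vel j) + deriv i.succ pres
        - reynolds⁻¹ • laplace (vel i) := by
    have h0 : deriv 0 (vel i) = X (i.succ, Pi.single 0 1) := by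
      rw [vel, dvar, deriv_X, zero_add]
    rw [momentumEq, h0]
    abel
  have hle : within CoeffField Set.univ (Pi.single 1 2)
      ≤ lower CoeffField (i.succ, Pi.single 0 1) :=
    within_le_lower (Or.inl (toLex_lt_of (b := Pi.single 0 1) 0 (by decide) (by decide)))
  have h1 (j : Fin 3) : toLex (0 + Pi.single j.succ 1) ≤ toLex (Pi.single 1 2 : Fin 4 → ℕ) :=
    (toLex_single_lt j 0).trans (toLex_lt_of 1 (by decide) (by decide)).le
  have hp : pres ∈ within CoeffField Set.univ 0 := X_mem_within (Set.mem_univ _) le_rfl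
  rw [h]
  refine hle (sub_mem (add_mem (sum_mem fun j _ => deriv_mem_within
    (mul_mem (vel_mem_within_univ i) (vel_mem_within_univ j)) (h1 j)) (deriv_mem_within hp (h1 i)))
    (Subalgebra.smul_mem _ (sum_mem fun j _ => deriv_mem_within
      (deriv_mem_within (vel_mem_within_univ i) (toLex_single_lt j 0))
      ((toLex_single_lt j _).trans (le_of_eq (congrArg toLex ?_)))) _))
  rw [zero_add, ← Pi.single_add]

theorem poissonEq_tail :
    poissonEq - X (0, Pi.single 1 2) ∈ lower CoeffField (0, Pi.single 1 2) := by
  have h : poissonEq - X (0, Pi.single 1 2)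
      = deriv 2 (deriv 2 pres) + deriv 3 (deriv 3 pres)
        + ∑ i : Fin 3, ∑ j : Fin 3, deriv i.succ (deriv j.succ (vel i * vel j)) := by
    have h0 : deriv 1 (deriv 1 pres) = X (0, Pi.single 1 2) := by
      rw [pres, dvar, deriv_X, deriv_X, zero_add, ← Pi.single_add]
    rw [poissonEq_eq, Fin.sum_univ_three (fun i : Fin 3 => deriv i.succ (deriv i.succ pres)),
      Fin.succ_zero_eq_one, h0, Fin.succ_one_eq_two, show (2 : Fin 3).succ = 3 from rfl]
    abel
  have hle : within CoeffField Set.univ (Pi.single 1 1) ≤ lower CoeffField (0, Pi.single 1 2) :=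
    within_le_lower (Or.inl (toLex_lt_of (b := Pi.single 1 2) 1 (by decide) (by decide)))
  -- As in the discrete case, velocity derivatives of the order of the leading derivative occur, and
  -- `p` must rank above the velocities.
  have hle' : within CoeffField {α | 0 < α} (Pi.single 1 2)
      ≤ lower CoeffField (0, Pi.single 1 2) := within_le_lower (Or.inr ⟨rfl, fun _ h => h⟩)
  have hp : pres ∈ within CoeffField Set.univ 0 := X_mem_within (Set.mem_univ _) le_rfl
  rw [h]
  refine add_mem (hle (add_mem (deriv_mem_within (deriv_mem_within hp le_rfl) ?_)
    (deriv_mem_within (deriv_mem_within hp le_rfl) ?_)))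
    (hle' (sum_mem fun i _ => sum_mem fun j _ => deriv_mem_within
      (deriv_mem_within (mul_mem (vel_mem_within i) (vel_mem_within j)) (toLex_single_lt j 0))
      ((toLex_single_lt i _).trans (le_of_eq (congrArg toLex ?_)))))
  · exact (toLex_lt_of 1 (by decide) (by decide)).le
  · exact (toLex_lt_of 1 (by decide) (by decide)).le
  · rw [zero_add, ← Pi.single_add]

theorem pdeSystem_tail (j : Fin 5) :
    pdeSystem j - X (differentialLead j) ∈ lower CoeffField (differentialLead j) := by
  fin_cases j
  · exact continuityEq_tail
  · exact momentumEq_tail 0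
  · exact momentumEq_tail 1
  · exact momentumEq_tail 2
  · exact poissonEq_tail

theorem ne_zero_of_sub_X_mem_lower {f : DiffPoly} {x : Var} (h : f - X x ∈ lower CoeffField x) :
    f ≠ 0 := by
  rintro rfl
  rw [zero_sub] at h
  have h' : X x ∈ lower CoeffField x := by simpa using neg_mem h
  have h'' : x ∈ {y | rankLT y x} := X_mem_supported.1 h'
  exact rankLT_irrefl x h''

theorem pdeSystem_ne_zero (j : Fin 5) : pdeSystem j ≠ 0 :=
  ne_zero_of_sub_X_mem_lower (pdeSystem_tail j)

/-- Setting all velocities to zero is a differential homomorphism. -/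
theorem deriv_aeval_pres_eq (i : Fin 4) (f : DiffPoly) :
    deriv i (aeval (fun x : Var => if x.1 = 0 then X x else 0 : Var → DiffPoly) f)
      = aeval (fun x : Var => if x.1 = 0 then X x else 0 : Var → DiffPoly) (deriv i f) := by
  induction f using MvPolynomial.induction_on with
  | C a => rw [aeval_C, deriv_C, map_zero, algebraMap_eq, deriv_C]
  | add f g hf hg => simp only [map_add, hf, hg]
  | mul_X f x hf =>
    simp only [map_mul, (deriv i).leibniz, hf, map_add, smul_eq_mul, aeval_X, deriv_X]
    split_ifs
    · rw [deriv_X]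
    · rw [map_zero]

/-- The correction by continuity contributes a third derivative of `u`, so the leading term of the
Poisson equation cannot be used. Setting the velocities to zero leaves the Laplacian of `p`, which
is non-zero. -/
theorem poissonEq_sub_ne_zero : poissonEq - reynolds⁻¹ • laplace continuityEq ≠ 0 := by
  intro h
  have hv (i : Fin 3) : aeval (fun x : Var => if x.1 = 0 then X x else 0 : Var → DiffPoly) (vel i)
      = 0 := by
    rw [vel, dvar, aeval_X, if_neg (Fin.succ_ne_zero i)]
  have hp : aeval (fun x : Var => if x.1 = 0 then X x else 0 : Var → DiffPoly) pres = pres := by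
    rw [pres, dvar, aeval_X, if_pos rfl]
  have h' := congrArg (aeval (fun x : Var => if x.1 = 0 then X x else 0 : Var → DiffPoly)) h
  rw [poissonEq_eq] at h'
  simp only [laplace, continuityEq, map_sub, map_add, map_sum, map_smul, map_mul, map_zero,
    ← deriv_aeval_pres_eq, hv, hp, mul_zero, Finset.sum_const_zero, add_zero, smul_zero,
    sub_zero] at h'
  refine ne_zero_of_sub_X_mem_lower (x := (0, Pi.single 1 2)) ?_ h'
  have h0 : deriv 1 (deriv 1 pres) = X (0, Pi.single 1 2) := by
    rw [pres, dvar, deriv_X, deriv_X, zero_add, ← Pi.single_add]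
  have hle : within CoeffField Set.univ (Pi.single 1 1) ≤ lower CoeffField (0, Pi.single 1 2) :=
    within_le_lower (Or.inl (toLex_lt_of (b := Pi.single 1 2) 1 (by decide) (by decide)))
  have hp : pres ∈ within CoeffField Set.univ 0 := X_mem_within (Set.mem_univ _) le_rfl
  rw [Fin.sum_univ_three, Fin.succ_zero_eq_one, h0, add_assoc, add_sub_cancel_left]
  refine hle (add_mem (deriv_mem_within (deriv_mem_within hp le_rfl) ?_)
    (deriv_mem_within (deriv_mem_within hp le_rfl) ?_))
  · exact (toLex_lt_of 1 (by decide) (by decide)).le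
  · exact (toLex_lt_of 1 (by decide) (by decide)).le

theorem implies_discreteSystem (j : Fin 4) :
    Implies (discreteSystem j.castSucc) {pdeSystem j.castSucc} := by
  refine Approximates.implies ?_ (pdeSystem_ne_zero _)
  fin_cases j
  · exact approximates_discreteContinuity
  · exact approximates_discreteMomentum 0
  · exact approximates_discreteMomentum 1
  · exact approximates_discreteMomentum 2

theorem implies_discretePoisson :
    Implies (discreteSystem 4) {pdeSystem 4 - reynolds⁻¹ • laplace (pdeSystem 0)} :=
  approximates_discretePoisson.implies poissonEq_sub_ne_zero

end DifferentialLeading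

/-! ### Iterated mixed derivatives -/

section IteratedDerivatives

theorem derivPow_add (i : Fin 4) (m n : ℕ) (f : DiffPoly) :
    derivPow i (m + n) f = derivPow i m (derivPow i n f) := by
  rw [derivPow, pow_add]
  rfl

theorem derivPow_comm (i j : Fin 4) (m n : ℕ) (f : DiffPoly) :
    derivPow i m (derivPow j n f) = derivPow j n (derivPow i m f) := by
  induction n with
  | zero => simp [derivPow_zero]
  | succ n ih => rw [derivPow_succ, derivPow_deriv, ih, ← derivPow_succ]

/-- The iterated derivative `∂ᵏ` as a linear map. -/
def iterDeriv (k : Fin 4 → ℕ) : DiffPoly →ₗ[CoeffField] DiffPoly :=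
  derivPow 0 (k 0) ∘ₗ derivPow 1 (k 1) ∘ₗ derivPow 2 (k 2) ∘ₗ derivPow 3 (k 3)

theorem iterDeriv_apply (k : Fin 4 → ℕ) (f : DiffPoly) : iterDeriv k f
    = derivPow 0 (k 0) (derivPow 1 (k 1) (derivPow 2 (k 2) (derivPow 3 (k 3) f))) := rfl

theorem iterDeriv_zero (f : DiffPoly) : iterDeriv 0 f = f := by
  simp [iterDeriv_apply, derivPow_zero]

theorem derivPow_iterDeriv (k : Fin 4 → ℕ) (i : Fin 4) (m : ℕ) (f : DiffPoly) :
    derivPow i m (iterDeriv k f) = iterDeriv (k + Pi.single i m) f := by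
  simp only [iterDeriv_apply, Pi.add_apply]
  fin_cases i
  · simp [add_comm (k 0), derivPow_add]
  · simp [add_comm (k 1), derivPow_add, derivPow_comm 1 0]
  · simp [add_comm (k 2), derivPow_add, derivPow_comm 2 0, derivPow_comm 2 1]
  · simp [add_comm (k 3), derivPow_add, derivPow_comm 3 0, derivPow_comm 3 1, derivPow_comm 3 2]

theorem iterDeriv_derivPow (k : Fin 4 → ℕ) (i : Fin 4) (m : ℕ) (f : DiffPoly) :
    iterDeriv k (derivPow i m f) = iterDeriv (k + Pi.single i m) f := by
  rw [← derivPow_iterDeriv]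
  simp only [iterDeriv_apply, derivPow_comm i]

theorem deriv_iterDeriv (k : Fin 4 → ℕ) (i : Fin 4) (f : DiffPoly) :
    deriv i (iterDeriv k f) = iterDeriv (k + Pi.single i 1) f := by
  rw [← derivPow_iterDeriv, derivPow_one]

theorem iterDeriv_X (k : Fin 4 → ℕ) (x : Var) : iterDeriv k (X x) = X (x.1, x.2 + k) := by
  induction k using nat_shift_induction with
  | h0 => rw [iterDeriv_zero, add_zero]
  | h s i ih => rw [← deriv_iterDeriv, ih, deriv_X, add_assoc]

theorem iterDeriv_mem_lower {x : Var} {f : DiffPoly} (hf : f ∈ lower CoeffField x)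
    (k : Fin 4 → ℕ) : iterDeriv k f ∈ lower CoeffField (x.1, x.2 + k) := by
  induction k using nat_shift_induction with
  | h0 => rwa [iterDeriv_zero, add_zero]
  | h s i ih =>
    rw [← deriv_iterDeriv, ← add_assoc]
    exact deriv_mem_lower ih i

theorem iterDeriv_mem {J : Ideal DiffPoly} (hJ : ∀ i, ∀ f ∈ J, deriv i f ∈ J) {f : DiffPoly}
    (hf : f ∈ J) (k : Fin 4 → ℕ) : iterDeriv k f ∈ J := by
  induction k using nat_shift_induction with
  | h0 => rwa [iterDeriv_zero]
  | h s i ih =>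
    rw [← deriv_iterDeriv]
    exact hJ i _ ih

end IteratedDerivatives

/-! ### Power series killed together with their derivatives -/

section Solutions

open MvPowerSeries (coeff constantCoeff)

/-- The coefficientwise derivative `∂ᵏ` of a power series in the grid spacings. -/
def coeffDeriv (k : Fin 4 → ℕ) (g : MvPowerSeries (Fin 4) DiffPoly) :
    MvPowerSeries (Fin 4) DiffPoly := fun n => iterDeriv k (coeff n g)

theorem coeff_coeffDeriv (k : Fin 4 → ℕ) (g : MvPowerSeries (Fin 4) DiffPoly) (n : Fin 4 →₀ ℕ) :
    coeff n (coeffDeriv k g) = iterDeriv k (coeff n g) := rfl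

theorem constantCoeff_coeffDeriv (k : Fin 4 → ℕ) (g : MvPowerSeries (Fin 4) DiffPoly) :
    constantCoeff (coeffDeriv k g) = iterDeriv k (constantCoeff g) := rfl

theorem coeff_extend_congr (E : DiffPoly →+* MvPowerSeries (Fin 4) DiffPoly)
    {g g' : MvPowerSeries (Fin 4) DiffPoly} {n : Fin 4 →₀ ℕ}
    (h : ∀ p ≤ n, coeff p g = coeff p g') : coeff n (extend E g) = coeff n (extend E g') := by
  rw [coeff_extend, coeff_extend]
  refine Finset.sum_congr rfl fun p hp => ?_
  rw [Finset.HasAntidiagonal.mem_antidiagonal] at hp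
  rw [h p.1 (by simp [← hp])]

/-- The homomorphism `E` kills `g` and its derivatives in the directions in `A`. -/
def Kills (E : DiffPoly →+* MvPowerSeries (Fin 4) DiffPoly) (A : Set (Fin 4))
    (g : MvPowerSeries (Fin 4) DiffPoly) : Prop :=
  ∀ k : Fin 4 → ℕ, (∀ i ∉ A, k i = 0) → extend E (coeffDeriv k g) = 0

variable {E : DiffPoly →+* MvPowerSeries (Fin 4) DiffPoly} {A : Set (Fin 4)}
  {g : MvPowerSeries (Fin 4) DiffPoly}

theorem Kills.extend_eq_zero (h : Kills E A g) : extend E g = 0 := by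
  have h0 : coeffDeriv 0 g = g := by
    ext1 n
    rw [coeff_coeffDeriv, iterDeriv_zero]
  rw [← h0]
  exact h 0 fun _ _ => rfl

/-- A formal shift is a series in `hᵢ` whose coefficients are scalar multiples of derivatives in
direction `i`, all of which are killed. This turns differential consequences into difference
consequences. -/
theorem Kills.formalShift (h : Kills E A g) {i : Fin 4} (hi : i ∈ A) (ε : ℤ) :
    Kills E A (formalShift i ε g) := by
  intro k hk
  ext1 n
  -- For the coefficient at `n` only exponents up to `n` matter, so the infinite Taylor sum may be
  -- cut off at `n i` and `extend E` applied termwise.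
  have hcongr : ∀ p ≤ n, coeff p (coeffDeriv k (NavierStokes.formalShift i ε g))
      = coeff p (∑ m ∈ Finset.range (n i + 1), MvPowerSeries.monomial (Finsupp.single i m)
        (C (taylorCoeff ε m)) * coeffDeriv (k + Pi.single i m) g) := by
    intro p hp
    rw [coeff_coeffDeriv, coeff_formalShift, map_sum, map_sum]
    refine Finset.sum_subset_zero_on_sdiff
      (Finset.range_mono (Nat.succ_le_succ (hp i))) (fun m hm => ?_) fun m hm => ?_
    · rw [MvPowerSeries.coeff_monomial_mul, if_neg]
      rw [Finsupp.single_le_iff]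
      simpa using (Finset.mem_sdiff.1 hm).2
    · rw [MvPowerSeries.coeff_monomial_mul, if_pos, map_smul, iterDeriv_derivPow,
        smul_eq_C_mul, coeff_coeffDeriv]
      rw [Finsupp.single_le_iff]
      exact Nat.lt_succ_iff.1 (Finset.mem_range.1 hm)
  rw [coeff_extend_congr E hcongr, map_sum, Finset.sum_eq_zero]
  intro m _
  rw [map_mul, h, mul_zero]
  intro j hj
  have hij : j ≠ i := fun hij => hj (hij ▸ hi)
  simp [hk j hj, hij]

theorem exists_hasExpansion_kills {f : ShiftPoly ℤ} {m : Fin 4 →₀ ℕ} (hf : HasExpansion m f g)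
    (h : Kills E A g) {a : Fin 4 → ℤ} (ha : ∀ i ∉ A, a i = 0) :
    ∃ g', HasExpansion m (shift a f) g' ∧ Kills E A g' := by
  classical
  -- Coordinates outside `A` are zeroed so that induction over all shifts can be used: a step in a
  -- direction outside `A` then changes nothing.
  have key (a : Fin 4 → ℤ) :
      ∃ g', HasExpansion m (shift (fun i => if i ∈ A then a i else 0) f) g' ∧ Kills E A g' := by
    have hstep (s : Fin 4 → ℤ) (i : Fin 4) (ε : ℤ)
        (ih : ∃ g', HasExpansion m (shift (fun i => if i ∈ A then s i else 0) f) g'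
          ∧ Kills E A g') :
        ∃ g', HasExpansion m
          (shift (fun j => if j ∈ A then (s + Pi.single i ε : Fin 4 → ℤ) j else 0) f)
          g' ∧ Kills E A g' := by
      by_cases hi : i ∈ A
      · obtain ⟨g', h1, h2⟩ := ih
        refine ⟨_, ?_, h2.formalShift hi ε⟩
        convert h1.shift i ε using 1
        rw [shift_shift]
        congr 1
        congr 1
        funext j
        by_cases hj : j = i
        · subst hj
          simp [hi]
        · simp [hj]
      · convert ih using 7 with g' j
        by_cases hj : j = i
        · subst hj
          simp [hi]
        · simp [hj]
    induction a using int_shift_induction with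
    | h0 =>
      have h0 : (fun i => if i ∈ A then (0 : Fin 4 → ℤ) i else 0) = 0 := funext fun i => ite_self _
      exact ⟨g, by rwa [h0, shift_zero], h⟩
    | h s i ih => exact hstep s i 1 ih
    | h' s i ih => exact hstep s i (-1) ih
  have h' : (fun i => if i ∈ A then a i else 0) = a := by
    funext i
    split_ifs with hi
    · rfl
    · exact (ha i hi).symm
  rw [← h']
  exact key a

end Solutions

/-! ### Evaluating difference polynomials at formal solutions -/

section Evaluation

variable {E : DiffPoly →+* MvPowerSeries (Fin 4) DiffPoly}

/-- Polynomials in the grid spacings as power series with differential polynomials as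
coefficients. -/
def stepSeries : StepPoly →+* MvPowerSeries (Fin 4) DiffPoly :=
  coeToMvPowerSeries.ringHom.comp (MvPolynomial.map C)

theorem stepSeries_apply (a : StepPoly) :
    stepSeries a = (MvPolynomial.map C a : MvPolynomial (Fin 4) DiffPoly) := rfl

theorem stepSeries_injective : Function.Injective stepSeries :=
  (coe_injective (σ := Fin 4) (R := DiffPoly)).comp (map_injective _ (C_injective _ _))

theorem extend_stepSeries (hE : ∀ a, E (C a) = MvPowerSeries.C (C a)) (a : StepPoly) :
    extend E (stepSeries a) = stepSeries a := by
  have : (extend E).comp stepSeries = stepSeries := by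
    refine MvPolynomial.ringHom_ext (fun c => ?_) fun i => ?_
    · rw [RingHom.comp_apply, stepSeries_apply, MvPolynomial.map_C, coe_C, extend_C, hE]
    · rw [RingHom.comp_apply, stepSeries_apply, MvPolynomial.map_X, coe_X, MvPowerSeries.X,
        extend_monomial, E.map_one, mul_one]
  exact RingHom.congr_fun this a

/-- The field of fractions of the power series in the grid spacings. -/
abbrev SeriesField : Type := FractionRing (MvPowerSeries (Fin 4) DiffPoly)

/-- Coefficients of difference polynomials may have any non-zero polynomial in the grid spacings as
denominator, which need not be invertible as a power series. Evaluation therefore takes values in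
the fraction field. -/
theorem algebraMap_stepSeries_injective : Function.Injective
    ((algebraMap (MvPowerSeries (Fin 4) DiffPoly) SeriesField).comp stepSeries) :=
  (IsFractionRing.injective (MvPowerSeries (Fin 4) DiffPoly) SeriesField).comp
    stepSeries_injective

/-- The evaluation of difference polynomials at the grid functions with Taylor expansions
`E (u^(α))`. -/
def seriesEval (E : DiffPoly →+* MvPowerSeries (Fin 4) DiffPoly) : ShiftPoly ℤ →+* SeriesField :=
  eval₂Hom (IsFractionRing.lift algebraMap_stepSeries_injective)
    fun x => algebraMap _ _ (extend E (taylorVar x))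

theorem seriesEval_map (hE : ∀ a, E (C a) = MvPowerSeries.C (C a))
    (P : MvPolynomial (Fin 4 × (Fin 4 → ℤ)) StepPoly) :
    seriesEval E (MvPolynomial.map (algebraMap StepPoly StepField) P)
      = algebraMap _ _ (extend E (taylor P)) := by
  have : (seriesEval E).comp (MvPolynomial.map (algebraMap StepPoly StepField))
      = (algebraMap _ SeriesField).comp ((extend E).comp taylor) := by
    refine MvPolynomial.ringHom_ext (fun c => ?_) fun x => ?_
    · rw [RingHom.comp_apply, MvPolynomial.map_C, seriesEval, eval₂Hom_C, RingHom.comp_apply,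
        RingHom.comp_apply, taylor_C, ← stepSeries_apply, extend_stepSeries hE]
      exact IsFractionRing.lift_algebraMap algebraMap_stepSeries_injective c
    · rw [RingHom.comp_apply, MvPolynomial.map_X, seriesEval, eval₂Hom_X', RingHom.comp_apply,
        RingHom.comp_apply, taylor_X]
  exact RingHom.congr_fun this P

theorem eq_zero_of_seriesEval_C_mul {a : StepField} (ha : a ≠ 0) {f : ShiftPoly ℤ}
    (h : seriesEval E (C a * f) = 0) : seriesEval E f = 0 := by
  rw [map_mul, seriesEval, eval₂Hom_C] at h
  exact (mul_eq_zero.1 h).resolve_left ((map_ne_zero _).2 ha)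

theorem HasExpansion.seriesEval_eq_zero (hE : ∀ a, E (C a) = MvPowerSeries.C (C a))
    {m : Fin 4 →₀ ℕ} {f : ShiftPoly ℤ} {g : MvPowerSeries (Fin 4) DiffPoly}
    (h : HasExpansion m f g) (hg : extend E g = 0) : seriesEval E f = 0 := by
  obtain ⟨P, hP, ht⟩ := h
  refine eq_zero_of_seriesEval_C_mul (a := algebraMap StepPoly StepField (monomial m 1)) ?_ ?_
  · rw [Ne, FaithfulSMul.algebraMap_eq_zero_iff, monomial_eq_zero]
    exact one_ne_zero
  · rw [← hP, seriesEval_map hE, ht, map_mul, hg, mul_zero, map_zero]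

end Evaluation

/-! ### A formal solution of the discrete system -/

section SolutionOfSystem

open MvPowerSeries (coeff constantCoeff)

/-- The difference polynomials `F̃₀, …, F̃₃` and a combination of `F̃₄` and `F̃₀`. -/
def adjustedSystem : Fin 5 → ShiftPoly ℤ :=
  ![discreteContinuity, discreteMomentum 0, discreteMomentum 1, discreteMomentum 2,
    discretePoisson + invRe • discreteLaplace discreteContinuity]

/-- The limit of the discrete Poisson equation contains third derivatives of `u`, which outrank its
pressure term and would destroy triangularity. Adding the discrete Laplacian of continuity cancels
them in the limit. -/
theorem approximates_adjustedSystem (j : Fin 5) :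
    Approximates (adjustedSystem j) (pdeSystem j) := by
  fin_cases j
  · exact approximates_discreteContinuity
  · exact approximates_discreteMomentum 0
  · exact approximates_discreteMomentum 1
  · exact approximates_discreteMomentum 2
  · have h := approximates_discretePoisson.add
      (approximates_discreteContinuity.discreteLaplace.smul reynolds⁻¹)
    rwa [sub_add_cancel] at h

/-- The triangular shape depends only on constant terms, which here are derivatives of the
differential equations. -/
theorem isTriangular_coeffDeriv {g : Fin 5 → MvPowerSeries (Fin 4) DiffPoly}
    (hg : ∀ j, constantCoeff (g j) = pdeSystem j) :
    IsTriangular rankLT (ruleLead differentialLead)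
      fun p : RuleIndex => coeffDeriv p.1.2 (g p.1.1) where
  wf := wellFounded_rankLT
  injective := ruleLead_injective (by ext j; fin_cases j <;> rfl) rfl (by decide)
  tail p := by
    rw [constantCoeff_coeffDeriv, hg, ruleLead, ← iterDeriv_X, ← map_sub]
    exact iterDeriv_mem_lower (pdeSystem_tail _) _

theorem deriv_mem_radicalDifferentialIdeal {F : Set DiffPoly} {f : DiffPoly}
    (hf : f ∈ radicalDifferentialIdeal F) (i : Fin 4) : deriv i f ∈ radicalDifferentialIdeal F :=
  Ideal.mem_sInf.2 fun {_} hI => hI.2.2 i _ (Ideal.mem_sInf.1 hf hI)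

theorem subset_radicalDifferentialIdeal (F : Set DiffPoly) : F ⊆ radicalDifferentialIdeal F :=
  fun _ hf => Ideal.mem_sInf.2 fun {_} hI => hI.1 hf

theorem Dx_mem_shiftKernel {A : Type*} [CommRing A] {φ : ShiftPoly ℤ →+* A}
    {M : AddSubmonoid (Fin 4 → ℤ)} (hM : ∀ (i : Fin 3) ε, Pi.single i.succ ε ∈ M) {f : ShiftPoly ℤ}
    (hf : f ∈ shiftKernel φ M) (i : Fin 3) : Dx i f ∈ shiftKernel φ M :=
  smul_mem_ideal _ (sub_mem (shift_mem_shiftKernel hf (hM i _)) (shift_mem_shiftKernel hf (hM i _)))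

theorem discreteLaplace_mem_shiftKernel {A : Type*} [CommRing A] {φ : ShiftPoly ℤ →+* A}
    {M : AddSubmonoid (Fin 4 → ℤ)} (hM : ∀ (i : Fin 3) ε, Pi.single i.succ ε ∈ M) {f : ShiftPoly ℤ}
    (hf : f ∈ shiftKernel φ M) : discreteLaplace f ∈ shiftKernel φ M :=
  sum_mem fun i _ => smul_mem_ideal _ (add_mem (sub_mem (shift_mem_shiftKernel hf (hM i _))
    (Ideal.mul_mem_left _ _ hf)) (shift_mem_shiftKernel hf (hM i _)))

/-- The shifts in the space directions. -/
def spaceShifts : AddSubmonoid (Fin 4 → ℤ) where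
  carrier := {a | a 0 = 0}
  zero_mem' := rfl
  add_mem' {a b} ha hb := by
    change a 0 + b 0 = 0
    rw [show a 0 = 0 from ha, show b 0 = 0 from hb, add_zero]

/-- The shifts that are non-negative in the time direction. -/
def futureShifts : AddSubmonoid (Fin 4 → ℤ) where
  carrier := {a | 0 ≤ a 0}
  zero_mem' := le_refl (0 : ℤ)
  add_mem' {a b} ha hb := add_nonneg (a := a 0) (b := b 0) ha hb

theorem shiftKernel_anti {A : Type*} [CommRing A] {φ : ShiftPoly ℤ →+* A}
    {M N : AddSubmonoid (Fin 4 → ℤ)} (h : M ≤ N) : shiftKernel φ N ≤ shiftKernel φ M :=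
  fun _ hf => mem_shiftKernel.2 fun s hs => mem_shiftKernel.1 hf s (h hs)

theorem discreteMomentum_mem_shiftKernel {A : Type*} [CommRing A] {φ : ShiftPoly ℤ →+* A}
    {M : AddSubmonoid (Fin 4 → ℤ)} (h : ∀ j ≠ 0, adjustedSystem j ∈ shiftKernel φ M) (i : Fin 3) :
    discreteMomentum i ∈ shiftKernel φ M := by
  fin_cases i
  exacts [h 1 (by decide), h 2 (by decide), h 3 (by decide)]

/-- Continuity, known at all space shifts, is propagated forward in time by the integrability
condition. The direction matters: with the adjusted Poisson equation the new time level is given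
explicitly by the old one, whereas a step backward would require inverting an operator involving the
discrete Laplacian. -/
theorem discreteContinuity_mem_shiftKernel {A : Type*} [CommRing A] {φ : ShiftPoly ℤ →+* A}
    (h0 : discreteContinuity ∈ shiftKernel φ spaceShifts)
    (h : ∀ j ≠ 0, adjustedSystem j ∈ shiftKernel φ ⊤) :
    discreteContinuity ∈ shiftKernel φ futureShifts := by
  have hM (i : Fin 3) (ε : ℤ) : Pi.single i.succ ε ∈ spaceShifts :=
    Pi.single_eq_of_ne (Fin.succ_ne_zero i).symm ε
  have hshift {f : ShiftPoly ℤ} (hf : f ∈ shiftKernel φ ⊤) (s : Fin 4 → ℤ) :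
      shift s f ∈ shiftKernel φ spaceShifts :=
    shiftKernel_anti le_top (shift_mem_shiftKernel hf (AddSubmonoid.mem_top s))
  have key (n : ℕ) : shift (Pi.single 0 (n : ℤ)) discreteContinuity
      ∈ shiftKernel φ spaceShifts := by
    induction n with
    | zero => simpa [shift_zero] using h0
    | succ n ih =>
      -- Continuity at time level `n` removes the correction from the adjusted Poisson equation at
      -- the same level.
      have hP : shift (Pi.single 0 (n : ℤ)) discretePoisson ∈ shiftKernel φ spaceShifts := by
        have h4 := hshift (h 4 (by decide)) (Pi.single 0 (n : ℤ))
        have hL := smul_mem_ideal invRe (discreteLaplace_mem_shiftKernel hM ih)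
        have := sub_mem h4 hL
        rwa [discreteLaplace_shift, ← map_smul, ← map_sub, show adjustedSystem 4
          = discretePoisson + invRe • discreteLaplace discreteContinuity from rfl,
          add_sub_cancel_right] at this
      rw [Nat.cast_succ, add_comm, Pi.single_add, ← shift_shift, shift_time_discreteContinuity,
        map_add, map_smul, map_sub, map_sum]
      refine add_mem ih (smul_mem_ideal _ (sub_mem (sum_mem fun i _ => ?_) hP))
      rw [← Dx_shift]
      exact Dx_mem_shiftKernel hM (hshift (discreteMomentum_mem_shiftKernel h i) _) i
  refine mem_shiftKernel.2 fun s hs => ?_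
  obtain ⟨n, hn⟩ := Int.eq_ofNat_of_zero_le (show 0 ≤ s 0 from hs)
  have hs' : s - Pi.single 0 (n : ℤ) ∈ spaceShifts := by
    change s 0 - (Pi.single 0 (n : ℤ) : Fin 4 → ℤ) 0 = 0
    rw [Pi.single_eq_same, hn, sub_self]
  have := mem_shiftKernel.1 (key n) _ hs'
  rwa [shift_shift, add_sub_cancel] at this

theorem discreteSystem_mem_shiftKernel {A : Type*} [CommRing A] {φ : ShiftPoly ℤ →+* A}
    (h0 : discreteContinuity ∈ shiftKernel φ spaceShifts)
    (h : ∀ j ≠ 0, adjustedSystem j ∈ shiftKernel φ ⊤) (j : Fin 5) :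
    discreteSystem j ∈ shiftKernel φ futureShifts := by
  have hC := discreteContinuity_mem_shiftKernel h0 h
  have h' (j : Fin 5) (hj : j ≠ 0) := shiftKernel_anti (le_top (a := futureShifts)) (h j hj)
  have hM (i : Fin 3) (ε : ℤ) : Pi.single i.succ ε ∈ futureShifts :=
    (Pi.single_eq_of_ne (M := fun _ => ℤ) (Fin.succ_ne_zero i).symm ε).ge
  fin_cases j
  · exact hC
  · exact discreteMomentum_mem_shiftKernel h' 0
  · exact discreteMomentum_mem_shiftKernel h' 1
  · exact discreteMomentum_mem_shiftKernel h' 2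
  · have := sub_mem (h' 4 (by decide))
      (smul_mem_ideal invRe (discreteLaplace_mem_shiftKernel hM hC))
    rwa [show adjustedSystem 4 = discretePoisson + invRe • discreteLaplace discreteContinuity
      from rfl, add_sub_cancel_right] at this

/-- The system vanishes only at non-negative time shifts, so an element of the inversive ideal is
first moved into the difference ideal by a right shift. -/
theorem exists_map_shift_eq_zero {A : Type*} [CommRing A] {φ : ShiftPoly ℤ →+* A}
    (h : ∀ j, discreteSystem j ∈ shiftKernel φ futureShifts) {f : ShiftPoly ℤ}
    (hf : f ∈ inversiveDifferenceIdeal (Set.range discreteSystem)) :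
    ∃ s : Fin 4 → ℕ, φ (shift (castShift s) f) = 0 := by
  obtain ⟨s, g, hg, hgf⟩ := (mem_inversiveDifferenceIdeal_iff f).1 hf
  have hfuture (s : Fin 4 → ℕ) : castShift s ∈ futureShifts := Int.natCast_nonneg _
  have hle : differenceIdeal (Set.range clearedSystem)
      ≤ (shiftKernel φ futureShifts).comap natInclusion := by
    refine differenceIdeal_le ?_ fun s f hf => ?_
    · rintro _ ⟨j, rfl⟩
      change natInclusion (clearedSystem j) ∈ shiftKernel φ futureShifts
      rw [natInclusion_clearedSystem]
      refine shift_mem_shiftKernel (h j) (show 0 ≤ clearing j 0 from ?_)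
      fin_cases j <;> exact le_rfl
    · change natInclusion (shift s f) ∈ shiftKernel φ futureShifts
      rw [natInclusion_shift]
      exact shift_mem_shiftKernel hf (hfuture s)
  refine ⟨s, ?_⟩
  have := mem_shiftKernel.1 (hle hg) 0 (zero_mem _)
  rw [shift_zero] at this
  rw [← hgf]
  exact this

/-- There are formal power series solutions of the discrete system in the grid spacings, whose
constant terms are the generic solution of the differential system. -/
theorem exists_seriesEval_eq_zero : ∃ E : DiffPoly →+* MvPowerSeries (Fin 4) DiffPoly,
    (∀ a, E (C a) = MvPowerSeries.C (C a)) ∧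
    (∀ f, f - constantCoeff (E f) ∈ radicalDifferentialIdeal (Set.range pdeSystem)) ∧
    ∀ f ∈ inversiveDifferenceIdeal (Set.range discreteSystem),
      ∃ s : Fin 4 → ℕ, seriesEval E (shift (castShift s) f) = 0 := by
  -- The unknown `E` is required to kill the expansions `g j` and their derivatives, the time
  -- derivatives of `g 0` excepted.
  choose m g hexp hg using approximates_adjustedSystem
  have htri := isTriangular_coeffDeriv hg
  obtain ⟨E, hE⟩ := htri.exists_isSolution
  refine ⟨E, hE.map_C, hE.sub_constantCoeff_mem htri fun p => ?_, fun f hf =>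
    exists_map_shift_eq_zero (discreteSystem_mem_shiftKernel ?_ fun j hj => ?_) hf⟩
  · rw [constantCoeff_coeffDeriv, hg]
    exact iterDeriv_mem (fun i f hf => deriv_mem_radicalDifferentialIdeal hf i)
      (subset_radicalDifferentialIdeal _ (Set.mem_range_self p.1.1)) _
  -- Time derivatives of continuity are not rules, so only space shifts are controlled directly.
  · have hk : Kills E {0}ᶜ (g 0) := fun k hk =>
      hE.extend_eq_zero (⟨(0, k), fun _ => hk 0 (by simp)⟩ : RuleIndex)
    refine mem_shiftKernel.2 fun s hs => ?_
    obtain ⟨g', h1, h2⟩ := exists_hasExpansion_kills (hexp 0) hk (a := s) fun i hi => by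
      rw [show i = 0 by simpa using hi]
      exact hs
    exact h1.seriesEval_eq_zero hE.map_C h2.extend_eq_zero
  · have hk : Kills E Set.univ (g j) := fun k _ =>
      hE.extend_eq_zero (⟨(j, k), fun h => absurd h hj⟩ : RuleIndex)
    refine mem_shiftKernel.2 fun s hs => ?_
    obtain ⟨g', h1, h2⟩ := exists_hasExpansion_kills (hexp j) hk (a := s)
      fun i hi => absurd (Set.mem_univ i) hi
    exact h1.seriesEval_eq_zero hE.map_C h2.extend_eq_zero

end SolutionOfSystem

/-! ### Injectivity of Taylor expansion -/

section TaylorInjective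

variable {σ K : Type*} [Field K]

theorem exists_eval_eq_one_eq_zero {a b : σ → K} (h : a ≠ b) :
    ∃ p : MvPolynomial σ K, eval a p = 1 ∧ eval b p = 0 := by
  obtain ⟨i, hi⟩ := Function.ne_iff.1 h
  refine ⟨C (a i - b i)⁻¹ * (X i - C (b i)), ?_, ?_⟩
  · simp [inv_mul_cancel₀ (sub_ne_zero.2 hi)]
  · simp

/-- Interpolation at finitely many points. -/
theorem exists_forall_eval_eq {ι : Type*} (s : Finset ι) {a : ι → σ → K}
    (ha : Function.Injective a) (c : ι → K) :
    ∃ p : MvPolynomial σ K, ∀ i ∈ s, eval (a i) p = c i := by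
  classical
  have h (i j : ι) : ∃ p : MvPolynomial σ K, i ≠ j → eval (a i) p = 1 ∧ eval (a j) p = 0 := by
    by_cases hij : i = j
    · exact ⟨0, fun h => absurd hij h⟩
    · obtain ⟨p, hp⟩ := exists_eval_eq_one_eq_zero (ha.ne hij)
      exact ⟨p, fun _ => hp⟩
  choose p hp using h
  refine ⟨∑ i ∈ s, C (c i) * ∏ j ∈ s.erase i, p i j, fun k hk => ?_⟩
  simp only [map_sum, map_mul, map_prod, eval_C]
  rw [Finset.sum_eq_single_of_mem k hk]
  · rw [Finset.prod_eq_one, mul_one]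
    exact fun j hj => (hp k j (Finset.ne_of_mem_erase hj).symm).1
  · intro i _ hik
    rw [Finset.prod_eq_zero (Finset.mem_erase.2 ⟨hik.symm, hk⟩) (hp i k hik).2, mul_zero]

/-- A non-zero polynomial with polynomial coefficients does not vanish at some point with non-zero
parameters. -/
theorem exists_eval_map_eval_ne_zero [Fintype σ] [Infinite K] {V : Type*}
    {P : MvPolynomial V (MvPolynomial σ K)} (hP : P ≠ 0) :
    ∃ (h : σ → K) (c : V → K), (∀ i, h i ≠ 0) ∧ eval c (MvPolynomial.map (eval h) P) ≠ 0 := by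
  obtain ⟨m, hm⟩ := MvPolynomial.ne_zero_iff.1 hP
  -- The factor `∏ i, X i` forces the point found to have all coordinates non-zero.
  have hm' : coeff m P * ∏ i, X i ≠ 0 :=
    mul_ne_zero hm (Finset.prod_ne_zero_iff.2 fun i _ => X_ne_zero i)
  obtain ⟨h, hh⟩ : ∃ h, eval h (coeff m P * ∏ i, X i) ≠ 0 := by
    by_contra! hcon
    exact hm' (MvPolynomial.funext fun h => by rw [hcon, map_zero])
  rw [map_mul, map_prod] at hh
  have hmap : MvPolynomial.map (eval h) P ≠ 0 :=
    MvPolynomial.ne_zero_iff.2 ⟨m, by rw [coeff_map]; exact left_ne_zero_of_mul hh⟩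
  obtain ⟨c, hc⟩ : ∃ c, eval c (MvPolynomial.map (eval h) P) ≠ 0 := by
    by_contra! hcon
    exact hmap (MvPolynomial.funext fun h => by rw [hcon, map_zero])
  refine ⟨h, c, fun i => ?_, hc⟩
  simpa using Finset.prod_ne_zero_iff.1 (right_ne_zero_of_mul hh) i (Finset.mem_univ i)

theorem coeff_aeval_smul_X [Fintype σ] (a : σ → K) (g : MvPolynomial σ K) (k : σ →₀ ℕ) :
    coeff k (aeval (fun i => a i • (X i : MvPolynomial σ K)) g) = (∏ i, a i ^ k i) * coeff k g := by
  classical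
  induction g using MvPolynomial.induction_on' with
  | monomial m b =>
    have h : aeval (fun i => a i • (X i : MvPolynomial σ K)) (monomial m b)
        = C (∏ i, a i ^ m i) * monomial m b := by
      rw [aeval_monomial, Finsupp.prod_fintype _ _ fun i => pow_zero _, monomial_eq,
        Finsupp.prod_fintype _ _ fun i => pow_zero _]
      simp only [smul_eq_C_mul, mul_pow, Finset.prod_mul_distrib, map_prod, map_pow, algebraMap_eq]
      ring
    rw [h, coeff_C_mul, coeff_monomial]
    split_ifs with hmk
    · rw [hmk]
    · rw [mul_zero, mul_zero]
  | add p q hp hq => rw [map_add, coeff_add, hp, hq, coeff_add, mul_add]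

theorem eval_aeval_smul_X (a h : σ → K) (g : MvPolynomial σ K) :
    eval h (aeval (fun i => a i • (X i : MvPolynomial σ K)) g) = eval (fun i => a i * h i) g := by
  induction g using MvPolynomial.induction_on with
  | C b => simp
  | add p q hp hq => simp only [map_add, hp, hq]
  | mul_X p i hp => rw [map_mul, map_mul, hp, aeval_X, smul_eval, eval_X, map_mul, eval_X]

/-- The values at `0` of the derivatives of the polynomial functions `g`. -/
def polyJet (g : Fin 4 → MvPolynomial (Fin 4) CoeffField) : DiffPoly →ₐ[CoeffField] CoeffField :=
  aeval fun x => (∏ i, ((x.2 i).factorial : CoeffField))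
    * coeff (Finsupp.equivFunOnFinite.symm x.2) (g x.1)

theorem map_polyJet_taylorVar (g : Fin 4 → MvPolynomial (Fin 4) CoeffField)
    (x : Fin 4 × (Fin 4 → ℤ)) :
    MvPowerSeries.map (polyJet g : DiffPoly →+* CoeffField) (taylorVar x)
      = (aeval (fun i => (x.2 i : CoeffField) • (X i : StepPoly)) (g x.1) : StepPoly) := by
  ext1 k
  rw [MvPowerSeries.coeff_map, coeff_taylorVar, RingHom.coe_coe, map_smul, polyJet, aeval_X,
    coeff_coe, coeff_aeval_smul_X, smul_eq_mul, ← mul_assoc, ← Finset.prod_mul_distrib]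
  have hprod : ∏ i, taylorCoeff (x.2 i) (k i) * ((k i).factorial : CoeffField)
      = ∏ i, (x.2 i : CoeffField) ^ k i :=
    Finset.prod_congr rfl fun i _ =>
      div_mul_cancel₀ _ (Nat.cast_ne_zero.2 (k i).factorial_ne_zero)
  rw [hprod, Finsupp.equivFunOnFinite_symm_coe]

/-- For polynomial functions the Taylor series is finite and exact: substituting their jets at the
origin into the formal expansion gives the values of the difference polynomial on the grid, as
polynomials in the grid spacings. -/
theorem map_polyJet_taylor (g : Fin 4 → MvPolynomial (Fin 4) CoeffField)
    (P : MvPolynomial (Fin 4 × (Fin 4 → ℤ)) StepPoly) :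
    MvPowerSeries.map (polyJet g : DiffPoly →+* CoeffField) (taylor P)
      = (eval (fun x => aeval (fun i => (x.2 i : CoeffField) • (X i : StepPoly)) (g x.1)) P :
        StepPoly) := by
  have : (MvPowerSeries.map (polyJet g : DiffPoly →+* CoeffField)).comp taylor
      = coeToMvPowerSeries.ringHom.comp
        (eval fun x => aeval (fun i => (x.2 i : CoeffField) • (X i : StepPoly)) (g x.1)) := by
    refine MvPolynomial.ringHom_ext (fun a => ?_) fun x => ?_
    · rw [RingHom.comp_apply, RingHom.comp_apply, taylor_C, eval_C]
      ext1 k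
      rw [MvPowerSeries.coeff_map, coeff_coe, coeff_map, RingHom.coe_coe, polyJet, aeval_C]
      exact (coeff_coe ..).symm
    · rw [RingHom.comp_apply, RingHom.comp_apply, taylor_X, eval_X, map_polyJet_taylorVar]
      rfl
  exact RingHom.congr_fun this P

/-- A non-zero difference polynomial is non-zero for some numerical non-zero grid spacings and some
grid values. The finitely many grid values involved are interpolated by polynomial functions, and on
these the Taylor expansion computes the difference polynomial. -/
theorem taylor_ne_zero {P : MvPolynomial (Fin 4 × (Fin 4 → ℤ)) StepPoly} (hP : P ≠ 0) :
    taylor P ≠ 0 := by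
  intro h0
  obtain ⟨h, c, hh, hc⟩ := exists_eval_map_eval_ne_zero hP
  -- Non-zero grid spacings make distinct shifts distinct points of space-time, as interpolation
  -- requires; coordinates are compared in characteristic zero.
  have hinj : Function.Injective fun (a : Fin 4 → ℤ) (i : Fin 4) => (a i : CoeffField) * h i := by
    intro a b hab
    funext i
    exact Int.cast_injective (mul_right_cancel₀ (hh i) (congrFun hab i))
  have hg (α : Fin 4) := exists_forall_eval_eq (P.vars.image Prod.snd) hinj fun a => c (α, a)
  choose g hg using hg
  have h1 := map_polyJet_taylor g P
  rw [h0, map_zero, eq_comm, coe_eq_zero_iff] at h1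
  have h2 := congrArg (eval h) h1
  rw [map_zero] at h2
  have h3 (φ : Fin 4 × (Fin 4 → ℤ) → StepPoly) :
      eval h (eval φ P) = eval₂ (eval h) (fun x => eval h (φ x)) P :=
    eval₂_comp_left (eval h) (RingHom.id StepPoly) φ P
  rw [h3] at h2
  rw [eval_map, ← h2] at hc
  refine hc (eval₂_congr _ _ _ fun {x n} hx hn => ?_)
  have hx' : x.2 ∈ P.vars.image Prod.snd :=
    Finset.mem_image_of_mem _ ((mem_vars_iff_mem_support x).2 ⟨n, mem_support_iff.2 hn, hx⟩)
  rw [eval_aeval_smul_X]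
  exact (hg x.1 x.2 hx').symm

end TaylorInjective

/-! ### Strong consistency -/

section Consistency

-- The finitely many coefficients have a common denominator: the polynomial ring over the fraction
-- field is a localization of the one over the grid polynomials.
attribute [local instance] algebraMvPolynomial in
theorem exists_map_eq_C_mul (f : ShiftPoly ℤ) : ∃ q : StepPoly, q ≠ 0 ∧
    ∃ P : MvPolynomial (Fin 4 × (Fin 4 → ℤ)) StepPoly,
      MvPolynomial.map (algebraMap StepPoly StepField) P
        = C (algebraMap StepPoly StepField q) * f := by
  obtain ⟨⟨P, y⟩, h⟩ := IsLocalization.surj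
    ((nonZeroDivisors StepPoly).map (C (σ := Fin 4 × (Fin 4 → ℤ)))) f
  obtain ⟨q, hq, hy⟩ := y.2
  refine ⟨q, nonZeroDivisors.ne_zero hq, P, ?_⟩
  rw [mul_comm, ← map_C]
  rw [← hy] at h
  exact h.symm

open MvPowerSeries (coeff constantCoeff)

/-- The corrections made by a shift at an exponent are derivatives of coefficients of strictly
smaller degree. Up to the lowest degree `d` these vanish. -/
theorem coeff_taylor_polyShift {P : MvPolynomial (Fin 4 × (Fin 4 → ℤ)) StepPoly} {d : ℕ}
    (hd : ∀ n : Fin 4 →₀ ℕ, n.degree < d → coeff n (taylor P) = 0) (s : Fin 4 → ℕ)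
    (n : Fin 4 →₀ ℕ) (hn : n.degree ≤ d) :
    coeff n (taylor (polyShift (castShift s) P)) = coeff n (taylor P) := by
  induction s using nat_shift_induction generalizing n with
  | h0 =>
    congr 2
    rw [castShift_zero]
    have : (fun x : Fin 4 × (Fin 4 → ℤ) => (x.1, x.2 + 0)) = id := by
      funext x
      rw [add_zero]
      rfl
    rw [polyShift, this, rename_id_apply]
  | h s i ih =>
    have h1 : polyShift (castShift (s + Pi.single i 1)) P
        = polyShift (Pi.single i 1) (polyShift (castShift s) P) := by
      rw [polyShift, polyShift, polyShift, rename_rename, castShift_add, castShift_single]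
      congr 2
      funext x
      simp [add_assoc]
    rw [h1, taylor_polyShift, coeff_formalShift, Finset.sum_range_succ', Finset.sum_eq_zero]
    · simp [taylorCoeff_zero, derivPow_zero, ih n hn]
    · intro m hm
      have hle : Finsupp.single i (m + 1) ≤ n := by
        rw [Finsupp.single_le_iff]
        exact Nat.succ_le_of_lt (Finset.mem_range.1 hm)
      have hdeg : (n - Finsupp.single i (m + 1)).degree < d := by
        have := congrArg Finsupp.degree (tsub_add_cancel_of_le hle)
        rw [map_add, Finsupp.degree_single] at this
        omega
      rw [ih _ hdeg.le, hd _ hdeg, map_zero, smul_zero]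

/-- Only finitely many exponents have degree `d`, so the non-zero coefficients there can be
enumerated to give the implied set. -/
theorem implies_lowestCoeffs {f : ShiftPoly ℤ} {q : StepPoly} (hq : q ≠ 0)
    {P : MvPolynomial (Fin 4 × (Fin 4 → ℤ)) StepPoly}
    (hP : MvPolynomial.map (algebraMap StepPoly StepField) P
      = C (algebraMap StepPoly StepField q) * f) {d : ℕ} (hd : 0 < d)
    (hlow : ∀ n : Fin 4 →₀ ℕ, n.degree < d → coeff n (taylor P) = 0) {n₀ : Fin 4 →₀ ℕ}
    (hn₀ : n₀.degree = d) (hne : coeff n₀ (taylor P) ≠ 0) :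
    Implies f {r | r ≠ 0 ∧ ∃ n : Fin 4 →₀ ℕ, n.degree = d ∧ coeff n (taylor P) = r} := by
  classical
  have hfin : {n : Fin 4 →₀ ℕ | n.degree = d ∧ coeff n (taylor P) ≠ 0}.Finite :=
    (Finsupp.finite_of_degree_le d).subset fun n hn => hn.1.le
  set s := hfin.toFinset with hs
  have hmem (n : Fin 4 →₀ ℕ) : n ∈ s ↔ n.degree = d ∧ coeff n (taylor P) ≠ 0 := by simp [hs]
  let e := s.equivFin
  refine ⟨q, hq, P, hP, d, hd, s.card, Finset.card_pos.2 ⟨n₀, (hmem _).2 ⟨hn₀, hne⟩⟩,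
    fun k => e.symm k, fun k => coeff (e.symm k : Fin 4 →₀ ℕ) (taylor P),
    Subtype.val_injective.comp e.symm.injective, fun k => ((hmem _).1 (e.symm k).2).1,
    fun k => ((hmem _).1 (e.symm k).2).2, ?_, fun n hn => ?_⟩
  · ext r
    constructor
    · rintro ⟨hr, n, hn, rfl⟩
      exact ⟨e ⟨n, (hmem n).2 ⟨hn, hr⟩⟩, by simp⟩
    · rintro ⟨k, rfl⟩
      exact ⟨((hmem _).1 (e.symm k).2).2, _, ((hmem _).1 (e.symm k).2).1, rfl⟩
  · by_cases hn' : n ∈ s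
    · rw [Finset.sum_eq_single (e ⟨n, hn'⟩)]
      · simp
      · intro k _ hk
        rw [if_neg]
        rintro rfl
        exact hk (by simp)
      · simp
    · rw [Finset.sum_eq_zero]
      · rcases hn.lt_or_eq with hlt | heq
        · exact hlow n hlt
        · by_contra hne'
          exact hn' ((hmem n).2 ⟨heq, hne'⟩)
      · intro k _
        rw [if_neg]
        rintro rfl
        exact hn' (e.symm k).2

/-- The set implied consists of the lowest coefficients of the expansion. The formal solution kills
the expansion of a right shift, which has the same lowest coefficients, and its constant part is the
identity modulo the differential ideal. -/
theorem sConsistent_discreteSystem :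
    SConsistent (Set.range discreteSystem) (Set.range pdeSystem) := by
  intro f hf hf0
  rw [← inversiveDifferenceIdeal_eq_perfectDifferenceIdeal] at hf
  obtain ⟨E, hC, hJ, hE⟩ := exists_seriesEval_eq_zero
  obtain ⟨s, hs⟩ := hE f hf
  obtain ⟨q, hq, P, hP⟩ := exists_map_eq_C_mul f
  have hP0 : P ≠ 0 := by
    rintro rfl
    rw [map_zero, eq_comm, mul_eq_zero, C_eq_zero, FaithfulSMul.algebraMap_eq_zero_iff] at hP
    exact hP.elim hq hf0
  -- The extra factor `τ` makes the constant term of the expansion vanish, so that the lowest degree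
  -- is positive.
  have hP' : MvPolynomial.map (algebraMap StepPoly StepField) (C (X 0) * P)
      = C (algebraMap StepPoly StepField (X 0 * q)) * f := by
    rw [map_mul, hP, map_C, map_mul, C_mul, mul_assoc]
  have hq' : X 0 * q ≠ 0 := mul_ne_zero (X_ne_zero 0) hq
  have hQ0 : C (X 0) * P ≠ 0 := mul_ne_zero (C_ne_zero.2 (X_ne_zero 0)) hP0
  generalize X 0 * q = q' at hP' hq'
  have hconst : constantCoeff (taylor (C (X 0) * P)) = 0 := by
    rw [map_mul, taylor_C, map_X, coe_X, map_mul, MvPowerSeries.constantCoeff_X, zero_mul]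
  generalize C (X 0) * P = Q at hP' hQ0 hconst
  have horder := MvPowerSeries.ne_zero_iff_order_finite.1 (taylor_ne_zero hQ0)
  obtain ⟨n₀, hne, hn₀⟩ := MvPowerSeries.exists_coeff_ne_zero_and_order horder
  have hlow (n : Fin 4 →₀ ℕ) (hn : n.degree < n₀.degree) : coeff n (taylor Q) = 0 :=
    MvPowerSeries.coeff_of_lt_order (by rw [← hn₀]; exact_mod_cast hn)
  have hpos : 0 < n₀.degree := by
    rw [pos_iff_ne_zero, Ne, Finsupp.degree_eq_zero_iff]
    rintro rfl
    exact hne hconst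
  refine ⟨_, ?_, implies_lowestCoeffs hq' hP' hpos hlow rfl hne⟩
  rintro _ ⟨-, n, hn, rfl⟩
  -- Evaluation in the fraction field vanishes, and power series embed into it.
  have hzero : extend E (taylor (polyShift (castShift s) Q)) = 0 := by
    have h1 := seriesEval_map hC (polyShift (castShift s) Q)
    rw [map_polyShift, hP', map_mul, map_mul, hs, mul_zero, eq_comm] at h1
    exact (FaithfulSMul.algebraMap_eq_zero_iff _ SeriesField).1 h1
  have hcoeff := coeff_taylor_polyShift hlow s
  have h2 : constantCoeff (E (coeff n (taylor Q))) = 0 := by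
    rw [← hcoeff n hn.le, ← coeff_extend_of_forall_lt, hzero, map_zero]
    intro m hm
    -- An exponent strictly below `n` has strictly smaller degree, so nothing mixes into the
    -- coefficient at `n` and `E` acts there through its constant part.
    have hdeg : m.degree < n₀.degree := by
      obtain ⟨k, rfl⟩ := exists_add_of_le hm.le
      have hk : k.degree ≠ 0 := fun hk =>
        hm.ne (by rw [(Finsupp.degree_eq_zero_iff k).1 hk, add_zero])
      rw [← hn, map_add]
      omega
    rw [hcoeff m hdeg.le, hlow m hdeg]
  have := hJ (coeff n (taylor Q))
  rwa [h2, sub_zero] at this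

end Consistency

end NavierStokes

end

theorem mainTheorem5 :
    -- the discrete system approximates the differential system
    (∀ j : Fin 4, NavierStokes.Implies (NavierStokes.discreteSystem j.castSucc)
      {NavierStokes.pdeSystem j.castSucc}) ∧
    NavierStokes.Implies (NavierStokes.discreteSystem 4)
      {NavierStokes.pdeSystem 4
        - NavierStokes.reynolds⁻¹ • NavierStokes.laplace (NavierStokes.pdeSystem 0)} ∧
    -- it is s-consistent with it
    NavierStokes.SConsistent (Set.range NavierStokes.discreteSystem)
      (Set.range NavierStokes.pdeSystem) ∧
    -- with negative shifts removed, it is a head reduced Gröbner basis of the difference ideal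
    -- it generates, and that ideal is the generated ideal of the system up to right shifts
    NavierStokes.IsAdmissibleOrdering NavierStokes.rankLT NavierStokes.lexLT ∧
    (∃ G : Fin 5 → NavierStokes.ShiftPoly ℕ,
      (∀ j, NavierStokes.natInclusion (G j)
        = NavierStokes.shift (NavierStokes.clearing j) (NavierStokes.discreteSystem j)) ∧
      NavierStokes.IsGroebnerBasis NavierStokes.lexLT (Set.range G)
        (NavierStokes.differenceIdeal (Set.range G)) ∧
      NavierStokes.IsHeadReduced NavierStokes.lexLT (Set.range G) ∧
      (∀ f : NavierStokes.ShiftPoly ℤ,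
        f ∈ NavierStokes.inversiveDifferenceIdeal (Set.range NavierStokes.discreteSystem) ↔
          ∃ s : Fin 4 → ℕ, ∃ g ∈ NavierStokes.differenceIdeal (Set.range G),
            NavierStokes.natInclusion g
              = NavierStokes.shift (fun i => (s i : ℤ)) f)) ∧
    -- the generated ideal equals its perfect closure
    NavierStokes.inversiveDifferenceIdeal (Set.range NavierStokes.discreteSystem)
      = NavierStokes.perfectDifferenceIdeal (Set.range NavierStokes.discreteSystem) := by
  exact ⟨NavierStokes.implies_discreteSystem, NavierStokes.implies_discretePoisson,
    NavierStokes.sConsistent_discreteSystem, NavierStokes.isAdmissibleOrdering_lexLT,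
    ⟨NavierStokes.clearedSystem, NavierStokes.natInclusion_clearedSystem,
      NavierStokes.isGroebnerBasis_clearedSystem, NavierStokes.isHeadReduced_clearedSystem,
      NavierStokes.mem_inversiveDifferenceIdeal_iff⟩,
    NavierStokes.inversiveDifferenceIdeal_eq_perfectDifferenceIdeal⟩
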